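/- Let $\kappa,\tau,H\in\mathbb{R}$ with $\tau\neq 0$, and put $\kappa'=\kappa/4$, $\sigma=\kappa/(2\tau)$. Let $\mathbb{E}^3(\kappa,\tau)$ be the set of $(w=x_1+ix_2,x_3)\in\mathbb{C}\times\mathbb{R}$ with $1+\kappa'|w|^2>0$, with the metric $$ds^2=\lambda^2|dw|^2+\big(\tau\lambda(x_2dx_1-x_1dx_2)+dx_3\big)^2,\qquad \lambda=\frac{1}{1+\kappa'|w|^2},$$ and the orientation $dx_1\wedge dx_2\wedge dx_3$. Consider the isometries $$\mathcal{S}_1(t)(w,x_3)=\Big(\tfrac{t+w}{1-\kappa'tw},\;x_3+\tfrac{4}{\sigma}\arctan\tfrac{\kappa'tx_2}{1-\kappa'tx_1+|1-\kappa'tw|}\Big),$$ $$\mathcal{S}_2(t)(w,x_3)=\Big(\tfrac{it+w}{1+i\kappa'tw},\;x_3-\tfrac{4}{\sigma}\arctan\tfrac{\kappa'tx_1}{1-\kappa'tx_2+|1+i\kappa'tw|}\Big),$$ $$\mathcal{S}_3(t)(w,x_3)=(w,x_3+t),\qquad \mathcal{S}_R(t)(w,x_3)=(we^{it},x_3)$$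 (for $\kappa=0$ the vertical terms of $\mathcal{S}_1(t)$, $\mathcal{S}_2(t)$ are the limits $x_3+\tau tx_2$ and $x_3-\tau tx_1$), where $1+\kappa't^2>0$ for $\mathcal{S}_1(t)$ and $\mathcal{S}_2(t)$, each on the set of points where the denominators of its formula do not vanish (everything if $\kappa\le 0$). Their infinitesimal generators are $$S_1=(1+\kappa'(x_1^2-x_2^2))\partial_{x_1}+2\kappa'x_1x_2\partial_{x_2}+\tau x_2\partial_{x_3},\qquad S_2=2\kappa'x_1x_2\partial_{x_1}+(1-\kappa'(x_1^2-x_2^2))\partial_{x_2}-\tau x_1\partial_{x_3},$$ $$S_3=\partial_{x_3},\qquad S_R=-x_2\partial_{x_1}+x_1\partial_{x_2}.$$ Let $\Sigma$ be a connected smooth surface and $f:\Sigma\to\mathbb{E}^3(\kappa,\tau)$ a smooth immersion, oriented by a smooth unit normal $N$, with constant mean curvature $H=\frac12\operatorname{tr}(-\nabla N)$ (minimal if $H=0$). For $i\in\{1,2,3,R\}$ let $F_i$ be any smooth vector field on $\mathbb{E}^3(\kappa,\tau)$ with $\operatorname{rot}F_i=S_i$, let $$\mu_i=\operatorname{vol}(N,S_i\circ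 f,df)-2H\,\langle F_i\circ f,df\rangle$$ be the Noether form on $\Sigma$ associated with $S_i$, and $\sigma_i(c)=\int_c\mu_i$ for a cycle $c$ (a smooth singular $1$-cycle of $\Sigma$ with integer coefficients). Then: (i) (One translation.) Let $t\neq0$ with $1+\kappa't^2>0$, and suppose that $f(\Sigma)$ lies in the domain of $\mathcal{S}_1(t)$ (resp. $\mathcal{S}_2(t)$) and that $f$ is invariant under it: $f\circ\psi=\mathcal{S}_1(t)\circ f$ (resp. $\mathcal{S}_2(t)\circ f$) for a diffeomorphism $\psi$ of $\Sigma$. If $c$ is a cycle homologous to its image $\psi(c)$, then $\sigma_2(c)=\sigma_3(c)=0$ (resp. $\sigma_1(c)=\sigma_3(c)=0$) if $\kappa=0$, and $\sigma_2(c)=\kappa\sigma_R(c)+2\tau\sigma_3(c)=0$ (resp. $\sigma_1(c)=\kappa\sigma_R(c)+2\tau\sigma_3(c)=0$) if $\kappa\neq0$. (i') (The one-parameter family of translations.) Suppose that for some $\varepsilon>0$ and every $|t|<\varepsilon$, $f(\Sigma)$ lies in the domain of $\mathcal{S}_1(t)$ (resp. $\mathcal{S}_2(t)$) and there is a diffeomorphism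 $\psi_t$ of $\Sigma$ with $f\circ\psi_t=\mathcal{S}_1(t)\circ f$ (resp. $\mathcal{S}_2(t)\circ f$). Then, in $H^1(\Sigma)$ (that is, up to exact forms), $\mu_2=\mu_3=0$ (resp. $\mu_1=\mu_3=0$) if $\kappa=0$, and $\mu_2=\kappa\mu_R+2\tau\mu_3=0$ (resp. $\mu_1=\kappa\mu_R+2\tau\mu_3=0$) if $\kappa\neq0$. (ii) (Rotation.) Let $t\notin2\pi\mathbb{Z}$ and suppose that $f\circ\psi=\mathcal{S}_R(t)\circ f$ for a diffeomorphism $\psi$ of $\Sigma$; if $H=0$ and $\cos t=-1$, suppose moreover that $\psi$ respects the orientation of the immersion, i.e. $N\circ\psi=d\mathcal{S}_R(t)\cdot N$. If $c$ is a cycle homologous to its image $\psi(c)$, then $\sigma_1(c)=\sigma_2(c)=0$. -/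

import Mathlib

open scoped Manifold ContDiff

noncomputable section

namespace NoetherE3

/-! ### The homogeneous space `E³(κ, τ)`

The model is the open set `Ω_κ × ℝ` of `ℝ³`, where `Ω_κ` is the plane if `0 ≤ κ` and the open disk
of radius `2 |κ|^(-1/2)` if `κ < 0`. The coordinates `(x₁, x₂, x₃)` are `x 0`, `x 1`, `x 2`. -/

/-- Coordinate space of the model (tangent vectors are also written in coordinates). -/
abbrev R3 : Type := Fin 3 → ℝ

/-- The domain `Ω_κ × ℝ`: the condition `0 < 1 + (κ/4)|w|²` is void for `0 ≤ κ` and means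
`|w| < 2 |κ|^(-1/2)` for `κ < 0`. -/
def E3 (κ : ℝ) : Set R3 := {x | 0 < 1 + κ / 4 * (x 0 ^ 2 + x 1 ^ 2)}

/-- The conformal factor `λ = 1 / (1 + (κ/4)|w|²)`. -/
def lam (κ : ℝ) (x : R3) : ℝ := 1 / (1 + κ / 4 * (x 0 ^ 2 + x 1 ^ 2))

/-- The `1`-form `τ λ (x₂ dx₁ - x₁ dx₂) + dx₃`. -/
def vert (κ τ : ℝ) (x u : R3) : ℝ := τ * lam κ x * (x 1 * u 0 - x 0 * u 1) + u 2

/-- The riemannian metric `λ² |dw|² + (τ λ (x₂ dx₁ - x₁ dx₂) + dx₃)²`. -/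
def metric (κ τ : ℝ) (x u v : R3) : ℝ :=
  lam κ x ^ 2 * (u 0 * v 0 + u 1 * v 1) + vert κ τ x u * vert κ τ x v

/-- The riemannian volume form of `metric κ τ` for the orientation `dx₁ ∧ dx₂ ∧ dx₃`; the square
root of the determinant of the metric is `λ²`. -/
def vol (κ : ℝ) (x u v w : R3) : ℝ := lam κ x ^ 2 * (Matrix.of ![u, v, w]).det

/-- Christoffel symbols of the first kind of the Levi-Civita connection: `⟨∇_u v, w⟩` for the
coordinate-constant vector fields `u`, `v`, `w`. -/
def christoffel (κ τ : ℝ) (x u v w : R3) : ℝ :=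
  (fderiv ℝ (fun y => metric κ τ y v w) x u + fderiv ℝ (fun y => metric κ τ y u w) x v
    - fderiv ℝ (fun y => metric κ τ y u v) x w) / 2

/-- `F` is a potential vector of `S`, i.e. a smooth vector field on `E³(κ, τ)` with `rot F = S`.
As `rot F = (* d F^♭)^♯`, this means `d F^♭ = * S^♭ = S ⌟ vol`. -/
def IsPotential (κ τ : ℝ) (F S : R3 → R3) : Prop :=
  ContDiffOn ℝ ∞ F (E3 κ) ∧
    ∀ x ∈ E3 κ, ∀ u v : R3,
      fderiv ℝ (fun y => metric κ τ y (F y) v) x u - fderiv ℝ (fun y => metric κ τ y (F y) u) x v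
        = vol κ x (S x) u v

/-! ### One-parameter families of isometries and their infinitesimal generators -/

/-- The infinitesimal generator `S₁` of the translations `trans1`. -/
def S1 (κ τ : ℝ) (x : R3) : R3 :=
  ![1 + κ / 4 * (x 0 ^ 2 - x 1 ^ 2), 2 * (κ / 4) * x 0 * x 1, τ * x 1]

/-- The infinitesimal generator `S₂` of the translations `trans2`. -/
def S2 (κ τ : ℝ) (x : R3) : R3 :=
  ![2 * (κ / 4) * x 0 * x 1, 1 - κ / 4 * (x 0 ^ 2 - x 1 ^ 2), -(τ * x 0)]

/-- The infinitesimal generator `S₃` of the vertical translations. -/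
def S3 (_x : R3) : R3 := ![0, 0, 1]

/-- The infinitesimal generator `S_R` of the rotations. -/
def SR (x : R3) : R3 := ![-x 1, x 0, 0]

/-- The complex coordinate `w = x₁ + i x₂`. -/
def base (x : R3) : ℂ := ⟨x 0, x 1⟩

/-- The translation `𝒮₁(t)`, with `σ = κ / (2 τ)`; for `κ = 0` the vertical term is the limit
`τ t x₂` of the general expression. -/
def trans1 (κ τ t : ℝ) (x : R3) : R3 :=
  let D : ℂ := 1 - ((κ / 4 * t : ℝ) : ℂ) * base x
  let W : ℂ := ((t : ℂ) + base x) / D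
  ![W.re, W.im,
    x 2 + if κ = 0 then τ * t * x 1
      else 4 / (κ / (2 * τ)) * Real.arctan (κ / 4 * t * x 1 / (1 - κ / 4 * t * x 0 + ‖D‖))]

/-- The translation `𝒮₂(t)`, with `σ = κ / (2 τ)`; for `κ = 0` the vertical term is the limit
`- τ t x₁` of the general expression. -/
def trans2 (κ τ t : ℝ) (x : R3) : R3 :=
  let D : ℂ := 1 + Complex.I * ((κ / 4 * t : ℝ) : ℂ) * base x
  let W : ℂ := (Complex.I * (t : ℂ) + base x) / D
  ![W.re, W.im,
    x 2 - if κ = 0 then τ * t * x 0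
      else 4 / (κ / (2 * τ)) * Real.arctan (κ / 4 * t * x 0 / (1 - κ / 4 * t * x 1 + ‖D‖))]

/-- The rotation `𝒮_R(t)`. -/
def transR (t : ℝ) (x : R3) : R3 :=
  let W : ℂ := base x * Complex.exp ((t : ℂ) * Complex.I)
  ![W.re, W.im, x 2]

/-- The points of the model where the formula for `𝒮₁(t)` makes sense, i.e. where its denominators
do not vanish: everything if `κ ≤ 0` (and `0 < 1 + (κ/4) t²`), the complement of a half plane
`{x₂ = 0, (κ/4) t x₁ ≥ 1}` if `0 < κ`. -/
def dom1 (κ t : ℝ) : Set R3 :=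
  {x | 0 < 1 - κ / 4 * t * x 0 + ‖(1 : ℂ) - ((κ / 4 * t : ℝ) : ℂ) * base x‖}

/-- The points of the model where the formula for `𝒮₂(t)` makes sense. -/
def dom2 (κ t : ℝ) : Set R3 :=
  {x | 0 < 1 - κ / 4 * t * x 1 + ‖(1 : ℂ) + Complex.I * ((κ / 4 * t : ℝ) : ℂ) * base x‖}

/-! ### Surfaces -/

/-- Model of surfaces. -/
abbrev R2 : Type := EuclideanSpace ℝ (Fin 2)

section Surface

variable {M : Type*} [TopologicalSpace M] [ChartedSpace R2 M]

/-- The differential of a map from a surface to `ℝ³`. -/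
def dmap (f : M → R3) (p : M) (v : TangentSpace (𝓡 2) p) : R3 :=
  mfderiv (𝓡 2) 𝓘(ℝ, R3) f p v

/-- `⟨∇_v N, df(w)⟩` for a vector field `N` along `f`, with `∇` the Levi-Civita connection of
`E³(κ, τ)` pulled back by `f`. -/
def covInner (κ τ : ℝ) (f N : M → R3) (p : M) (v w : TangentSpace (𝓡 2) p) : ℝ :=
  metric κ τ (f p) (dmap N p v) (dmap f p w)
    + christoffel κ τ (f p) (dmap f p v) (N p) (dmap f p w)

/-- `f` is a smooth immersion in `E³(κ, τ)`, oriented by the smooth unit normal `N`, of constant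
mean curvature `H` with respect to `N` (minimal if `H = 0`): half the trace of the shape operator
`- ∇N` is `H` at every point. -/
structure IsCMCImmersion (κ τ H : ℝ) (f N : M → R3) : Prop where
  smooth : ContMDiff (𝓡 2) 𝓘(ℝ, R3) ∞ f
  mem : ∀ p, f p ∈ E3 κ
  immersion : ∀ p, Function.Injective (dmap f p)
  smooth_normal : ContMDiff (𝓡 2) 𝓘(ℝ, R3) ∞ N
  unit : ∀ p, metric κ τ (f p) (N p) (N p) = 1
  normal : ∀ p v, metric κ τ (f p) (N p) (dmap f p v) = 0
  meanCurvature : ∀ p, ∀ u v : TangentSpace (𝓡 2) p,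
    metric κ τ (f p) (dmap f p u) (dmap f p u) = 1 →
    metric κ τ (f p) (dmap f p v) (dmap f p v) = 1 →
    metric κ τ (f p) (dmap f p u) (dmap f p v) = 0 →
    -(covInner κ τ f N p u u + covInner κ τ f N p v v) / 2 = H

/-- `1`-forms on a surface (no regularity). -/
abbrev OneForm (M : Type*) [TopologicalSpace M] [ChartedSpace R2 M] : Type _ :=
  ∀ p : M, TangentSpace (𝓡 2) p → ℝ

/-- The Noether form `μ_S = S ⌟ Λ₀ - 2 H F^♭` pulled back to the surface, for a Killing field `S`
with potential vector `F`; here `S ⌟ Λ₀ = vol(N, S, ·) = ⟨S, *df⟩`. -/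
def noetherForm (κ τ H : ℝ) (f N S F : M → R3) : OneForm M := fun p v =>
  vol κ (f p) (N p) (S p) (dmap f p v) - 2 * H * metric κ τ (f p) (F p) (dmap f p v)

/-- The smooth `1`-form `η` vanishes in `H¹(M)`, i.e. it is exact. -/
def IsExact (η : OneForm M) : Prop :=
  ∃ h : M → ℝ, ContMDiff (𝓡 2) 𝓘(ℝ, ℝ) ∞ h ∧
    ∀ (p : M) (v : TangentSpace (𝓡 2) p), (mfderiv (𝓡 2) 𝓘(ℝ, ℝ) h p v : ℝ) = η p v

/-! ### Smooth singular chains with integer coefficients -/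

variable (M) in
/-- Smooth singular `n`-simplices: maps from the standard simplex to `M` that extend to a smooth
map on the ambient vector space. -/
def Simplex (n : ℕ) : Type _ :=
  {γ : stdSimplex ℝ (Fin (n + 1)) → M //
    ∃ g : (Fin (n + 1) → ℝ) → M, ContMDiff 𝓘(ℝ, Fin (n + 1) → ℝ) (𝓡 2) ∞ g ∧
      ∀ x : stdSimplex ℝ (Fin (n + 1)), g x.1 = γ x}

/-- The `i`-th face of a smooth simplex. -/
def face {n : ℕ} (γ : Simplex M (n + 1)) (i : Fin (n + 2)) : Simplex M n :=
  ⟨fun x => γ.1 (stdSimplex.map (Fin.succAbove i) x), by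
    obtain ⟨g, hg, hγ⟩ := γ.2
    refine ⟨g ∘ (LinearMap.toContinuousLinearMap
      (FunOnFinite.linearMap ℝ ℝ (Fin.succAbove i))),
      hg.comp (ContinuousLinearMap.contMDiff _), fun x => hγ (stdSimplex.map (Fin.succAbove i) x)⟩⟩

variable (M) in
/-- Smooth singular `n`-chains. -/
abbrev Chain (n : ℕ) : Type _ := Simplex M n →₀ ℤ

/-- The boundary operator. -/
def boundary {n : ℕ} (c : Chain M (n + 1)) : Chain M n :=
  c.sum fun γ k => ∑ i : Fin (n + 2), Finsupp.single (face γ i) ((-1) ^ (i : ℕ) * k)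

/-- The `1`-chain `c` is a cycle. -/
def IsCycle (c : Chain M 1) : Prop := boundary c = 0

/-- The `1`-chains `c` and `c'` are homologous. -/
def Homologous (c c' : Chain M 1) : Prop := ∃ b : Chain M 2, boundary b = c' - c

/-- The image of a smooth simplex under a smooth map. -/
def Simplex.push {n : ℕ} (ψ : M ≃ₘ^∞⟮𝓡 2, 𝓡 2⟯ M) (γ : Simplex M n) : Simplex M n :=
  ⟨fun x => ψ (γ.1 x), by
    obtain ⟨g, hg, hγ⟩ := γ.2
    exact ⟨ψ ∘ g, ψ.contMDiff.comp hg, fun x => congrArg ψ (hγ x)⟩⟩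

/-- The image of a chain under a diffeomorphism. -/
def Chain.push {n : ℕ} (ψ : M ≃ₘ^∞⟮𝓡 2, 𝓡 2⟯ M) (c : Chain M n) : Chain M n :=
  Finsupp.mapDomain (Simplex.push ψ) c

/-- A `1`-simplex as a path, `s ↦ γ (1 - s, s)` for `0 ≤ s ≤ 1`. -/
def path (γ : Simplex M 1) (s : ℝ) : M :=
  γ.1 (stdSimplexHomeomorphUnitInterval.symm (Set.projIcc 0 1 zero_le_one s))

/-- The integral of a `1`-form along a `1`-chain. -/
def integral (η : OneForm M) (c : Chain M 1) : ℝ :=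
  c.sum fun γ k => (k : ℝ) *
    ∫ s in (0 : ℝ)..1, η (path γ s) (mfderiv 𝓘(ℝ, ℝ) (𝓡 2) (path γ) s (1 : ℝ))

end Surface

end NoetherE3

end

/-! Constant mean curvature and the Killing equation make each Noether form closed. In the pullback
to the surface, the exterior derivative of `vol(N, S, df)` is `2H vol(S, df, df)`, and the term `-2H
F^♭` cancels it because `rot F = S` (`noetherForm_closed`).

Invariance under one isometry. Let `Φ` be an isometry with `f ∘ ψ = Φ ∘ f`. Then `N ∘ ψ = ε dΦ(N)`
with a constant sign `ε`, and `ε = -1` forces `H = 0`. The inverse differential of `Φ` sends the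
Killing field with coefficients `c` to the one with coefficients `A c`. Hence the pullback by `ψ` of
the Noether form of `c` is `ε` times that of `A c`, up to an exact form. This exact form appears
because two potentials of the same field differ by a closed field, which is a gradient on a
star-shaped domain. If `z` is a cycle homologous to `ψ(z)`, Stokes gives `σ_c(z) = ε σ_{Ac}(z)`
(`integral_noetherForm`). This is a linear system for the four periods. Solving it gives
`periods_of_translation` and `periods_of_rotation`. Translations need no orientation hypothesis,
since the system with `ε = -1` also forces the claimed vanishing.

Invariance under a family of translations. The diffeomorphisms `ψ_t` need not depend continuously on
`t`. Since the surface is second countable, the points `ψ_t(p)` nevertheless accumulate along some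
parameters, and this makes the generator `T` tangent to the surface (`exists_tangent`). When `T` is
tangent, Cartan's formula suggests that the Noether form of the bracket of `T` with any Killing
field `S` is the differential of the contraction with `T` of the Noether form of `S`. An explicit
primitive `vol(N, S, T) - 2H k` is checked directly (`isExact_noetherForm_bracket`), so de Rham's
theorem is not needed. The brackets with `S₁` are spanned by `S₂` and `κ S_R + 2τ S₃`, and those
with `S₂` by `S₁` and the same field.

All local geometry is computed in a global orthonormal frame, where the metric is the dot product,
the volume is the triple product and the connection is a cross product. -/

noncomputable section

namespace NoetherE3

open scoped Matrix

/-! ### The orthonormal coframe -/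

/-- The derivative of `lam κ` at `x` in the direction `h`. -/
def dlam (κ : ℝ) (x h : R3) : ℝ := -(κ / 2) * lam κ x ^ 2 * (x 0 * h 0 + x 1 * h 1)

/-- Components of the tangent vector `u` at `x` in an orthonormal frame. -/
def coframe (κ τ : ℝ) (x u : R3) : R3 := ![lam κ x * u 0, lam κ x * u 1, vert κ τ x u]

/-- The derivative of `x ↦ coframe κ τ x u` in the direction `h`. -/
def dcoframe (κ τ : ℝ) (x h u : R3) : R3 :=
  ![dlam κ x h * u 0, dlam κ x h * u 1,
    τ * (dlam κ x h * (x 1 * u 0 - x 0 * u 1) + lam κ x * (h 1 * u 0 - h 0 * u 1))]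

/-- The Levi-Civita connection form in the orthonormal frame, as a vector acting by cross
product. -/
def connection (κ τ : ℝ) (x h : R3) : R3 :=
  ![τ * (lam κ x * h 0), τ * (lam κ x * h 1),
    -(τ * vert κ τ x h) + κ / 2 * lam κ x * (x 1 * h 0 - x 0 * h 1)]

/-- Components in the orthonormal frame of the covariant derivative in the direction `h` of a
vector field with value `u` and coordinate derivative `u'`. -/
def cov (κ τ : ℝ) (x h u u' : R3) : R3 :=
  coframe κ τ x u' + dcoframe κ τ x h u + connection κ τ x h ⨯₃ coframe κ τ x u

/-- The triple product. -/
def triple (a b c : R3) : ℝ := a ⬝ᵥ (b ⨯₃ c)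

lemma triple_apply (a b c : R3) : triple a b c =
    a 0 * (b 1 * c 2 - b 2 * c 1) + a 1 * (b 2 * c 0 - b 0 * c 2)
      + a 2 * (b 0 * c 1 - b 1 * c 0) := by
  simp [triple, cross_apply, dotProduct, Fin.sum_univ_three]

lemma dot_apply (a b : R3) : a ⬝ᵥ b = a 0 * b 0 + a 1 * b 1 + a 2 * b 2 := by
  simp [dotProduct, Fin.sum_univ_three]

section Coframe

variable {κ τ : ℝ} {x : R3}

lemma metric_eq_dot (κ τ : ℝ) (x u v : R3) :
    metric κ τ x u v = coframe κ τ x u ⬝ᵥ coframe κ τ x v := by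
  simp [metric, coframe]; ring

lemma vol_eq_triple (κ τ : ℝ) (x u v w : R3) :
    vol κ x u v w = triple (coframe κ τ x u) (coframe κ τ x v) (coframe κ τ x w) := by
  simp [vol, coframe, triple_apply, Matrix.det_fin_three, vert]; ring

lemma lam_mul (hx : x ∈ E3 κ) : lam κ x * (1 + κ / 4 * (x 0 ^ 2 + x 1 ^ 2)) = 1 := by
  have h : 0 < 1 + κ / 4 * (x 0 ^ 2 + x 1 ^ 2) := hx
  exact one_div_mul_cancel h.ne'

lemma lam_pos (hx : x ∈ E3 κ) : 0 < lam κ x := one_div_pos.2 hx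

lemma coframe_add (κ τ : ℝ) (x u v : R3) :
    coframe κ τ x (u + v) = coframe κ τ x u + coframe κ τ x v := by
  ext i; fin_cases i <;> simp [coframe, vert] <;> ring

lemma coframe_smul (κ τ : ℝ) (x : R3) (r : ℝ) (u : R3) :
    coframe κ τ x (r • u) = r • coframe κ τ x u := by
  ext i; fin_cases i <;> simp [coframe, vert] <;> ring

/-- The coframe as a linear map. -/
def coframeₗ (κ τ : ℝ) (x : R3) : R3 →ₗ[ℝ] R3 where
  toFun := coframe κ τ x
  map_add' := coframe_add κ τ x
  map_smul' := coframe_smul κ τ x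

lemma coframe_injective (hx : x ∈ E3 κ) : Function.Injective (coframe κ τ x) := by
  have h := (lam_pos hx).ne'
  refine (injective_iff_map_eq_zero (coframeₗ κ τ x)).2 fun u hu => ?_
  have h0 : lam κ x * u 0 = 0 := congrFun hu 0
  have h1 : lam κ x * u 1 = 0 := congrFun hu 1
  have h2 : vert κ τ x u = 0 := congrFun hu 2
  have h0' : u 0 = 0 := by simpa [h] using h0
  have h1' : u 1 = 0 := by simpa [h] using h1
  have h2' : u 2 = 0 := by simpa [vert, h0', h1'] using h2
  ext i; fin_cases i <;> assumption

/-- The connection is torsion free. -/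
lemma cov_sub_cov (hx : x ∈ E3 κ) (u v u' v' : R3) :
    cov κ τ x u v v' - cov κ τ x v u u' = coframe κ τ x (v' - u') := by
  have h := lam_mul hx
  ext i; fin_cases i
  · simp [cov, coframe, dcoframe, connection, cross_apply, vert, dlam]; ring
  · simp [cov, coframe, dcoframe, connection, cross_apply, vert, dlam]; ring
  · simp [cov, coframe, dcoframe, connection, cross_apply, vert, dlam]
    -- This is the structure equation `dθ³ = -2τ θ¹ ∧ θ²`, the only component that needs `λ (1 +
    -- (κ/4)|w|²) = 1`.
    linear_combination (2 * τ * lam κ x * (u 1 * v 0 - u 0 * v 1)) * (-h)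

end Coframe

/-! ### Covariant differentiation of the metric and the volume along maps -/

section Calculus

variable {E : Type*} [NormedAddCommGroup E] [NormedSpace ℝ E] {κ τ : ℝ} {x : E}
  {φ a b c : E → R3}

lemma hasFDerivAt_lam (hφ : DifferentiableAt ℝ φ x) (hx : φ x ∈ E3 κ) :
    DifferentiableAt ℝ (fun y => lam κ (φ y)) x ∧
      ∀ u, fderiv ℝ (fun y => lam κ (φ y)) x u = dlam κ (φ x) (fderiv ℝ φ x u) := by
  have hx' : 1 + κ / 4 * (φ x 0 ^ 2 + φ x 1 ^ 2) ≠ 0 := ne_of_gt hx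
  have h := hφ.hasFDerivAt
  rw [hasFDerivAt_pi'] at h
  have key := (hasDerivAt_inv hx').comp_hasFDerivAt x
    ((((h 0).pow 2).add ((h 1).pow 2)).const_mul (κ / 4) |>.const_add 1)
  have e : (fun y => lam κ (φ y)) = Inv.inv ∘ fun y => 1 + κ / 4 * (φ y 0 ^ 2 + φ y 1 ^ 2) := by
    ext y; simp [lam]
  rw [e]
  refine ⟨key.differentiableAt, fun u => ?_⟩
  refine (congrArg (· u) key.fderiv).trans ?_
  simp [dlam, lam]
  field_simp
  ring

lemma hasFDerivAt_coframe (hφ : DifferentiableAt ℝ φ x) (ha : DifferentiableAt ℝ a x)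
    (hx : φ x ∈ E3 κ) :
    DifferentiableAt ℝ (fun y => coframe κ τ (φ y) (a y)) x ∧
      ∀ u, fderiv ℝ (fun y => coframe κ τ (φ y) (a y)) x u =
        coframe κ τ (φ x) (fderiv ℝ a x u) + dcoframe κ τ (φ x) (fderiv ℝ φ x u) (a x) := by
  obtain ⟨hl, hl'⟩ := hasFDerivAt_lam hφ hx
  have h := hφ.hasFDerivAt
  rw [hasFDerivAt_pi'] at h
  have k := ha.hasFDerivAt
  rw [hasFDerivAt_pi'] at k
  have h0 := hl.hasFDerivAt.mul (k 0)
  have h1 := hl.hasFDerivAt.mul (k 1)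
  have h2 := ((hl.hasFDerivAt.const_mul τ).mul (((h 1).mul (k 0)).sub ((h 0).mul (k 1)))).add (k 2)
  have d : DifferentiableAt ℝ (fun y => coframe κ τ (φ y) (a y)) x := by
    rw [differentiableAt_pi]
    intro i; fin_cases i
    exacts [h0.differentiableAt, h1.differentiableAt, h2.differentiableAt]
  refine ⟨d, fun u => ?_⟩
  have hd := d.hasFDerivAt
  rw [hasFDerivAt_pi'] at hd
  have e : ∀ i, fderiv ℝ (fun y => coframe κ τ (φ y) (a y)) x u i
      = fderiv ℝ (fun y => coframe κ τ (φ y) (a y) i) x u := fun i => by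
    rw [(hd i).fderiv]; rfl
  ext i
  rw [e]
  fin_cases i
  · refine (congrArg (· u) h0.fderiv).trans ?_
    simp [hl', coframe, dcoframe]; ring
  · refine (congrArg (· u) h1.fderiv).trans ?_
    simp [hl', coframe, dcoframe]; ring
  · refine (congrArg (· u) h2.fderiv).trans ?_
    simp [hl', coframe, dcoframe, vert]; ring

lemma differentiableAt_metric (hφ : DifferentiableAt ℝ φ x) (ha : DifferentiableAt ℝ a x)
    (hb : DifferentiableAt ℝ b x) (hx : φ x ∈ E3 κ) :
    DifferentiableAt ℝ (fun y => metric κ τ (φ y) (a y) (b y)) x := by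
  have h := (hasFDerivAt_coframe (τ := τ) hφ ha hx).1
  have k := (hasFDerivAt_coframe (τ := τ) hφ hb hx).1
  rw [differentiableAt_pi] at h k
  simp only [metric_eq_dot, dot_apply]
  exact ((((h 0).mul (k 0)).add ((h 1).mul (k 1))).add ((h 2).mul (k 2)))

/-- Metric compatibility: the `connection` terms cancel because the cross product with a fixed
vector is skew. -/
lemma fderiv_metric (hφ : DifferentiableAt ℝ φ x) (ha : DifferentiableAt ℝ a x)
    (hb : DifferentiableAt ℝ b x) (hx : φ x ∈ E3 κ) (u : E) :
    fderiv ℝ (fun y => metric κ τ (φ y) (a y) (b y)) x u =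
      cov κ τ (φ x) (fderiv ℝ φ x u) (a x) (fderiv ℝ a x u) ⬝ᵥ coframe κ τ (φ x) (b x)
      + coframe κ τ (φ x) (a x) ⬝ᵥ cov κ τ (φ x) (fderiv ℝ φ x u) (b x) (fderiv ℝ b x u) := by
  obtain ⟨h, h'⟩ := hasFDerivAt_coframe (τ := τ) hφ ha hx
  obtain ⟨k, k'⟩ := hasFDerivAt_coframe (τ := τ) hφ hb hx
  have hh := h.hasFDerivAt
  have kk := k.hasFDerivAt
  rw [hasFDerivAt_pi'] at hh kk
  simp only [metric_eq_dot, dot_apply]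
  have key := (((hh 0).mul (kk 0)).add ((hh 1).mul (kk 1))).add ((hh 2).mul (kk 2))
  refine (congrArg (· u) key.fderiv).trans ?_
  simp [h', k', cov, cross_apply]
  ring

lemma differentiableAt_vol (hφ : DifferentiableAt ℝ φ x) (ha : DifferentiableAt ℝ a x)
    (hb : DifferentiableAt ℝ b x) (hc : DifferentiableAt ℝ c x) (hx : φ x ∈ E3 κ) :
    DifferentiableAt ℝ (fun y => vol κ (φ y) (a y) (b y) (c y)) x := by
  -- The volume does not involve `τ`, so the coframe with `τ = 0` serves as well as any other.
  have h := (hasFDerivAt_coframe (τ := 0) hφ ha hx).1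
  have k := (hasFDerivAt_coframe (τ := 0) hφ hb hx).1
  have l := (hasFDerivAt_coframe (τ := 0) hφ hc hx).1
  rw [differentiableAt_pi] at h k l
  simp only [vol_eq_triple κ 0, triple_apply]
  exact ((((h 0).mul (((k 1).mul (l 2)).sub ((k 2).mul (l 1)))).add
    ((h 1).mul (((k 2).mul (l 0)).sub ((k 0).mul (l 2))))).add
    ((h 2).mul (((k 0).mul (l 1)).sub ((k 1).mul (l 0)))))

/-- The volume form is parallel: the `connection` terms cancel because infinitesimal rotations
preserve the triple product. -/
lemma fderiv_vol (τ : ℝ) (hφ : DifferentiableAt ℝ φ x) (ha : DifferentiableAt ℝ a x)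
    (hb : DifferentiableAt ℝ b x) (hc : DifferentiableAt ℝ c x) (hx : φ x ∈ E3 κ) (u : E) :
    fderiv ℝ (fun y => vol κ (φ y) (a y) (b y) (c y)) x u =
      triple (cov κ τ (φ x) (fderiv ℝ φ x u) (a x) (fderiv ℝ a x u))
        (coframe κ τ (φ x) (b x)) (coframe κ τ (φ x) (c x))
      + triple (coframe κ τ (φ x) (a x))
        (cov κ τ (φ x) (fderiv ℝ φ x u) (b x) (fderiv ℝ b x u)) (coframe κ τ (φ x) (c x))
      + triple (coframe κ τ (φ x) (a x)) (coframe κ τ (φ x) (b x))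
        (cov κ τ (φ x) (fderiv ℝ φ x u) (c x) (fderiv ℝ c x u)) := by
  obtain ⟨h, h'⟩ := hasFDerivAt_coframe (τ := τ) hφ ha hx
  obtain ⟨k, k'⟩ := hasFDerivAt_coframe (τ := τ) hφ hb hx
  obtain ⟨l, l'⟩ := hasFDerivAt_coframe (τ := τ) hφ hc hx
  have hh := h.hasFDerivAt
  have kk := k.hasFDerivAt
  have ll := l.hasFDerivAt
  rw [hasFDerivAt_pi'] at hh kk ll
  simp only [vol_eq_triple κ τ, triple_apply]
  have key := ((((hh 0).mul (((kk 1).mul (ll 2)).sub ((kk 2).mul (ll 1)))).add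
    ((hh 1).mul (((kk 2).mul (ll 0)).sub ((kk 0).mul (ll 2))))).add
    ((hh 2).mul (((kk 0).mul (ll 1)).sub ((kk 1).mul (ll 0)))))
  refine (congrArg (· u) key.fderiv).trans ?_
  simp [h', k', l', cov, cross_apply]
  ring

/-- The Koszul formula. -/
lemma metric_add_christoffel {x : R3} (hx : x ∈ E3 κ) (u v w v' : R3) :
    metric κ τ x v' w + christoffel κ τ x u v w = cov κ τ x u v v' ⬝ᵥ coframe κ τ x w := by
  have key : ∀ h a b : R3, fderiv ℝ (fun y => metric κ τ y a b) x h =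
      cov κ τ x h a 0 ⬝ᵥ coframe κ τ x b + coframe κ τ x a ⬝ᵥ cov κ τ x h b 0 := fun h a b => by
    simpa using fderiv_metric (φ := fun y : R3 => y) (a := fun _ => a) (b := fun _ => b)
      differentiableAt_id (differentiableAt_const a) (differentiableAt_const b) hx h
  -- Coordinate-constant fields commute, so torsion-freeness becomes symmetry.
  have e : ∀ a b, cov κ τ x b a 0 = cov κ τ x a b 0 := fun a b => by
    have := cov_sub_cov (τ := τ) hx b a 0 0
    rw [sub_eq_zero.1 (this.trans _)]
    ext i; fin_cases i <;> simp [coframe, vert]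
  have e0 : cov κ τ x u v v' = coframe κ τ x v' + cov κ τ x u v 0 := by
    simp only [cov]
    rw [show coframe κ τ x 0 = 0 from (coframeₗ κ τ x).map_zero]; abel
  rw [christoffel, key, key, key, metric_eq_dot, e0, e v u, e w u, e w v]
  simp only [dot_apply, Pi.add_apply]
  ring

end Calculus

/-! ### Killing fields -/

/-- The Killing field with components `c` in the basis `S1`, `S2`, `S3`, `SR`. -/
def kill (κ τ : ℝ) (c : Fin 4 → ℝ) (x : R3) : R3 :=
  c 0 • S1 κ τ x + c 1 • S2 κ τ x + c 2 • S3 x + c 3 • SR x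

/-- The derivative of `kill κ τ c` at `x` in the direction `h`. -/
def dkill (κ τ : ℝ) (c : Fin 4 → ℝ) (x h : R3) : R3 :=
  ![c 0 * (κ / 2 * (x 0 * h 0 - x 1 * h 1)) + c 1 * (κ / 2 * (x 0 * h 1 + x 1 * h 0)) - c 3 * h 1,
    c 0 * (κ / 2 * (x 0 * h 1 + x 1 * h 0)) - c 1 * (κ / 2 * (x 0 * h 0 - x 1 * h 1)) + c 3 * h 0,
    c 0 * (τ * h 1) - c 1 * (τ * h 0)]

/-- Half of the curl of `kill κ τ c`, in the orthonormal frame. -/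
def curl (κ τ : ℝ) (c : Fin 4 → ℝ) (x : R3) : R3 :=
  ![τ * (lam κ x * kill κ τ c x 0), τ * (lam κ x * kill κ τ c x 1),
    c 3 + κ / 2 * (c 0 * x 1 - c 1 * x 0)
      + κ / 2 * lam κ x * (x 1 * kill κ τ c x 0 - x 0 * kill κ τ c x 1)
      - τ * vert κ τ x (kill κ τ c x)]

/-- Structure constants: `[S1, kill c] = kill (bracket1 c)` for the Lie bracket
`[X, Y] = DY X - DX Y`. -/
def bracket1 (κ τ : ℝ) (c : Fin 4 → ℝ) : Fin 4 → ℝ := ![0, c 3, -(2 * τ * c 1), -(κ * c 1)]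

/-- Structure constants: `[S2, kill c] = kill (bracket2 c)`. -/
def bracket2 (κ τ : ℝ) (c : Fin 4 → ℝ) : Fin 4 → ℝ := ![-c 3, 0, 2 * τ * c 0, κ * c 0]

lemma kill_apply (κ τ : ℝ) (c : Fin 4 → ℝ) (x : R3) : kill κ τ c x =
    ![c 0 * (1 + κ / 4 * (x 0 ^ 2 - x 1 ^ 2)) + c 1 * (κ / 2 * x 0 * x 1) - c 3 * x 1,
      c 0 * (κ / 2 * x 0 * x 1) + c 1 * (1 - κ / 4 * (x 0 ^ 2 - x 1 ^ 2)) + c 3 * x 0,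
      c 0 * (τ * x 1) - c 1 * (τ * x 0) + c 2] := by
  ext i
  fin_cases i <;>
    simp [kill, S1, S2, S3, SR, -mul_eq_mul_left_iff, -mul_eq_mul_right_iff] <;> ring

lemma contDiff_kill (κ τ : ℝ) (c : Fin 4 → ℝ) : ContDiff ℝ ∞ (kill κ τ c) := by
  rw [contDiff_pi]
  intro i
  simp only [kill_apply]
  fin_cases i <;> simp <;> fun_prop

lemma fderiv_kill (κ τ : ℝ) (c : Fin 4 → ℝ) (x h : R3) :
    fderiv ℝ (kill κ τ c) x h = dkill κ τ c x h := by
  have d : DifferentiableAt ℝ (kill κ τ c) x :=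
    (contDiff_kill κ τ c).differentiable (by simp) x
  have hd := d.hasFDerivAt
  rw [hasFDerivAt_pi'] at hd
  have p : ∀ i : Fin 3, HasFDerivAt (fun y : R3 => y i)
      (ContinuousLinearMap.proj (R := ℝ) (φ := fun _ : Fin 3 => ℝ) i) x :=
    fun i => hasFDerivAt_apply i x
  have e : ∀ i, fderiv ℝ (kill κ τ c) x h i = fderiv ℝ (fun y => kill κ τ c y i) x h := fun i => by
    rw [(hd i).fderiv]; rfl
  ext i
  rw [e]
  have q := ((((p 0).pow 2).sub ((p 1).pow 2)).const_mul (κ / 4))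
  have r := (((p 0).const_mul (κ / 2)).mul (p 1))
  fin_cases i
  · have key := (((q.const_add 1).const_mul (c 0)).add (r.const_mul (c 1))).sub
      ((p 1).const_mul (c 3))
    simp only [kill_apply]
    refine (congrArg (· h) key.fderiv).trans ?_
    simp [dkill]; ring
  · have key := ((r.const_mul (c 0)).add ((q.const_sub 1).const_mul (c 1))).add
      ((p 0).const_mul (c 3))
    simp only [kill_apply]
    refine (congrArg (· h) key.fderiv).trans ?_
    simp [dkill]; ring
  · have key := ((((p 1).const_mul τ).const_mul (c 0)).sub
      (((p 0).const_mul τ).const_mul (c 1))).add_const (c 2)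
    simp only [kill_apply]
    refine (congrArg (· h) key.fderiv).trans ?_
    simp [dkill]

/-- The covariant derivative of a Killing field is antisymmetric. -/
lemma cov_kill {κ : ℝ} (τ : ℝ) (c : Fin 4 → ℝ) {x : R3} (hx : x ∈ E3 κ) (h : R3) :
    cov κ τ x h (kill κ τ c x) (dkill κ τ c x h) = curl κ τ c x ⨯₃ coframe κ τ x h := by
  have hl := lam_mul hx
  ext i
  fin_cases i
  · simp [cov, curl, coframe, dcoframe, connection, cross_apply, vert, dlam, kill_apply, dkill]
    linear_combination (-(κ / 2) * lam κ x * h 0 * (c 0 * x 0 + c 1 * x 1)) * hl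
  · simp [cov, curl, coframe, dcoframe, connection, cross_apply, vert, dlam, kill_apply, dkill]
    linear_combination (-(κ / 2) * lam κ x * h 1 * (c 0 * x 0 + c 1 * x 1)) * hl
  · simp [cov, curl, coframe, dcoframe, connection, cross_apply, vert, dlam, kill_apply, dkill]
    linear_combination (-τ * (-2 * lam κ x * c 3 * (x 0 * h 0 + x 1 * h 1)
      + (1 + 2 * lam κ x) * (c 0 * h 1 - c 1 * h 0)
      - κ / 2 * lam κ x * (x 0 * h 0 + x 1 * h 1) * (c 0 * x 1 - c 1 * x 0))) * hl

lemma kill_bracket1 (κ τ : ℝ) (c : Fin 4 → ℝ) (x : R3) : kill κ τ (bracket1 κ τ c) x =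
    dkill κ τ c x (S1 κ τ x) - dkill κ τ (Pi.single 0 1) x (kill κ τ c x) := by
  ext i
  fin_cases i <;> simp [kill_apply, dkill, bracket1, S1] <;> ring

lemma kill_bracket2 (κ τ : ℝ) (c : Fin 4 → ℝ) (x : R3) : kill κ τ (bracket2 κ τ c) x =
    dkill κ τ c x (S2 κ τ x) - dkill κ τ (Pi.single 1 1) x (kill κ τ c x) := by
  ext i
  fin_cases i <;> simp [kill_apply, dkill, bracket2, S2] <;> ring

lemma kill_single_zero (κ τ : ℝ) : kill κ τ (Pi.single 0 1) = S1 κ τ := by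
  ext x i; simp [kill]

lemma kill_single_one (κ τ : ℝ) : kill κ τ (Pi.single 1 1) = S2 κ τ := by
  ext x i; simp [kill]

/-! ### Orthonormal triples -/

section Orthonormal

variable {n a b : R3}

/-- `n`, `a`, `b` is an orthonormal triple. -/
structure IsFrame (n a b : R3) : Prop where
  nn : n ⬝ᵥ n = 1
  aa : a ⬝ᵥ a = 1
  bb : b ⬝ᵥ b = 1
  na : n ⬝ᵥ a = 0
  nb : n ⬝ᵥ b = 0
  ab : a ⬝ᵥ b = 0

/-- The triple forms the rows of an orthogonal matrix `Q`. Orthonormality is `Q Qᵀ = 1`, and the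
expansion is `Qᵀ Q = 1`. -/
lemma IsFrame.expand (h : IsFrame n a b) (v : R3) :
    v = (v ⬝ᵥ n) • n + (v ⬝ᵥ a) • a + (v ⬝ᵥ b) • b := by
  obtain ⟨h1, h2, h3, h4, h5, h6⟩ := h
  have hQ : (Matrix.of ![n, a, b]) * (Matrix.of ![n, a, b])ᵀ = 1 := by
    simp only [dot_apply] at *
    ext i j
    fin_cases i <;> fin_cases j <;> simp [Matrix.mul_apply, Fin.sum_univ_three] <;> linarith
  rw [mul_eq_one_comm] at hQ
  have e := congrFun (congrArg (Matrix.mulVec · v) hQ)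
  ext i
  have ei := e i
  simp only [Matrix.one_mulVec] at ei
  rw [← ei]
  simp only [Matrix.mulVec, dotProduct, Matrix.mul_apply, Fin.sum_univ_three,
    Pi.add_apply, Pi.smul_apply, smul_eq_mul]
  simp
  ring

/-- The algebraic identity behind the closedness of the Noether forms: `A`, `B` are the covariant
derivatives of the unit normal, `s` is the Killing field and `p` its curl. -/
lemma IsFrame.noether_identity (h : IsFrame n a b) {A B s p : R3} {H : ℝ} (hA : A ⬝ᵥ n = 0)
    (hB : B ⬝ᵥ n = 0) (hH : A ⬝ᵥ a + B ⬝ᵥ b = -(2 * H)) :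
    triple A s b + triple n (p ⨯₃ a) b - (triple B s a + triple n (p ⨯₃ b) a)
      = 2 * H * triple s a b := by
  -- As `n` is orthogonal to `a` and `b`, both terms equal `-(n·p)(a·b)`, so the curl drops out.
  have h1 : triple n (p ⨯₃ a) b - triple n (p ⨯₃ b) a = 0 := by
    obtain ⟨-, ha, hb, hna, hnb, -⟩ := h
    have e : triple n (p ⨯₃ a) b - triple n (p ⨯₃ b) a =
        (n ⬝ᵥ a) * (p ⬝ᵥ b) - (n ⬝ᵥ p) * (a ⬝ᵥ b) - (n ⬝ᵥ b) * (p ⬝ᵥ a)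
          + (n ⬝ᵥ p) * (a ⬝ᵥ b) := by
      simp [triple_apply, dot_apply, cross_apply]; ring
    rw [e, hna, hnb]; ring
  have eA := h.expand A
  have eB := h.expand B
  rw [hA, zero_smul, zero_add] at eA
  rw [hB, zero_smul, zero_add] at eB
  -- The off-diagonal parts of `A` and `B` give triple products with a repeated vector. Only the
  -- trace `A·a + B·b` survives.
  have h2 : triple A s b - triple B s a = 2 * H * triple s a b := by
    rw [eA, eB]
    have e : 2 * H = -(A ⬝ᵥ a + B ⬝ᵥ b) := by rw [hH]; ring
    rw [e]
    generalize A ⬝ᵥ a = α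
    generalize B ⬝ᵥ b = β
    simp [triple_apply]; ring
  linear_combination h1 + h2

end Orthonormal

/-- A linear relation between cross products: the derivation property of the triple product. -/
lemma triple_cross (p u v w : R3) :
    triple (p ⨯₃ u) v w + triple u (p ⨯₃ v) w + triple u v (p ⨯₃ w) = 0 := by
  simp [triple_apply, cross_apply]; ring

lemma dot_cross (p u v : R3) : (p ⨯₃ u) ⬝ᵥ v = -(u ⬝ᵥ (p ⨯₃ v)) := by
  simp only [dot_apply]; simp [cross_apply]; ring

/-! ### Linear algebra and local parametrizations of the surface -/

section Surface

variable {M : Type*} [TopologicalSpace M] [ChartedSpace R2 M]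
  {E : Type*} [NormedAddCommGroup E] [NormedSpace ℝ E]

/-- The differential of a map from a surface to `ℝ³`, as a linear map. -/
def dmapL (f : M → R3) (p : M) : TangentSpace (𝓡 2) p →L[ℝ] R3 := mfderiv (𝓡 2) 𝓘(ℝ, R3) f p

lemma dmap_add (f : M → R3) (p : M) (v w : TangentSpace (𝓡 2) p) :
    dmap f p (v + w) = dmap f p v + dmap f p w := (dmapL f p).map_add v w

lemma dmap_smul (f : M → R3) (p : M) (r : ℝ) (v : TangentSpace (𝓡 2) p) :
    dmap f p (r • v) = r • dmap f p v := (dmapL f p).map_smul r v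

/-- The differential of a map from a vector space to a surface. -/
def tmap (g : E → M) (x u : E) : TangentSpace (𝓡 2) (g x) := mfderiv 𝓘(ℝ, E) (𝓡 2) g x u

lemma fderiv_comp_map {F : M → R3} {g : E → M} {x : E}
    (hF : MDifferentiableAt (𝓡 2) 𝓘(ℝ, R3) F (g x))
    (hg : MDifferentiableAt 𝓘(ℝ, E) (𝓡 2) g x) (u : E) :
    fderiv ℝ (fun y => F (g y)) x u = dmap F (g x) (tmap g x u) := by
  have h := mfderiv_comp_apply x hF hg u
  rw [mfderiv_eq_fderiv] at h
  exact h

/-- To prove a property of the points of a surface, it is enough to prove it for the values of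
local parametrizations. -/
lemma parametrization_induction [IsManifold (𝓡 2) ∞ M] {P : M → Prop}
    (h : ∀ (g : R2 → M) (x : R2), ContMDiffAt 𝓘(ℝ, R2) (𝓡 2) ∞ g x →
      Function.Surjective (tmap g x) → P (g x)) (p : M) : P p := by
  have e : (extChartAt (𝓡 2) p).symm (extChartAt (𝓡 2) p p) = p := extChartAt_to_inv p
  have ht : extChartAt (𝓡 2) p p ∈ (extChartAt (𝓡 2) p).target := mem_extChartAt_target p
  have key := h (extChartAt (𝓡 2) p).symm (extChartAt (𝓡 2) p p) ?_ ?_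
  · rwa [e] at key
  · exact (contMDiffOn_extChartAt_symm p).contMDiffAt (extChartAt_target_mem_nhds p)
  · have hi := isInvertible_mfderivWithin_extChartAt_symm (I := 𝓡 2) ht
    rw [(𝓡 2).range_eq_univ, mfderivWithin_univ] at hi
    exact hi.bijective.surjective

/-- Gram-Schmidt for an injective linear map from a plane to `ℝ³`. -/
lemma exists_orthonormal {V : Type*} [AddCommGroup V] [Module ℝ V]
    (L : V →ₗ[ℝ] R3) (hL : Function.Injective L) (v w : V) (h : LinearIndependent ℝ ![v, w]) :
    ∃ a b : V, L a ⬝ᵥ L a = 1 ∧ L b ⬝ᵥ L b = 1 ∧ L a ⬝ᵥ L b = 0 := by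
  have norm : ∀ u : V, u ≠ 0 → ∃ r : ℝ, r ≠ 0 ∧ L (r • u) ⬝ᵥ L (r • u) = 1 := fun u hu => by
    have h0 : L u ⬝ᵥ L u ≠ 0 := by
      rw [Ne, dotProduct_self_eq_zero]
      exact fun h => hu (hL (h.trans L.map_zero.symm))
    have h1 : 0 ≤ L u ⬝ᵥ L u := by
      rw [dot_apply]
      nlinarith [sq_nonneg (L u 0), sq_nonneg (L u 1), sq_nonneg (L u 2)]
    have h2 : 0 < √(L u ⬝ᵥ L u) := Real.sqrt_pos.2 (lt_of_le_of_ne h1 h0.symm)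
    refine ⟨(√(L u ⬝ᵥ L u))⁻¹, inv_ne_zero h2.ne', ?_⟩
    rw [map_smul, smul_dotProduct, dotProduct_smul, smul_eq_mul, smul_eq_mul, ← mul_assoc,
      ← mul_inv, Real.mul_self_sqrt h1, inv_mul_cancel₀ h0]
  rw [LinearIndependent.pair_iff] at h
  obtain ⟨r, hr, hr'⟩ := norm v fun hv => by simpa using h 1 0 (by simp [hv])
  obtain ⟨a, ha⟩ : ∃ a, a = r • v := ⟨_, rfl⟩
  rw [← ha] at hr'
  obtain ⟨s, -, hs'⟩ := norm (w - (L w ⬝ᵥ L a) • a) fun hw => by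
    have := h (-((L w ⬝ᵥ L a) * r)) 1 (by rw [← hw, ha, smul_smul]; module)
    simp at this
  refine ⟨a, _, hr', hs', ?_⟩
  rw [map_smul, map_sub, map_smul, dotProduct_smul, dotProduct_sub, dotProduct_smul, hr',
    dotProduct_comm]
  simp

end Surface

/-! ### The normal and the second fundamental form of the immersion -/

section CMC

variable {M : Type*} [TopologicalSpace M] [ChartedSpace R2 M] {κ τ H : ℝ} {f N : M → R3}

/-- The covariant derivative of the field `N` along `f`, in the orthonormal frame. -/
def covNormal (κ τ : ℝ) (f N : M → R3) (p : M) (v : TangentSpace (𝓡 2) p) : R3 :=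
  cov κ τ (f p) (dmap f p v) (N p) (dmap N p v)

/-- The differential of `f` in the orthonormal frame. -/
def frameMap (κ τ : ℝ) (f : M → R3) (p : M) (v : TangentSpace (𝓡 2) p) : R3 :=
  coframe κ τ (f p) (dmap f p v)

lemma frameMap_lin (κ τ : ℝ) (f : M → R3) (p : M) (r s : ℝ) (v w : TangentSpace (𝓡 2) p) :
    frameMap κ τ f p (r • v + s • w) = r • frameMap κ τ f p v + s • frameMap κ τ f p w := by
  simp only [frameMap, dmap_add, dmap_smul, coframe_add, coframe_smul]

lemma covNormal_lin (κ τ : ℝ) (f N : M → R3) (p : M) (r s : ℝ) (v w : TangentSpace (𝓡 2) p) :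
    covNormal κ τ f N p (r • v + s • w)
      = r • covNormal κ τ f N p v + s • covNormal κ τ f N p w := by
  simp only [covNormal, dmap_add, dmap_smul]
  ext i
  fin_cases i <;> simp [cov, coframe, dcoframe, connection, dlam, vert, cross_apply] <;> ring

namespace IsCMCImmersion

lemma covInner_eq (hf : IsCMCImmersion κ τ H f N) (p : M) (v w : TangentSpace (𝓡 2) p) :
    covInner κ τ f N p v w = covNormal κ τ f N p v ⬝ᵥ frameMap κ τ f p w :=
  metric_add_christoffel (hf.mem p) _ _ _ _

lemma frameMap_injective (hf : IsCMCImmersion κ τ H f N) (p : M) :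
    Function.Injective (frameMap κ τ f p) :=
  (coframe_injective (hf.mem p)).comp (hf.immersion p)

lemma normal_dot (hf : IsCMCImmersion κ τ H f N) (p : M) (v : TangentSpace (𝓡 2) p) :
    coframe κ τ (f p) (N p) ⬝ᵥ frameMap κ τ f p v = 0 := by
  rw [frameMap, ← metric_eq_dot, hf.normal]

lemma exists_frame (hf : IsCMCImmersion κ τ H f N) (p : M) : ∃ a b : TangentSpace (𝓡 2) p,
    IsFrame (coframe κ τ (f p) (N p)) (frameMap κ τ f p a) (frameMap κ τ f p b) := by
  have hL := hf.frameMap_injective p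
  let e := (EuclideanSpace.basisFun (Fin 2) ℝ).toBasis
  obtain ⟨a, b, h1, h2, h3⟩ := exists_orthonormal
    ((coframeₗ κ τ (f p)) ∘ₗ (dmapL f p).toLinearMap) hL (e 0 : R2) (e 1 : R2) (by
      have h : (e : Fin 2 → R2) = ![e 0, e 1] := by
        funext i; fin_cases i <;> rfl
      have h' := e.linearIndependent
      rw [h] at h'
      exact h')
  exact ⟨a, b, (metric_eq_dot ..).symm.trans (hf.unit p), h1, h2, hf.normal_dot p a,
    hf.normal_dot p b, h3⟩

lemma exists_coeff (hf : IsCMCImmersion κ τ H f N) {p : M} {a b : TangentSpace (𝓡 2) p}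
    (h : IsFrame (coframe κ τ (f p) (N p)) (frameMap κ τ f p a) (frameMap κ τ f p b))
    (v : TangentSpace (𝓡 2) p) : ∃ r s : ℝ, v = r • a + s • b := by
  refine ⟨frameMap κ τ f p v ⬝ᵥ frameMap κ τ f p a,
    frameMap κ τ f p v ⬝ᵥ frameMap κ τ f p b, hf.frameMap_injective p ?_⟩
  rw [frameMap_lin]
  refine (h.expand _).trans ?_
  rw [dotProduct_comm, hf.normal_dot, zero_smul, zero_add]

variable {E : Type*} [NormedAddCommGroup E] [NormedSpace ℝ E] {g : E → M} {x : E}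

lemma contDiffAt_map (hf : IsCMCImmersion κ τ H f N) (hg : ContMDiffAt 𝓘(ℝ, E) (𝓡 2) ∞ g x) :
    ContDiffAt ℝ ∞ (fun y => f (g y)) x :=
  contMDiffAt_iff_contDiffAt.1 (hf.smooth.contMDiffAt.comp x hg)

lemma contDiffAt_normal (hf : IsCMCImmersion κ τ H f N) (hg : ContMDiffAt 𝓘(ℝ, E) (𝓡 2) ∞ g x) :
    ContDiffAt ℝ ∞ (fun y => N (g y)) x :=
  contMDiffAt_iff_contDiffAt.1 (hf.smooth_normal.contMDiffAt.comp x hg)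

lemma fderiv_map (hf : IsCMCImmersion κ τ H f N)
    (hg : MDifferentiableAt 𝓘(ℝ, E) (𝓡 2) g x) (u : E) :
    fderiv ℝ (fun y => f (g y)) x u = dmap f (g x) (tmap g x u) :=
  fderiv_comp_map ((hf.smooth.mdifferentiable (by simp)) _) hg u

lemma fderiv_normal (hf : IsCMCImmersion κ τ H f N)
    (hg : MDifferentiableAt 𝓘(ℝ, E) (𝓡 2) g x) (u : E) :
    fderiv ℝ (fun y => N (g y)) x u = dmap N (g x) (tmap g x u) :=
  fderiv_comp_map ((hf.smooth_normal.mdifferentiable (by simp)) _) hg u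

lemma eventually_mdifferentiableAt [IsManifold (𝓡 2) ∞ M]
    (hg : ContMDiffAt 𝓘(ℝ, E) (𝓡 2) ∞ g x) :
    ∀ᶠ y in nhds x, MDifferentiableAt 𝓘(ℝ, E) (𝓡 2) g y := by
  -- Only smoothness of finite order at a point spreads to a neighbourhood, hence the passage to
  -- order `1`.
  have h1 : ContMDiffAt 𝓘(ℝ, E) (𝓡 2) 1 g x := hg.of_le (by norm_cast)
  have : IsManifold (𝓡 2) 1 M := IsManifold.of_le (m := 1) (n := ∞) (by norm_cast)
  filter_upwards [contMDiffAt_iff_contMDiffAt_nhds (by simp) |>.1 h1] with y hy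
  exact hy.mdifferentiableAt (by simp)

variable [IsManifold (𝓡 2) ∞ M]

/-- Differentiate `⟨N, N⟩ = 1`. -/
lemma covNormal_dot_normal (hf : IsCMCImmersion κ τ H f N) (p : M) (v : TangentSpace (𝓡 2) p) :
    covNormal κ τ f N p v ⬝ᵥ coframe κ τ (f p) (N p) = 0 := by
  revert v
  induction p using parametrization_induction with | h g x hg hs => ?_
  intro v
  obtain ⟨u, rfl⟩ := hs v
  have hg' := hg.mdifferentiableAt (by simp)
  have h1 := (hf.contDiffAt_map hg).differentiableAt (by simp)
  have h2 := (hf.contDiffAt_normal hg).differentiableAt (by simp)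
  have key := fderiv_metric (τ := τ) h1 h2 h2 (hf.mem (g x)) u
  simp only [hf.unit] at key
  rw [hf.fderiv_map hg', hf.fderiv_normal hg', dotProduct_comm (coframe _ _ _ _)] at key
  simp at key
  rw [covNormal]
  linarith

/-- The second fundamental form is symmetric. -/
lemma covNormal_symm (hf : IsCMCImmersion κ τ H f N) (p : M) (v w : TangentSpace (𝓡 2) p) :
    covNormal κ τ f N p v ⬝ᵥ frameMap κ τ f p w
      = covNormal κ τ f N p w ⬝ᵥ frameMap κ τ f p v := by
  revert v w
  induction p using parametrization_induction with | h g x hg hs => ?_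
  intro v w
  obtain ⟨u, rfl⟩ := hs v
  obtain ⟨u', rfl⟩ := hs w
  have hg' := hg.mdifferentiableAt (by simp)
  have c1 := hf.contDiffAt_map hg
  have h1 := c1.differentiableAt (by simp)
  have h2 := (hf.contDiffAt_normal hg).differentiableAt (by simp)
  have h3 : DifferentiableAt ℝ (fderiv ℝ (fun y => f (g y))) x :=
    (c1.fderiv_right (m := 1) (by norm_cast)).differentiableAt (by simp)
  have sym : IsSymmSndFDerivAt ℝ (fun y => f (g y)) x := c1.isSymmSndFDerivAt (by simp; norm_cast)
  -- Differentiating `⟨N, df(z')⟩ = 0` expresses the second fundamental form through `∇df`, which is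
  -- symmetric because the connection is torsion free and second derivatives commute.
  have zero : ∀ z, (fun y => metric κ τ (f (g y)) (N (g y)) (fderiv ℝ (fun y => f (g y)) y z))
      =ᶠ[nhds x] fun _ => 0 := fun z => by
    filter_upwards [eventually_mdifferentiableAt hg] with y hy
    rw [hf.fderiv_map hy, hf.normal]
  have key : ∀ z z', covNormal κ τ f N (g x) (tmap g x z)
      ⬝ᵥ frameMap κ τ f (g x) (tmap g x z')
      = - (coframe κ τ (f (g x)) (N (g x)) ⬝ᵥ cov κ τ (f (g x)) (fderiv ℝ (fun y => f (g y)) x z)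
        (fderiv ℝ (fun y => f (g y)) x z')
        (fderiv ℝ (fderiv ℝ (fun y => f (g y))) x z z')) := fun z z' => by
    have h4 : DifferentiableAt ℝ (fun y => fderiv ℝ (fun y => f (g y)) y z') x :=
      h3.clm_apply (differentiableAt_const z')
    have k := fderiv_metric (τ := τ) h1 h2 h4 (hf.mem (g x)) z
    rw [(zero z').fderiv_eq, fderiv_clm_apply h3 (differentiableAt_const z')] at k
    rw [covNormal, frameMap, ← hf.fderiv_map hg', ← hf.fderiv_map hg', ← hf.fderiv_normal hg']
    simp at k
    linarith
  have tf := cov_sub_cov (τ := τ) (hf.mem (g x)) (fderiv ℝ (fun y => f (g y)) x u)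
    (fderiv ℝ (fun y => f (g y)) x u') (fderiv ℝ (fderiv ℝ (fun y => f (g y))) x u' u)
    (fderiv ℝ (fderiv ℝ (fun y => f (g y))) x u u')
  rw [sym.eq u u', sub_self] at tf
  rw [key, key, sym.eq u u', sub_eq_zero.1 (tf.trans (coframeₗ κ τ (f (g x))).map_zero)]

/-- The closedness of the Noether form of a Killing field, at the level of tangent vectors. -/
lemma noether_alternating (hf : IsCMCImmersion κ τ H f N)
    (c : Fin 4 → ℝ) (p : M) (v w : TangentSpace (𝓡 2) p) :
    triple (covNormal κ τ f N p v) (coframe κ τ (f p) (kill κ τ c (f p))) (frameMap κ τ f p w)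
      + triple (coframe κ τ (f p) (N p)) (curl κ τ c (f p) ⨯₃ frameMap κ τ f p v)
        (frameMap κ τ f p w)
      - (triple (covNormal κ τ f N p w) (coframe κ τ (f p) (kill κ τ c (f p)))
          (frameMap κ τ f p v)
        + triple (coframe κ τ (f p) (N p)) (curl κ τ c (f p) ⨯₃ frameMap κ τ f p w)
          (frameMap κ τ f p v))
      = 2 * H * triple (coframe κ τ (f p) (kill κ τ c (f p))) (frameMap κ τ f p v)
        (frameMap κ τ f p w) := by
  obtain ⟨a, b, h⟩ := hf.exists_frame p
  have hH := hf.meanCurvature p a b ((metric_eq_dot ..).trans h.aa)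
    ((metric_eq_dot ..).trans h.bb) ((metric_eq_dot ..).trans h.ab)
  rw [hf.covInner_eq, hf.covInner_eq] at hH
  have key := h.noether_identity (s := coframe κ τ (f p) (kill κ τ c (f p)))
    (p := curl κ τ c (f p)) (hf.covNormal_dot_normal p a) (hf.covNormal_dot_normal p b)
    (H := H) (by linarith)
  obtain ⟨r, s, rfl⟩ := hf.exists_coeff h v
  obtain ⟨r', s', rfl⟩ := hf.exists_coeff h w
  simp only [covNormal_lin, frameMap_lin]
  simp only [triple_apply] at key ⊢
  simp [cross_apply] at key ⊢
  -- Both sides are bilinear and alternating in the two tangent vectors, so the value on the frame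
  -- is multiplied by the determinant of the coefficients.
  linear_combination (r * s' - s * r') * key

end IsCMCImmersion

end CMC

/-! ### Closedness of the Noether forms -/

section ClosedForms

variable {E : Type*} [NormedAddCommGroup E] [NormedSpace ℝ E] {κ τ : ℝ} {x : E}

lemma _root_.ContDiffAt.differentiableAt_fderiv {F : Type*} [NormedAddCommGroup F]
    [NormedSpace ℝ F] {φ : E → F} (h : ContDiffAt ℝ ∞ φ x) : DifferentiableAt ℝ (fderiv ℝ φ) x :=
  (h.fderiv_right (m := 1) (by norm_cast)).differentiableAt (by simp)

lemma fderiv_fderiv_apply {F : Type*} [NormedAddCommGroup F] [NormedSpace ℝ F] {φ : E → F}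
    (h : ContDiffAt ℝ ∞ φ x) (u v : E) :
    fderiv ℝ (fun y => fderiv ℝ φ y v) x u = fderiv ℝ (fderiv ℝ φ) x u v := by
  rw [fderiv_clm_apply h.differentiableAt_fderiv (differentiableAt_const v)]
  simp

lemma fderiv_fderiv_comm {F : Type*} [NormedAddCommGroup F] [NormedSpace ℝ F] {φ : E → F}
    (h : ContDiffAt ℝ ∞ φ x) (u v : E) :
    fderiv ℝ (fderiv ℝ φ) x u v = fderiv ℝ (fderiv ℝ φ) x v u :=
  (h.isSymmSndFDerivAt (by simp; norm_cast)).eq u v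

/-- The pullback of the connection is torsion free. -/
lemma cov_fderiv_comm {φ : E → R3} (h : ContDiffAt ℝ ∞ φ x) (hx : φ x ∈ E3 κ) (u v : E) :
    cov κ τ (φ x) (fderiv ℝ φ x u) (fderiv ℝ φ x v) (fderiv ℝ (fderiv ℝ φ) x u v)
      = cov κ τ (φ x) (fderiv ℝ φ x v) (fderiv ℝ φ x u) (fderiv ℝ (fderiv ℝ φ) x v u) := by
  have tf := cov_sub_cov (τ := τ) hx (fderiv ℝ φ x u) (fderiv ℝ φ x v)
    (fderiv ℝ (fderiv ℝ φ) x v u) (fderiv ℝ (fderiv ℝ φ) x u v)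
  rw [fderiv_fderiv_comm h u v, sub_self] at tf
  rw [fderiv_fderiv_comm h u v]
  exact sub_eq_zero.1 (tf.trans (coframeₗ κ τ (φ x)).map_zero)

lemma contDiffAt_lam {n : WithTop ℕ∞} {φ : E → R3} (hφ : ContDiffAt ℝ n φ x) (hx : φ x ∈ E3 κ) :
    ContDiffAt ℝ n (fun y => lam κ (φ y)) x := by
  have h := contDiffAt_pi.1 hφ
  exact contDiffAt_const.div
    (contDiffAt_const.add (contDiffAt_const.mul (((h 0).pow 2).add ((h 1).pow 2)))) (ne_of_gt hx)

lemma contDiffAt_metric {n : WithTop ℕ∞} {φ a b : E → R3} (hφ : ContDiffAt ℝ n φ x)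
    (ha : ContDiffAt ℝ n a x) (hb : ContDiffAt ℝ n b x) (hx : φ x ∈ E3 κ) :
    ContDiffAt ℝ n (fun y => metric κ τ (φ y) (a y) (b y)) x := by
  have hl := contDiffAt_lam hφ hx
  rw [contDiffAt_pi] at hφ ha hb
  have h0 := hφ 0
  have h1 := hφ 1
  have a0 := ha 0
  have a1 := ha 1
  have a2 := ha 2
  have b0 := hb 0
  have b1 := hb 1
  have b2 := hb 2
  unfold metric vert
  fun_prop

lemma contDiffAt_vol {n : WithTop ℕ∞} {φ a b c : E → R3} (hφ : ContDiffAt ℝ n φ x)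
    (ha : ContDiffAt ℝ n a x) (hb : ContDiffAt ℝ n b x) (hc : ContDiffAt ℝ n c x)
    (hx : φ x ∈ E3 κ) : ContDiffAt ℝ n (fun y => vol κ (φ y) (a y) (b y) (c y)) x := by
  have hl := contDiffAt_lam hφ hx
  rw [contDiffAt_pi] at ha hb hc
  have a0 := ha 0
  have a1 := ha 1
  have a2 := ha 2
  have b0 := hb 0
  have b1 := hb 1
  have b2 := hb 2
  have c0 := hc 0
  have c1 := hc 1
  have c2 := hc 2
  simp only [vol, Matrix.det_fin_three]
  simp
  fun_prop

lemma isOpen_E3 (κ : ℝ) : IsOpen (E3 κ) :=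
  isOpen_lt continuous_const (by fun_prop)

lemma IsPotential.contDiffAt {F S : R3 → R3} (hF : IsPotential κ τ F S) {y : R3}
    (hy : y ∈ E3 κ) : ContDiffAt ℝ ∞ F y :=
  hF.1.contDiffAt ((isOpen_E3 κ).mem_nhds hy)

/-- The second derivatives of `φ` disappear by torsion-freeness. What remains depends on `φ` only
through its value and its differential at `x`, so a general `φ` can be compared with the identity.
-/
lemma fderiv_potential {F : R3 → R3} {φ : E → R3} (hφ : ContDiffAt ℝ ∞ φ x)
    (hF : ContDiffAt ℝ ∞ F (φ x)) (hx : φ x ∈ E3 κ) (u v : E) :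
    fderiv ℝ (fun y => metric κ τ (φ y) (F (φ y)) (fderiv ℝ φ y v)) x u
        - fderiv ℝ (fun y => metric κ τ (φ y) (F (φ y)) (fderiv ℝ φ y u)) x v
      = cov κ τ (φ x) (fderiv ℝ φ x u) (F (φ x)) (fderiv ℝ F (φ x) (fderiv ℝ φ x u))
          ⬝ᵥ coframe κ τ (φ x) (fderiv ℝ φ x v)
        - cov κ τ (φ x) (fderiv ℝ φ x v) (F (φ x)) (fderiv ℝ F (φ x) (fderiv ℝ φ x v))
          ⬝ᵥ coframe κ τ (φ x) (fderiv ℝ φ x u) := by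
  have h1 := hφ.differentiableAt (by simp)
  have h2 := hF.differentiableAt (by simp)
  have h3 : DifferentiableAt ℝ (fun y => F (φ y)) x := h2.comp x h1
  have h4 : ∀ v, DifferentiableAt ℝ (fun y => fderiv ℝ φ y v) x := fun v =>
    hφ.differentiableAt_fderiv.clm_apply (differentiableAt_const v)
  have e : ∀ u, fderiv ℝ (fun y => F (φ y)) x u = fderiv ℝ F (φ x) (fderiv ℝ φ x u) := fun u =>
    congrArg (· u) (fderiv_comp x h2 h1)
  rw [fderiv_metric h1 h3 (h4 v) hx, fderiv_metric h1 h3 (h4 u) hx, e, e,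
    fderiv_fderiv_apply hφ, fderiv_fderiv_apply hφ, cov_fderiv_comm hφ hx u v]
  ring

/-- The exterior derivative of the pullback of `F^♭` is the pullback of `S ⌟ vol` if `rot F = S`. -/
lemma IsPotential.fderiv_pullback {F S : R3 → R3} (hF : IsPotential κ τ F S) {φ : E → R3}
    (hφ : ContDiffAt ℝ ∞ φ x) (hx : φ x ∈ E3 κ) (u v : E) :
    fderiv ℝ (fun y => metric κ τ (φ y) (F (φ y)) (fderiv ℝ φ y v)) x u
        - fderiv ℝ (fun y => metric κ τ (φ y) (F (φ y)) (fderiv ℝ φ y u)) x v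
      = vol κ (φ x) (S (φ x)) (fderiv ℝ φ x u) (fderiv ℝ φ x v) := by
  -- For the identity, on the image vectors `dφ(u)` and `dφ(v)`, the formula computes the left side
  -- in the definition of a potential.
  have key := fderiv_potential (τ := τ) (φ := id) (x := φ x) contDiffAt_id
    (hF.contDiffAt hx) hx (fderiv ℝ φ x u) (fderiv ℝ φ x v)
  rw [fderiv_potential hφ (hF.contDiffAt hx) hx, ← hF.2 (φ x) hx]
  simp only [id, fderiv_id, ContinuousLinearMap.id_apply] at key
  exact key.symm

section Surface

variable {M : Type*} [TopologicalSpace M] [ChartedSpace R2 M]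
  {H : ℝ} {f N : M → R3} {g : E → M}

lemma fderiv_kill_comp (c : Fin 4 → ℝ) {φ : E → R3} (hφ : DifferentiableAt ℝ φ x) (u : E) :
    DifferentiableAt ℝ (fun y => kill κ τ c (φ y)) x ∧
    fderiv ℝ (fun y => kill κ τ c (φ y)) x u = dkill κ τ c (φ x) (fderiv ℝ φ x u) := by
  have h : DifferentiableAt ℝ (kill κ τ c) (φ x) := (contDiff_kill κ τ c).differentiable (by simp) _
  refine ⟨h.comp x hφ, ?_⟩
  rw [← fderiv_kill]
  exact congrArg (· u) (fderiv_comp x h hφ)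

/-- The symmetric terms `∇df` drop out of the exterior derivative. The derivative of the Killing
field is a cross product with its curl, and `noether_alternating` evaluates the rest. -/
lemma IsCMCImmersion.fderiv_vol_form [IsManifold (𝓡 2) ∞ M]
    (hf : IsCMCImmersion κ τ H f N) (c : Fin 4 → ℝ)
    (hg : ContMDiffAt 𝓘(ℝ, E) (𝓡 2) ∞ g x) (u v : E) :
    fderiv ℝ (fun y => vol κ (f (g y)) (N (g y)) (kill κ τ c (f (g y)))
        (fderiv ℝ (fun y => f (g y)) y v)) x u
      - fderiv ℝ (fun y => vol κ (f (g y)) (N (g y)) (kill κ τ c (f (g y)))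
        (fderiv ℝ (fun y => f (g y)) y u)) x v
      = 2 * H * vol κ (f (g x)) (kill κ τ c (f (g x))) (fderiv ℝ (fun y => f (g y)) x u)
          (fderiv ℝ (fun y => f (g y)) x v) := by
  have hg' := hg.mdifferentiableAt (by simp)
  have c1 := hf.contDiffAt_map hg
  have h1 := c1.differentiableAt (by simp)
  have h2 := (hf.contDiffAt_normal hg).differentiableAt (by simp)
  have h3 := fun u => fderiv_kill_comp (κ := κ) (τ := τ) c h1 u
  have h4 : ∀ v, DifferentiableAt ℝ (fun y => fderiv ℝ (fun y => f (g y)) y v) x := fun v =>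
    c1.differentiableAt_fderiv.clm_apply (differentiableAt_const v)
  have hx := hf.mem (g x)
  rw [fderiv_vol τ h1 h2 (h3 u).1 (h4 v) hx, fderiv_vol τ h1 h2 (h3 u).1 (h4 u) hx,
    (h3 u).2, (h3 v).2, fderiv_fderiv_apply c1, fderiv_fderiv_apply c1, cov_fderiv_comm c1 hx u v,
    cov_kill τ c hx, cov_kill τ c hx, vol_eq_triple κ τ]
  have key := hf.noether_alternating c (g x) (tmap g x u) (tmap g x v)
  simp only [covNormal, frameMap, ← hf.fderiv_map hg', ← hf.fderiv_normal hg'] at key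
  linarith

/-- The Noether form of a Killing field is closed. -/
lemma IsCMCImmersion.noetherForm_closed [IsManifold (𝓡 2) ∞ M]
    (hf : IsCMCImmersion κ τ H f N) (c : Fin 4 → ℝ)
    {F : R3 → R3} (hF : IsPotential κ τ F (kill κ τ c))
    (hg : ContMDiff 𝓘(ℝ, E) (𝓡 2) ∞ g) (u v : E) :
    fderiv ℝ (fun y => noetherForm κ τ H f N (kill κ τ c ∘ f) (F ∘ f) (g y) (tmap g y v)) x u
      = fderiv ℝ (fun y => noetherForm κ τ H f N (kill κ τ c ∘ f) (F ∘ f) (g y) (tmap g y u)) x v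
      := by
  have hg' : ∀ y, MDifferentiableAt 𝓘(ℝ, E) (𝓡 2) g y := hg.mdifferentiable (by simp)
  have c1 := hf.contDiffAt_map (hg.contMDiffAt (x := x))
  have h1 := c1.differentiableAt (by simp)
  have h2 := (hf.contDiffAt_normal (hg.contMDiffAt (x := x))).differentiableAt (by simp)
  have h4 : ∀ v, DifferentiableAt ℝ (fun y => fderiv ℝ (fun y => f (g y)) y v) x := fun v =>
    c1.differentiableAt_fderiv.clm_apply (differentiableAt_const v)
  have hx := hf.mem (g x)
  have h5 : DifferentiableAt ℝ (fun y => F (f (g y))) x :=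
    ((hF.contDiffAt hx).differentiableAt (by simp)).comp x h1
  simp only [noetherForm, ← hf.fderiv_map (hg' _), Function.comp_apply]
  have d1 := fun v => differentiableAt_vol h1 h2 (fderiv_kill_comp (κ := κ) (τ := τ) c h1 u).1
    (h4 v) hx
  have d2 := fun v => (differentiableAt_metric (τ := τ) h1 h5 (h4 v) hx)
  have e1 := hf.fderiv_vol_form c (hg.contMDiffAt (x := x)) u v
  have e2 := hF.fderiv_pullback c1 hx u v
  rw [fderiv_fun_sub (d1 v) ((d2 v).const_mul _), fderiv_fun_sub (d1 u) ((d2 u).const_mul _),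
    fderiv_const_mul (d2 v), fderiv_const_mul (d2 u)]
  simp only [sub_apply, smul_apply, smul_eq_mul]
  linear_combination e1 - 2 * H * e2

lemma IsCMCImmersion.contDiff_noetherForm (hf : IsCMCImmersion κ τ H f N) (c : Fin 4 → ℝ)
    {F : R3 → R3} (hF : IsPotential κ τ F (kill κ τ c))
    (hg : ContMDiff 𝓘(ℝ, E) (𝓡 2) ∞ g) (v : E) : ContDiff ℝ ∞
    (fun y => noetherForm κ τ H f N (kill κ τ c ∘ f) (F ∘ f) (g y) (tmap g y v)) := by
  have hg' : ∀ y, MDifferentiableAt 𝓘(ℝ, E) (𝓡 2) g y := hg.mdifferentiable (by simp)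
  rw [contDiff_iff_contDiffAt]
  intro x
  have c1 := hf.contDiffAt_map (hg.contMDiffAt (x := x))
  have c2 := hf.contDiffAt_normal (hg.contMDiffAt (x := x))
  have hx := hf.mem (g x)
  have c3 : ContDiffAt ℝ ∞ (fun y => F (f (g y))) x := (hF.contDiffAt hx).comp x c1
  have c4 : ContDiffAt ℝ ∞ (fun y => fderiv ℝ (fun y => f (g y)) y v) x :=
    (c1.fderiv_right (m := ∞) (by norm_cast)).clm_apply contDiffAt_const
  have c5 : ContDiffAt ℝ ∞ (fun y => kill κ τ c (f (g y))) x :=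
    (contDiff_kill κ τ c).contDiffAt.comp x c1
  simp only [noetherForm, ← hf.fderiv_map (hg' _), Function.comp_apply]
  exact (contDiffAt_vol c1 c2 c5 c4 hx).sub (contDiffAt_const.mul (contDiffAt_metric c1 c3 c4 hx))

end Surface

end ClosedForms

/-! ### The Poincaré lemma on star-shaped domains -/

/-- A closed smooth `1`-form on an open star-shaped domain is exact. -/
lemma exists_primitive {E : Type*} [NormedAddCommGroup E] [NormedSpace ℝ E]
    [FiniteDimensional ℝ E] {U : Set E} (hU : IsOpen U) {o : E}
    (hs : StarConvex ℝ o U) (β : E → E → ℝ) (hadd : ∀ x v w, β x (v + w) = β x v + β x w)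
    (hsmul : ∀ x (r : ℝ) v, β x (r • v) = r * β x v)
    (hβ : ∀ v, ContDiffOn ℝ ∞ (fun x => β x v) U)
    (hclosed : ∀ x ∈ U, ∀ u v,
      fderiv ℝ (fun y => β y v) x u = fderiv ℝ (fun y => β y u) x v) :
    ∃ k : E → ℝ, ContDiffOn ℝ ∞ k U ∧ ∀ x ∈ U, ∀ v, fderiv ℝ k x v = β x v := by
  let α : E → E →L[ℝ] ℝ := fun x =>
    LinearMap.toContinuousLinearMap { toFun := β x, map_add' := hadd x, map_smul' := hsmul x }
  have hα : ContDiffOn ℝ ∞ α U := contDiffOn_clm_apply.2 hβ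
  have hd : ∀ x ∈ U, DifferentiableAt ℝ α x := fun x hx =>
    (hα.contDiffAt (hU.mem_nhds hx)).differentiableAt (by simp)
  have hsym : ∀ x ∈ U, ∀ u v, fderiv ℝ α x u v = fderiv ℝ α x v u := fun x hx u v => by
    have e : ∀ u v, fderiv ℝ α x u v = fderiv ℝ (fun y => β y v) x u := fun u v => by
      have h := fderiv_clm_apply (hd x hx) (differentiableAt_const v)
      have h' := congrArg (· u) h
      simp at h'
      exact h'.symm
    rw [e, e, hclosed x hx]
  have key : ∀ b ∈ U, HasFDerivAt (fun c => curveIntegral α (.segment o c)) (α b) b := by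
    intro b hb
    obtain ⟨r, hr, hball⟩ := Metric.isOpen_iff.1 hU b hb
    -- The available Poincaré lemma is for convex sets. The hull of `o` and a ball around `b` is the
    -- union of the segments from `o` to the ball, so it stays in the star-shaped set `U` and is a
    -- neighbourhood of `b`.
    set s : Set E := convexHull ℝ (insert o (Metric.ball b r)) with hsdef
    have hsU : s ⊆ U := by
      rw [hsdef, convexHull_insert ⟨b, Metric.mem_ball_self hr⟩,
        (convex_ball b r).convexHull_eq]
      intro y hy
      simp only [convexJoin_singleton_left, Set.mem_iUnion] at hy
      obtain ⟨z, hz, hy⟩ := hy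
      exact hs.segment_subset (hball hz) hy
    have hos : o ∈ s := subset_convexHull ℝ _ (Set.mem_insert _ _)
    have hbs : Metric.ball b r ⊆ s :=
      (Set.subset_insert _ _).trans (subset_convexHull ℝ _)
    exact ((convex_convexHull ℝ _).hasFDerivWithinAt_curveIntegral_segment_of_hasFDerivWithinAt_symmetric
      (dω := fderiv ℝ α) (fun x hx => (hd x (hsU hx)).hasFDerivAt.hasFDerivWithinAt)
      (fun a ha x _ y _ => hsym a (hsU ha) x y) hos
      (hbs (Metric.mem_ball_self hr))).hasFDerivAt
      (Filter.mem_of_superset (Metric.ball_mem_nhds b hr) hbs)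
  refine ⟨fun c => curveIntegral α (.segment o c), ?_, fun x hx v => by rw [(key x hx).fderiv]; rfl⟩
  rw [contDiffOn_infty_iff_fderiv_of_isOpen hU]
  exact ⟨fun x hx => (key x hx).differentiableAt.differentiableWithinAt,
    hα.congr fun x hx => (key x hx).fderiv⟩

/-! ### Integration over smooth chains and Stokes' theorem -/

section Chains

variable {M : Type*} [TopologicalSpace M] [ChartedSpace R2 M]

/-- The `j`-th vertex of the standard simplex. -/
def vertex (n : ℕ) (j : Fin (n + 1)) : stdSimplex ℝ (Fin (n + 1)) :=
  ⟨Pi.single j 1, single_mem_stdSimplex ℝ j⟩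

lemma face_vertex {n : ℕ} (γ : Simplex M (n + 1)) (i : Fin (n + 2)) (j : Fin (n + 1)) :
    (face γ i).1 (vertex n j) = γ.1 (vertex (n + 1) (i.succAbove j)) :=
  congrArg γ.1 (stdSimplex.map_vertex _ _)

/-- The affine parametrization of the line through the vertices of the standard `1`-simplex. -/
def edge (s : ℝ) : Fin 2 → ℝ := ![1 - s, s]

lemma hasDerivAt_edge (s : ℝ) : HasDerivAt edge ![-1, 1] s := by
  rw [hasDerivAt_pi]
  intro i
  fin_cases i
  · exact (hasDerivAt_id' s).const_sub 1
  · exact hasDerivAt_id' s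

lemma path_eq {γ : Simplex M 1} {g : (Fin 2 → ℝ) → M} (hγ : ∀ x : stdSimplex ℝ (Fin 2), g x.1 = γ.1 x)
    {s : ℝ} (hs : s ∈ Set.Icc (0 : ℝ) 1) : path γ s = g (edge s) := by
  rw [path, ← hγ, Set.projIcc_of_mem zero_le_one hs]
  rfl

/-- The value of a `1`-form on a vector in the model plane. -/
def OneForm.eval (η : OneForm M) (p : M) (v : R2) : ℝ := η p v

/-- Only interior parameters are allowed: `path γ` is constant outside `[0, 1]`, so it need not be
differentiable at the endpoints. -/
lemma integrand_eq (η : OneForm M) {γ : Simplex M 1} {g : (Fin 2 → ℝ) → M}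
    (hg : MDifferentiable 𝓘(ℝ, Fin 2 → ℝ) (𝓡 2) g)
    (hγ : ∀ x : stdSimplex ℝ (Fin 2), g x.1 = γ.1 x) {s : ℝ} (hs : s ∈ Set.Ioo (0 : ℝ) 1) :
    η (path γ s) (mfderiv 𝓘(ℝ, ℝ) (𝓡 2) (path γ) s (1 : ℝ))
      = η (g (edge s)) (tmap g (edge s) ![-1, 1]) := by
  have h0 : path γ =ᶠ[nhds s] fun r => g (edge r) := by
    filter_upwards [isOpen_Ioo.mem_nhds hs] with r hr
    exact path_eq hγ (Set.Ioo_subset_Icc_self hr)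
  have h1 := congrArg (fun L : ℝ →L[ℝ] R2 => L 1)
    (h0.mfderiv_eq (I := 𝓘(ℝ, ℝ)) (I' := 𝓡 2))
  have h2 := mfderiv_comp_apply s (hg (edge s)) (hasDerivAt_edge s).differentiableAt.mdifferentiableAt
    (1 : ℝ)
  have h3 : mfderiv 𝓘(ℝ, ℝ) 𝓘(ℝ, Fin 2 → ℝ) edge s (1 : ℝ) = ![-1, 1] := by
    rw [mfderiv_eq_fderiv]
    exact (hasDerivAt_edge s).deriv
  -- `OneForm.eval` takes vectors in the fixed model plane, so the base point and the vector can be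
  -- rewritten independently.
  exact congrArg₂ (OneForm.eval η) h0.eq_of_nhds (h1.trans (h2.trans (congrArg
    (fun u : Fin 2 → ℝ => (tmap g (edge s) u : R2)) h3)))

/-- The integral of a `1`-form along a `1`-simplex. -/
def simplexIntegral (η : OneForm M) (γ : Simplex M 1) : ℝ :=
  ∫ s in (0 : ℝ)..1, η (path γ s) (mfderiv 𝓘(ℝ, ℝ) (𝓡 2) (path γ) s (1 : ℝ))

lemma simplexIntegral_eq (η : OneForm M) {γ : Simplex M 1} {g : (Fin 2 → ℝ) → M}
    (hg : MDifferentiable 𝓘(ℝ, Fin 2 → ℝ) (𝓡 2) g)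
    (hγ : ∀ x : stdSimplex ℝ (Fin 2), g x.1 = γ.1 x) :
    simplexIntegral η γ = ∫ s in (0 : ℝ)..1, η (g (edge s)) (tmap g (edge s) ![-1, 1]) := by
  rw [simplexIntegral, intervalIntegral.integral_of_le zero_le_one,
    intervalIntegral.integral_of_le zero_le_one, MeasureTheory.integral_Ioc_eq_integral_Ioo,
    MeasureTheory.integral_Ioc_eq_integral_Ioo]
  exact MeasureTheory.setIntegral_congr_fun measurableSet_Ioo fun s hs => integrand_eq η hg hγ hs

/-- The fundamental theorem of calculus along a `1`-simplex. -/
lemma simplexIntegral_eq_sub (η : OneForm M) {γ : Simplex M 1} {g : (Fin 2 → ℝ) → M}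
    (hg : MDifferentiable 𝓘(ℝ, Fin 2 → ℝ) (𝓡 2) g)
    (hγ : ∀ x : stdSimplex ℝ (Fin 2), g x.1 = γ.1 x) {h : (Fin 2 → ℝ) → ℝ} (hh : ContDiff ℝ 1 h)
    (hη : ∀ x v, fderiv ℝ h x v = η (g x) (tmap g x v)) :
    simplexIntegral η γ = h (Pi.single 1 1) - h (Pi.single 0 1) := by
  rw [simplexIntegral_eq η hg hγ]
  simp only [← hη]
  have hd : ∀ s : ℝ, HasDerivAt (fun s => h (edge s)) (fderiv ℝ h (edge s) ![-1, 1]) s := fun s =>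
    ((hh.differentiable (by simp)) _).hasFDerivAt.comp_hasDerivAt s (hasDerivAt_edge s)
  have hc : Continuous edge := continuous_iff_continuousAt.2 fun s => (hasDerivAt_edge s).continuousAt
  rw [intervalIntegral.integral_eq_sub_of_hasDerivAt (fun s _ => hd s)]
  · congr 2
    · ext i; fin_cases i <;> simp [edge]
    · ext i; fin_cases i <;> simp [edge]
  · exact (((hh.continuous_fderiv (by simp)).comp hc).clm_apply continuous_const).intervalIntegrable _ _

lemma integral_eq_sum (η : OneForm M) (c : Chain M 1) :
    integral η c = c.sum fun γ k => (k : ℝ) * simplexIntegral η γ := rfl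

/-- Integration of a `1`-form as a homomorphism on chains. -/
def integralHom (η : OneForm M) : Chain M 1 →+ ℝ :=
  Finsupp.liftAddHom fun γ => (AddMonoidHom.mulRight (simplexIntegral η γ)).comp
    (Int.castAddHom ℝ)

lemma integralHom_apply (η : OneForm M) (c : Chain M 1) : integralHom η c = integral η c := rfl

lemma integralHom_single (η : OneForm M) (γ : Simplex M 1) (k : ℤ) :
    integralHom η (Finsupp.single γ k) = k * simplexIntegral η γ := by
  rw [integralHom_apply, integral_eq_sum, Finsupp.sum_single_index (by simp)]

/-- The integral of an exact form along a cycle vanishes. -/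
lemma integral_eq_zero_of_exact [IsManifold (𝓡 2) ∞ M] (η : OneForm M) {h : M → ℝ}
    (hh : ContMDiff (𝓡 2) 𝓘(ℝ, ℝ) ∞ h)
    (hη : ∀ (p : M) (v : TangentSpace (𝓡 2) p), (mfderiv (𝓡 2) 𝓘(ℝ, ℝ) h p v : ℝ) = η p v)
    {c : Chain M 1} (hc : IsCycle c) : integral η c = 0 := by
  -- `Φ` evaluates `h` on `0`-chains, and `Φ(∂c) = ∫_c dh` is the fundamental theorem of calculus.
  let Φ : Chain M 0 →+ ℝ := Finsupp.liftAddHom fun γ =>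
    (AddMonoidHom.mulRight (h (γ.1 (vertex 0 0)))).comp (Int.castAddHom ℝ)
  have hΦ : ∀ γ k, Φ (Finsupp.single γ k) = k * h (γ.1 (vertex 0 0)) := fun γ k => by
    simp [Φ]
  have key : Φ (boundary c) = integral η c := by
    rw [boundary, map_finsuppSum, integral_eq_sum]
    refine Finsupp.sum_congr fun γ _ => ?_
    obtain ⟨g, hg, hγ⟩ := γ.2
    have hg' : MDifferentiable 𝓘(ℝ, Fin 2 → ℝ) (𝓡 2) g := hg.mdifferentiable (by simp)
    have e := simplexIntegral_eq_sub η hg' hγ (h := fun x => h (g x))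
      ((contMDiff_iff_contDiff.1 (hh.comp hg)).of_le (by norm_cast)) fun x v => by
        rw [← hη]
        have e := mfderiv_comp_apply x ((hh.mdifferentiable (by simp)) (g x)) (hg' x) v
        rw [mfderiv_eq_fderiv] at e
        exact e
    rw [e, map_sum, Fin.sum_univ_two, hΦ, hΦ, face_vertex, face_vertex, ← hγ, ← hγ]
    simp [vertex]
    ring
  rw [← key, hc, map_zero]

/-- A `1`-form on a surface whose pullbacks by smooth maps from vector spaces are smooth and
closed. -/
structure IsClosedForm (η : OneForm M) : Prop where
  add : ∀ p v w, η p (v + w) = η p v + η p w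
  smul : ∀ p (r : ℝ) v, η p (r • v) = r * η p v
  contDiff : ∀ {n : ℕ} (g : (Fin n → ℝ) → M), ContMDiff 𝓘(ℝ, Fin n → ℝ) (𝓡 2) ∞ g → ∀ v,
    ContDiff ℝ ∞ fun y => η (g y) (tmap g y v)
  closed : ∀ {n : ℕ} (g : (Fin n → ℝ) → M), ContMDiff 𝓘(ℝ, Fin n → ℝ) (𝓡 2) ∞ g → ∀ x u v,
    fderiv ℝ (fun y => η (g y) (tmap g y v)) x u = fderiv ℝ (fun y => η (g y) (tmap g y u)) x v

/-- The integral of a closed form along a boundary vanishes. -/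
lemma IsClosedForm.integral_boundary {η : OneForm M} (hη : IsClosedForm η) (b : Chain M 2) :
    integral η (boundary b) = 0 := by
  rw [← integralHom_apply, boundary, map_finsuppSum]
  refine Finset.sum_eq_zero fun γ _ => ?_
  obtain ⟨g, hg, hγ⟩ := γ.2
  -- The extension `g` is defined on all of `ℝ³`, so the pulled back form has a global primitive
  -- `h`. Each face contributes a difference of values of `h` at two vertices, and the alternating
  -- sum over the faces is zero.
  obtain ⟨h, hh, hh'⟩ := exists_primitive (U := Set.univ) isOpen_univ
    (convex_univ.starConvex (Set.mem_univ (0 : Fin 3 → ℝ))) (fun y v => η (g y) (tmap g y v))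
    (fun x v w => by
      have e : tmap g x (v + w) = tmap g x v + tmap g x w :=
        (mfderiv 𝓘(ℝ, Fin 3 → ℝ) (𝓡 2) g x).map_add v w
      rw [e, hη.add])
    (fun x r v => by
      have e : tmap g x (r • v) = r • tmap g x v :=
        (mfderiv 𝓘(ℝ, Fin 3 → ℝ) (𝓡 2) g x).map_smul r v
      rw [e, hη.smul])
    (fun v => (hη.contDiff g hg v).contDiffOn) (fun x _ u v => hη.closed g hg x u v)
  rw [contDiffOn_univ] at hh
  have key : ∀ i : Fin 3, simplexIntegral η (face γ i) =
      h (Pi.single (i.succAbove 1) 1) - h (Pi.single (i.succAbove 0) 1) := fun i => by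
    let ι : (Fin 2 → ℝ) →L[ℝ] (Fin 3 → ℝ) := LinearMap.toContinuousLinearMap
      (FunOnFinite.linearMap ℝ ℝ (Fin.succAbove i))
    have hι : ∀ j, ι (Pi.single j 1) = Pi.single (i.succAbove j) 1 := fun j =>
      FunOnFinite.linearMap_piSingle ..
    have hg' : MDifferentiable 𝓘(ℝ, Fin 3 → ℝ) (𝓡 2) g := hg.mdifferentiable (by simp)
    have e := simplexIntegral_eq_sub η (γ := face γ i) (g := fun x => g (ι x))
      ((hg.comp ι.contMDiff).mdifferentiable (by simp))
      (fun x => hγ (stdSimplex.map (Fin.succAbove i) x)) (h := fun x => h (ι x))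
      ((hh.comp ι.contDiff).of_le (by norm_cast)) fun x v => by
        have e1 : fderiv ℝ (fun x => h (ι x)) x v = fderiv ℝ h (ι x) (ι v) := by
          have := fderiv_comp x ((hh.differentiable (by simp)) (ι x)) ι.differentiableAt
          rw [ι.fderiv] at this
          exact congrArg (· v) this
        have e2 : tmap (fun x => g (ι x)) x v = tmap g (ι x) (ι v) := by
          have := mfderiv_comp_apply x (hg' (ι x)) ι.differentiableAt.mdifferentiableAt v
          rw [mfderiv_eq_fderiv, ι.fderiv] at this
          exact this
        rw [e1, e2, hh' _ (Set.mem_univ _)]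
    rw [e, hι, hι]
  simp only [map_sum, integralHom_single, key]
  refine (Fin.sum_univ_three _).trans ?_
  have a1 : (0 : Fin 3).succAbove 0 = 1 := rfl
  have a2 : (0 : Fin 3).succAbove 1 = 2 := rfl
  have a3 : (1 : Fin 3).succAbove 0 = 0 := rfl
  have a4 : (1 : Fin 3).succAbove 1 = 2 := rfl
  have a5 : (2 : Fin 3).succAbove 0 = 0 := rfl
  have a6 : (2 : Fin 3).succAbove 1 = 1 := rfl
  rw [a1, a2, a3, a4, a5, a6]
  push_cast
  simp
  ring

lemma IsClosedForm.integral_eq_of_homologous {η : OneForm M} (hη : IsClosedForm η)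
    {c c' : Chain M 1} (h : Homologous c c') : integral η c' = integral η c := by
  obtain ⟨b, hb⟩ := h
  have := hη.integral_boundary b
  rw [hb, ← integralHom_apply, map_sub, integralHom_apply, integralHom_apply] at this
  linarith

/-- The pullback of a `1`-form by a diffeomorphism. -/
def OneForm.pullback (ψ : M ≃ₘ^∞⟮𝓡 2, 𝓡 2⟯ M) (η : OneForm M) : OneForm M :=
  fun p v => η (ψ p) (mfderiv (𝓡 2) (𝓡 2) ψ p v)

lemma tmap_comp (ψ : M ≃ₘ^∞⟮𝓡 2, 𝓡 2⟯ M) {E : Type*} [NormedAddCommGroup E] [NormedSpace ℝ E]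
    {g : E → M} {x : E} (hg : MDifferentiableAt 𝓘(ℝ, E) (𝓡 2) g x) (v : E) :
    tmap (fun y => ψ (g y)) x v = mfderiv (𝓡 2) (𝓡 2) ψ (g x) (tmap g x v) :=
  mfderiv_comp_apply x (ψ.contMDiff.mdifferentiable (by simp) (g x)) hg v

lemma integral_push (ψ : M ≃ₘ^∞⟮𝓡 2, 𝓡 2⟯ M) (η : OneForm M) (c : Chain M 1) :
    integral η (c.push ψ) = integral (η.pullback ψ) c := by
  rw [integral_eq_sum, integral_eq_sum, Chain.push, Finsupp.sum_mapDomain_index (by simp)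
    (fun _ _ _ => by push_cast; ring)]
  refine Finsupp.sum_congr fun γ _ => ?_
  obtain ⟨g, hg, hγ⟩ := γ.2
  have hg' : MDifferentiable 𝓘(ℝ, Fin 2 → ℝ) (𝓡 2) g := hg.mdifferentiable (by simp)
  rw [simplexIntegral_eq η (γ := Simplex.push ψ γ) (g := fun y => ψ (g y))
    ((ψ.contMDiff.comp hg).mdifferentiable (by simp)) (fun x => congrArg ψ (hγ x)),
    simplexIntegral_eq (η.pullback ψ) hg' hγ]
  simp only [tmap_comp ψ (hg' _)]
  rfl

lemma integral_congr {η θ : OneForm M} (h : ∀ p v, η p v = θ p v) (c : Chain M 1) :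
    integral η c = integral θ c := by
  rw [show η = θ from funext fun p => funext fun v => h p v]

lemma IsClosedForm.integral_sum {ι : Type*} (s : Finset ι) {η : ι → OneForm M}
    (hη : ∀ i, IsClosedForm (η i)) (a : ι → ℝ) (c : Chain M 1) :
    integral (fun p v => ∑ i ∈ s, a i * η i p v) c = ∑ i ∈ s, a i * integral (η i) c := by
  have key : ∀ γ : Simplex M 1, simplexIntegral (fun p v => ∑ i ∈ s, a i * η i p v) γ
      = ∑ i ∈ s, a i * simplexIntegral (η i) γ := fun γ => by
    obtain ⟨g, hg, hγ⟩ := γ.2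
    have hg' : MDifferentiable 𝓘(ℝ, Fin 2 → ℝ) (𝓡 2) g := hg.mdifferentiable (by simp)
    have hc : Continuous edge :=
      continuous_iff_continuousAt.2 fun s => (hasDerivAt_edge s).continuousAt
    rw [simplexIntegral_eq _ hg' hγ, intervalIntegral.integral_finsetSum]
    · simp only [intervalIntegral.integral_const_mul, simplexIntegral_eq _ hg' hγ]
    · intro i _
      exact (continuous_const.mul (((hη i).contDiff g hg _).continuous.comp hc)).intervalIntegrable
        _ _
  simp only [integral_eq_sum, key, Finsupp.sum, Finset.mul_sum]
  rw [Finset.sum_comm]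
  exact Finset.sum_congr rfl fun i _ => Finset.sum_congr rfl fun γ _ => by ring

end Chains

/-! ### Isometries and their effect on an invariant immersion -/

/-- `Φ` is an orientation preserving isometry of the open star-shaped subset `U` of `E³(κ, τ)` into
`E³(κ, τ)`, whose inverse differential maps `kill κ τ c` to `kill κ τ (A c)`. -/
structure IsLocalIsometry (κ τ : ℝ) (U : Set R3) (Φ : R3 → R3)
    (A : (Fin 4 → ℝ) → Fin 4 → ℝ) : Prop where
  isOpen : IsOpen U
  subset : U ⊆ E3 κ
  star : StarConvex ℝ 0 U
  mapsTo : ∀ x ∈ U, Φ x ∈ E3 κ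
  smooth : ∀ x ∈ U, ContDiffAt ℝ ∞ Φ x
  metric_eq : ∀ x ∈ U, ∀ u v,
    metric κ τ (Φ x) (fderiv ℝ Φ x u) (fderiv ℝ Φ x v) = metric κ τ x u v
  vol_eq : ∀ x ∈ U, ∀ u v w,
    vol κ (Φ x) (fderiv ℝ Φ x u) (fderiv ℝ Φ x v) (fderiv ℝ Φ x w) = vol κ x u v w
  kill_eq : ∀ x ∈ U, ∀ c, kill κ τ c (Φ x) = fderiv ℝ Φ x (kill κ τ (A c) x)

lemma cov_zero_comm {κ τ : ℝ} {x : R3} (hx : x ∈ E3 κ) (u v : R3) :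
    cov κ τ x u v 0 = cov κ τ x v u 0 := by
  have := cov_sub_cov (τ := τ) hx u v 0 0
  rw [sub_self] at this
  exact sub_eq_zero.1 (this.trans (coframeₗ κ τ x).map_zero)

lemma cov_add (κ τ : ℝ) (x h u u' v' : R3) :
    cov κ τ x h u (u' + v') = cov κ τ x h u u' + coframe κ τ x v' := by
  simp only [cov, coframe_add]; abel

lemma cov_smul (κ τ : ℝ) (x h u u' : R3) (r : ℝ) :
    cov κ τ x h (r • u) (r • u') = r • cov κ τ x h u u' := by
  ext i
  fin_cases i <;> simp [cov, coframe, dcoframe, connection, vert, cross_apply] <;> ring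

namespace IsLocalIsometry

variable {κ τ : ℝ} {U : Set R3} {Φ : R3 → R3} {A : (Fin 4 → ℝ) → Fin 4 → ℝ}

/-- Isometries preserve the Levi-Civita connection. -/
lemma cov_eq (hΦ : IsLocalIsometry κ τ U Φ A) {x : R3} (hx : x ∈ U) (u v v' w : R3) :
    cov κ τ (Φ x) (fderiv ℝ Φ x u) (fderiv ℝ Φ x v)
        (fderiv ℝ (fderiv ℝ Φ) x u v + fderiv ℝ Φ x v') ⬝ᵥ coframe κ τ (Φ x) (fderiv ℝ Φ x w)
      = cov κ τ x u v v' ⬝ᵥ coframe κ τ x w := by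
  have hs := hΦ.smooth x hx
  have hd := hs.differentiableAt (by simp)
  have hU := hΦ.isOpen.mem_nhds hx
  -- `B` is the difference between the pulled back connection and the original one. It is symmetric
  -- in the first two arguments (no torsion) and skew in the last two (metric compatibility), so it
  -- vanishes.
  let B : R3 → R3 → R3 → ℝ := fun u v w =>
    cov κ τ (Φ x) (fderiv ℝ Φ x u) (fderiv ℝ Φ x v) (fderiv ℝ (fderiv ℝ Φ) x u v)
        ⬝ᵥ coframe κ τ (Φ x) (fderiv ℝ Φ x w)
      - cov κ τ x u v 0 ⬝ᵥ coframe κ τ x w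
  have h1 : ∀ u v w, B u v w = B v u w := fun u v w => by
    simp only [B, cov_fderiv_comm hs (hΦ.mapsTo x hx) u v, cov_zero_comm (hΦ.subset hx) u v]
  have h2 : ∀ u v w, B u v w = -B u w v := fun u v w => by
    have d : ∀ v, DifferentiableAt ℝ (fun y => fderiv ℝ Φ y v) x := fun v =>
      hs.differentiableAt_fderiv.clm_apply (differentiableAt_const v)
    have e1 := fderiv_metric (τ := τ) hd (d v) (d w) (hΦ.mapsTo x hx) u
    have e2 := fderiv_metric (τ := τ) (φ := fun y : R3 => y) (a := fun _ => v) (b := fun _ => w)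
      differentiableAt_id (differentiableAt_const v) (differentiableAt_const w) (hΦ.subset hx) u
    have e3 : (fun y => metric κ τ (Φ y) (fderiv ℝ Φ y v) (fderiv ℝ Φ y w))
        =ᶠ[nhds x] fun y => metric κ τ y v w := by
      filter_upwards [hU] with y hy using hΦ.metric_eq y hy v w
    rw [e3.fderiv_eq, e2, fderiv_fderiv_apply hs, fderiv_fderiv_apply hs] at e1
    simp only [fderiv_fun_id, ContinuousLinearMap.id_apply, fderiv_fun_const, Pi.zero_apply,
      zero_apply] at e1
    rw [dotProduct_comm (coframe κ τ x v),
      dotProduct_comm (coframe κ τ (Φ x) (fderiv ℝ Φ x v))] at e1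
    simp only [B]
    linarith
  have h3 : B u v w = 0 := by
    have := h2 u v w
    rw [h1 u w v, h2 w u v, h1 w v u, h2 v w u, h1 v u w] at this
    linarith
  have h4 := hΦ.metric_eq x hx v' w
  rw [metric_eq_dot, metric_eq_dot] at h4
  rw [cov_add, add_dotProduct, h4, ← zero_add v', cov_add, add_dotProduct, zero_add]
  simp only [B] at h3
  linarith

section Surface

variable {M : Type*} [TopologicalSpace M] [ChartedSpace R2 M]
  {H : ℝ} {f N : M → R3} {ψ : M ≃ₘ^∞⟮𝓡 2, 𝓡 2⟯ M}

lemma dmap_diffeo (hΦ : IsLocalIsometry κ τ U Φ A) (hf : IsCMCImmersion κ τ H f N)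
    (hU : ∀ p, f p ∈ U) (hψ : ∀ p, f (ψ p) = Φ (f p)) (p : M) (v : TangentSpace (𝓡 2) p) :
    dmap f (ψ p) (mfderiv (𝓡 2) (𝓡 2) ψ p v) = fderiv ℝ Φ (f p) (dmap f p v) := by
  have hf' := hf.smooth.mdifferentiable (by simp)
  have h1 := mfderiv_comp_apply p (hf' (ψ p)) (ψ.contMDiff.mdifferentiable (by simp) p) v
  have h2 := mfderiv_comp_apply p
    ((hΦ.smooth _ (hU p)).differentiableAt (by simp)).mdifferentiableAt (hf' p) v
  rw [show f ∘ ψ = Φ ∘ f from funext hψ, h2, mfderiv_eq_fderiv] at h1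
  exact h1.symm

/-- A diffeomorphism induced by an isometry preserves the normal up to sign. -/
lemma normal_diffeo (hΦ : IsLocalIsometry κ τ U Φ A) (hf : IsCMCImmersion κ τ H f N)
    (hU : ∀ p, f p ∈ U) (hψ : ∀ p, f (ψ p) = Φ (f p)) (p : M) :
    N (ψ p) = metric κ τ (f (ψ p)) (N (ψ p)) (fderiv ℝ Φ (f p) (N p)) • fderiv ℝ Φ (f p) (N p)
    ∧ metric κ τ (f (ψ p)) (N (ψ p)) (fderiv ℝ Φ (f p) (N p)) ^ 2 = 1 := by
  obtain ⟨a, b, h⟩ := hf.exists_frame p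
  have e : ∀ u v, coframe κ τ (f (ψ p)) (fderiv ℝ Φ (f p) u)
      ⬝ᵥ coframe κ τ (f (ψ p)) (fderiv ℝ Φ (f p) v) = coframe κ τ (f p) u ⬝ᵥ coframe κ τ (f p) v :=
    fun u v => by rw [← metric_eq_dot, hψ, hΦ.metric_eq _ (hU p), metric_eq_dot]
  have h' : IsFrame (coframe κ τ (f (ψ p)) (fderiv ℝ Φ (f p) (N p)))
      (coframe κ τ (f (ψ p)) (fderiv ℝ Φ (f p) (dmap f p a)))
      (coframe κ τ (f (ψ p)) (fderiv ℝ Φ (f p) (dmap f p b))) :=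
    ⟨(e _ _).trans h.nn, (e _ _).trans h.aa, (e _ _).trans h.bb, (e _ _).trans h.na,
      (e _ _).trans h.nb, (e _ _).trans h.ab⟩
  have z : ∀ v, coframe κ τ (f (ψ p)) (N (ψ p))
      ⬝ᵥ coframe κ τ (f (ψ p)) (fderiv ℝ Φ (f p) (dmap f p v)) = 0 := fun v => by
    rw [← hΦ.dmap_diffeo hf hU hψ]
    exact hf.normal_dot _ _
  -- `dΦ` carries a frame adapted to the surface at `p` to one at `ψ(p)`. Being orthogonal to the
  -- two tangent vectors, `N (ψ p)` is a multiple of the third vector.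
  have k := h'.expand (coframe κ τ (f (ψ p)) (N (ψ p)))
  rw [z, z, zero_smul, zero_smul, add_zero, add_zero, ← metric_eq_dot, ← coframe_smul] at k
  have k' := coframe_injective (hf.mem (ψ p)) k
  refine ⟨k', ?_⟩
  have u := hf.unit (ψ p)
  rw [metric_eq_dot, k, coframe_smul, smul_dotProduct, dotProduct_smul, h'.nn] at u
  simpa [sq] using u

/-- The factor between the two normals is a continuous function with square one, hence constant on a
connected surface. -/
lemma exists_sign [PreconnectedSpace M] [Nonempty M] (hΦ : IsLocalIsometry κ τ U Φ A)
    (hf : IsCMCImmersion κ τ H f N) (hU : ∀ p, f p ∈ U) (hψ : ∀ p, f (ψ p) = Φ (f p)) :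
    ∃ ε : ℝ, (ε = 1 ∨ ε = -1) ∧ ∀ p, N (ψ p) = ε • fderiv ℝ Φ (f p) (N p) := by
  have hc : Continuous fun p => metric κ τ (f (ψ p)) (N (ψ p)) (fderiv ℝ Φ (f p) (N p)) := by
    have c1 : Continuous fun p => f (ψ p) := hf.smooth.continuous.comp ψ.contMDiff.continuous
    have c2 : Continuous fun p => N (ψ p) := hf.smooth_normal.continuous.comp ψ.contMDiff.continuous
    have c3 : Continuous fun p => fderiv ℝ Φ (f p) := continuous_iff_continuousAt.2 fun p =>
      ContinuousAt.comp ((hΦ.smooth _ (hU p)).continuousAt_fderiv (by simp))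
        hf.smooth.continuous.continuousAt
    have c4 : Continuous fun p => fderiv ℝ Φ (f p) (N p) :=
      c3.clm_apply hf.smooth_normal.continuous
    refine continuous_iff_continuousAt.2 fun p => ?_
    have key : ContinuousAt (fun q : R3 × R3 × R3 => metric κ τ q.1 q.2.1 q.2.2)
        (f (ψ p), N (ψ p), fderiv ℝ Φ (f p) (N p)) :=
      (contDiffAt_metric (n := 0) contDiffAt_fst contDiffAt_snd.fst contDiffAt_snd.snd
        (hf.mem (ψ p))).continuousAt
    exact ContinuousAt.comp (f := fun p => (f (ψ p), N (ψ p), fderiv ℝ Φ (f p) (N p))) key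
      (c1.prodMk (c2.prodMk c4)).continuousAt
  have hsq := fun p => (hΦ.normal_diffeo hf hU hψ p).2
  have hN := fun p => (hΦ.normal_diffeo hf hU hψ p).1
  rcases isPreconnected_univ.eq_one_or_eq_neg_one_of_sq_eq hc.continuousOn
    (fun p _ => hsq p) with h | h
  · refine ⟨1, Or.inl rfl, fun p => (hN p).trans ?_⟩
    exact congrArg (· • fderiv ℝ Φ (f p) (N p)) (h (Set.mem_univ p))
  · refine ⟨-1, Or.inr rfl, fun p => (hN p).trans ?_⟩
    exact congrArg (· • fderiv ℝ Φ (f p) (N p)) (h (Set.mem_univ p))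

/-- Differentiating `N ∘ ψ = ε dΦ(N)` produces a second derivative of `Φ`, which is the term that
`cov_eq` absorbs. So the second fundamental form is multiplied by `ε`. -/
lemma covNormal_diffeo [IsManifold (𝓡 2) ∞ M] (hΦ : IsLocalIsometry κ τ U Φ A)
    (hf : IsCMCImmersion κ τ H f N)
    (hU : ∀ p, f p ∈ U) (hψ : ∀ p, f (ψ p) = Φ (f p)) {ε : ℝ}
    (hε : ∀ p, N (ψ p) = ε • fderiv ℝ Φ (f p) (N p)) (p : M) (v w : TangentSpace (𝓡 2) p) :
    covNormal κ τ f N (ψ p) (mfderiv (𝓡 2) (𝓡 2) ψ p v)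
        ⬝ᵥ frameMap κ τ f (ψ p) (mfderiv (𝓡 2) (𝓡 2) ψ p w)
      = ε * (covNormal κ τ f N p v ⬝ᵥ frameMap κ τ f p w) := by
  have key : dmap N (ψ p) (mfderiv (𝓡 2) (𝓡 2) ψ p v) =
      ε • (fderiv ℝ (fderiv ℝ Φ) (f p) (dmap f p v) (N p) + fderiv ℝ Φ (f p) (dmap N p v)) := by
    clear w
    revert v
    induction p using parametrization_induction with | h g x hg hs => ?_
    intro v
    obtain ⟨u, rfl⟩ := hs v
    have hg' := hg.mdifferentiableAt (by simp)
    have d1 := (hf.contDiffAt_map hg).differentiableAt (by simp)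
    have d2 := (hf.contDiffAt_normal hg).differentiableAt (by simp)
    have d3 := (hΦ.smooth _ (hU (g x))).differentiableAt_fderiv
    have d4 : DifferentiableAt ℝ (fun y => fderiv ℝ Φ (f (g y))) x := d3.comp x d1
    have e1 : fderiv ℝ (fun y => N (ψ (g y))) x u
        = dmap N (ψ (g x)) (mfderiv (𝓡 2) (𝓡 2) ψ (g x) (tmap g x u)) := by
      rw [← tmap_comp ψ hg']
      exact hf.fderiv_normal ((ψ.contMDiff.mdifferentiable (by simp) _).comp x hg') u
    rw [← e1, funext fun y => hε (g y), fderiv_fun_const_smul (d4.clm_apply d2),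
      fderiv_clm_apply d4 d2]
    have e2 : fderiv ℝ (fun y => fderiv ℝ Φ (f (g y))) x u
        = fderiv ℝ (fderiv ℝ Φ) (f (g x)) (fderiv ℝ (fun y => f (g y)) x u) :=
      congrArg (· u) (fderiv_comp x d3 d1)
    simp only [smul_apply, add_apply,
      ContinuousLinearMap.comp_apply, ContinuousLinearMap.flip_apply, e2,
      hf.fderiv_map hg', hf.fderiv_normal hg']
    rw [add_comm]
  rw [covNormal, key, hε, cov_smul, smul_dotProduct, frameMap, hΦ.dmap_diffeo hf hU hψ,
    hΦ.dmap_diffeo hf hU hψ, hψ, hΦ.cov_eq (hU p), smul_eq_mul]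
  rfl

/-- If the mean curvature is not zero, the induced diffeomorphism preserves the normal. -/
lemma sign_eq_one [IsManifold (𝓡 2) ∞ M] [Nonempty M]
    (hΦ : IsLocalIsometry κ τ U Φ A) (hf : IsCMCImmersion κ τ H f N)
    (hU : ∀ p, f p ∈ U) (hψ : ∀ p, f (ψ p) = Φ (f p)) {ε : ℝ}
    (hε : ∀ p, N (ψ p) = ε • fderiv ℝ Φ (f p) (N p)) (hH : H ≠ 0) : ε = 1 := by
  obtain ⟨p⟩ := ‹Nonempty M›
  obtain ⟨a, b, h⟩ := hf.exists_frame p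
  have e : ∀ u v, metric κ τ (f (ψ p)) (dmap f (ψ p) (mfderiv (𝓡 2) (𝓡 2) ψ p u))
      (dmap f (ψ p) (mfderiv (𝓡 2) (𝓡 2) ψ p v))
      = frameMap κ τ f p u ⬝ᵥ frameMap κ τ f p v := fun u v => by
    rw [hΦ.dmap_diffeo hf hU hψ, hΦ.dmap_diffeo hf hU hψ, hψ, hΦ.metric_eq _ (hU p), metric_eq_dot]
    rfl
  have h1 := hf.meanCurvature p a b ((metric_eq_dot ..).trans h.aa)
    ((metric_eq_dot ..).trans h.bb) ((metric_eq_dot ..).trans h.ab)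
  have h2 := hf.meanCurvature (ψ p) _ _ ((e _ _).trans h.aa)
    ((e _ _).trans h.bb) ((e _ _).trans h.ab)
  rw [hf.covInner_eq, hf.covInner_eq] at h1 h2
  rw [hΦ.covNormal_diffeo hf hU hψ hε, hΦ.covNormal_diffeo hf hU hψ hε] at h2
  -- The traces at `p` and `ψ(p)` are both governed by `H` and differ by the factor `ε`, so `H = ε
  -- H`.
  have h3 : (ε - 1) * H = 0 := by
    linear_combination (1 - ε) * h1 + h2 - h1
  rcases mul_eq_zero.1 h3 with h | h
  · linarith
  · exact absurd h hH

end Surface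

end IsLocalIsometry

lemma metric_add_right (κ τ : ℝ) (x u v w : R3) :
    metric κ τ x u (v + w) = metric κ τ x u v + metric κ τ x u w := by
  simp [metric, vert]; ring

lemma metric_smul_right (κ τ : ℝ) (x u v : R3) (r : ℝ) :
    metric κ τ x u (r • v) = r * metric κ τ x u v := by
  simp [metric, vert]; ring

lemma vol_add_right (κ : ℝ) (x u v w w' : R3) :
    vol κ x u v (w + w') = vol κ x u v w + vol κ x u v w' := by
  simp [vol, Matrix.det_fin_three]; ring

lemma vol_smul_right (κ : ℝ) (x u v w : R3) (r : ℝ) :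
    vol κ x u v (r • w) = r * vol κ x u v w := by
  simp [vol, Matrix.det_fin_three]; ring

lemma vol_smul_left (κ : ℝ) (x u v w : R3) (r : ℝ) :
    vol κ x (r • u) v w = r * vol κ x u v w := by
  simp [vol, Matrix.det_fin_three]; ring

/-! ### Noether forms and differentials as closed forms -/

section Forms

variable {M : Type*} [TopologicalSpace M] [ChartedSpace R2 M] {κ τ H : ℝ} {f N : M → R3}

lemma IsCMCImmersion.isClosedForm [IsManifold (𝓡 2) ∞ M] (hf : IsCMCImmersion κ τ H f N)
    (c : Fin 4 → ℝ) {F : R3 → R3} (hF : IsPotential κ τ F (kill κ τ c)) :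
    IsClosedForm (noetherForm κ τ H f N (kill κ τ c ∘ f) (F ∘ f)) where
  add p v w := by simp only [noetherForm, dmap_add, metric_add_right, vol_add_right]; ring
  smul p r v := by simp only [noetherForm, dmap_smul, metric_smul_right, vol_smul_right]; ring
  contDiff _ hg v := hf.contDiff_noetherForm c hF hg v
  closed _ hg _ u v := hf.noetherForm_closed c hF hg u v

/-- The differential of a function on a surface. -/
def differential (h : M → ℝ) : OneForm M := fun p v => mfderiv (𝓡 2) 𝓘(ℝ, ℝ) h p v

lemma fderiv_comp_function {E : Type*} [NormedAddCommGroup E] [NormedSpace ℝ E] {h : M → ℝ}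
    {g : E → M} {x : E} (hh : MDifferentiableAt (𝓡 2) 𝓘(ℝ, ℝ) h (g x))
    (hg : MDifferentiableAt 𝓘(ℝ, E) (𝓡 2) g x) (v : E) :
    fderiv ℝ (fun y => h (g y)) x v = differential h (g x) (tmap g x v) := by
  have e := mfderiv_comp_apply x hh hg v
  rw [mfderiv_eq_fderiv] at e
  exact e

lemma isClosedForm_differential {h : M → ℝ} (hh : ContMDiff (𝓡 2) 𝓘(ℝ, ℝ) ∞ h) :
    IsClosedForm (differential h) := by
  have e : ∀ {n : ℕ} (g : (Fin n → ℝ) → M), ContMDiff 𝓘(ℝ, Fin n → ℝ) (𝓡 2) ∞ g → ∀ y v,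
      differential h (g y) (tmap g y v) = fderiv ℝ (fun y => h (g y)) y v := fun g hg y v =>
    (fderiv_comp_function (hh.mdifferentiable (by simp) _) (hg.mdifferentiable (by simp) _) v).symm
  have d : ∀ {n : ℕ} (g : (Fin n → ℝ) → M), ContMDiff 𝓘(ℝ, Fin n → ℝ) (𝓡 2) ∞ g →
      ContDiff ℝ ∞ fun y => h (g y) := fun g hg => contMDiff_iff_contDiff.1 (hh.comp hg)
  refine ⟨fun p v w => ?_, fun p r v => ?_, fun g hg v => ?_, fun g hg x u v => ?_⟩
  · exact (mfderiv (𝓡 2) 𝓘(ℝ, ℝ) h p).map_add v w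
  · exact (mfderiv (𝓡 2) 𝓘(ℝ, ℝ) h p).map_smul r v
  · simp only [e g hg]
    exact ((d g hg).fderiv_right (m := ∞) (by norm_cast)).clm_apply contDiff_const
  · simp only [e g hg]
    rw [fderiv_fderiv_apply (d g hg).contDiffAt, fderiv_fderiv_apply (d g hg).contDiffAt,
      fderiv_fderiv_comm (d g hg).contDiffAt]

lemma IsCMCImmersion.contMDiff_comp (hf : IsCMCImmersion κ τ H f N) {k : R3 → ℝ} {U : Set R3}
    (hU : IsOpen U) (hfU : ∀ p, f p ∈ U) (hk : ContDiffOn ℝ ∞ k U) :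
    ContMDiff (𝓡 2) 𝓘(ℝ, ℝ) ∞ fun p => k (f p) := fun p =>
  (hk.contDiffAt (hU.mem_nhds (hfU p))).contMDiffAt.comp p (hf.smooth p)

lemma IsCMCImmersion.differential_comp (hf : IsCMCImmersion κ τ H f N) {k : R3 → ℝ} {p : M}
    (hk : DifferentiableAt ℝ k (f p)) (v : TangentSpace (𝓡 2) p) :
    differential (fun p => k (f p)) p v = fderiv ℝ k (f p) (dmap f p v) := by
  have e := mfderiv_comp_apply p hk.mdifferentiableAt (hf.smooth.mdifferentiable (by simp) p) v
  rw [mfderiv_eq_fderiv] at e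
  exact e

end Forms

/-! ### Transformation of the Noether forms and of their periods under isometries -/

namespace IsLocalIsometry

variable {κ τ : ℝ} {U : Set R3} {Φ : R3 → R3} {A : (Fin 4 → ℝ) → Fin 4 → ℝ}

/-- The pullback of `F^♭` by an isometry agrees up to an exact form with `G^♭`, if `F` and `G` are
potentials of corresponding Killing fields. -/
lemma exists_primitive_pullback (hΦ : IsLocalIsometry κ τ U Φ A) {c : Fin 4 → ℝ}
    {F G : R3 → R3} (hF : IsPotential κ τ F (kill κ τ c))
    (hG : IsPotential κ τ G (kill κ τ (A c))) :
    ∃ k : R3 → ℝ, ContDiffOn ℝ ∞ k U ∧ ∀ x ∈ U, ∀ v, fderiv ℝ k x v =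
      metric κ τ (Φ x) (F (Φ x)) (fderiv ℝ Φ x v) - metric κ τ x (G x) v := by
  have h1 : ∀ x ∈ U, ∀ v,
      ContDiffAt ℝ ∞ (fun x => metric κ τ (Φ x) (F (Φ x)) (fderiv ℝ Φ x v)) x := fun x hx v =>
    contDiffAt_metric (hΦ.smooth x hx)
      ((hF.contDiffAt (hΦ.mapsTo x hx)).comp x (hΦ.smooth x hx))
      (((hΦ.smooth x hx).fderiv_right (m := ∞) (by norm_cast)).clm_apply contDiffAt_const)
      (hΦ.mapsTo x hx)
  have h2 : ∀ x ∈ U, ∀ v, ContDiffAt ℝ ∞ (fun x => metric κ τ x (G x) v) x := fun x hx v =>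
    contDiffAt_metric contDiffAt_id (hG.contDiffAt (hΦ.subset hx)) contDiffAt_const (hΦ.subset hx)
  refine exists_primitive hΦ.isOpen hΦ.star
    (fun x v => metric κ τ (Φ x) (F (Φ x)) (fderiv ℝ Φ x v) - metric κ τ x (G x) v) ?_ ?_ ?_ ?_
  · intro x v w
    simp only [map_add, metric_add_right]; ring
  · intro x r v
    simp only [map_smul, metric_smul_right]; ring
  · exact fun v x hx => ((h1 x hx v).sub (h2 x hx v)).contDiffWithinAt
  · intro x hx u v
    have d1 := fun v => (h1 x hx v).differentiableAt (by simp)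
    have d2 := fun v => (h2 x hx v).differentiableAt (by simp)
    have e1 := hF.fderiv_pullback (hΦ.smooth x hx) (hΦ.mapsTo x hx) u v
    have e2 := hG.2 x (hΦ.subset hx) u v
    -- After this, both `1`-forms have as exterior derivative the contraction of the volume with
    -- `kill κ τ (A c)`, so their difference is closed.
    rw [hΦ.kill_eq x hx, hΦ.vol_eq x hx] at e1
    rw [fderiv_fun_sub (d1 v) (d2 v), fderiv_fun_sub (d1 u) (d2 u)]
    simp only [sub_apply]
    linear_combination e1 - e2

variable {M : Type*} [TopologicalSpace M] [ChartedSpace R2 M] [IsManifold (𝓡 2) ∞ M]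
  [ConnectedSpace M] {H : ℝ} {f N : M → R3} {ψ : M ≃ₘ^∞⟮𝓡 2, 𝓡 2⟯ M}

/-- The transformation law of the periods of the Noether forms. -/
theorem integral_noetherForm (hΦ : IsLocalIsometry κ τ U Φ A) (hf : IsCMCImmersion κ τ H f N)
    {F : (Fin 4 → ℝ) → R3 → R3} (hF : ∀ c, IsPotential κ τ (F c) (kill κ τ c))
    (hU : ∀ p, f p ∈ U) (hψ : ∀ p, f (ψ p) = Φ (f p)) {z : Chain M 1} (hz : IsCycle z)
    (hz' : Homologous z (z.push ψ)) :
    ∃ ε : ℝ, (ε = 1 ∨ ε = -1 ∧ H = 0) ∧ (∀ p, N (ψ p) = ε • fderiv ℝ Φ (f p) (N p)) ∧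
      ∀ c, integral (noetherForm κ τ H f N (kill κ τ c ∘ f) (F c ∘ f)) z
        = ε * integral (noetherForm κ τ H f N (kill κ τ (A c) ∘ f) (F (A c) ∘ f)) z := by
  obtain ⟨ε, hε, hN⟩ := hΦ.exists_sign hf hU hψ
  have hε' : (ε - 1) * H = 0 := by
    by_cases hH : H = 0
    · simp [hH]
    · simp [hΦ.sign_eq_one hf hU hψ hN hH]
  refine ⟨ε, ?_, hN, fun c => ?_⟩
  · rcases hε with h | h
    · exact Or.inl h
    · exact Or.inr ⟨h, by rw [h] at hε'; linarith⟩
  obtain ⟨k, hk, hk'⟩ := hΦ.exists_primitive_pullback (hF c) (hF (A c))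
  have hkf := hf.contMDiff_comp hΦ.isOpen hU hk
  have c1 := hf.isClosedForm c (hF c)
  have c2 := hf.isClosedForm (A c) (hF (A c))
  rw [← c1.integral_eq_of_homologous hz', integral_push]
  -- The pullback by `ψ` is `ε` times the Noether form of `A c`, minus `2H` times the differential
  -- of `k ∘ f`. The potential terms match because `(ε - 1) H = 0`.
  have key := IsClosedForm.integral_sum Finset.univ
    (η := ![noetherForm κ τ H f N (kill κ τ (A c) ∘ f) (F (A c) ∘ f),
      differential fun p => k (f p)])
    (fun i => by
      fin_cases i
      · exact c2
      · exact isClosedForm_differential hkf) ![ε, -2 * H] z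
  simp only [Fin.sum_univ_two, Matrix.cons_val_zero, Matrix.cons_val_one] at key
  rw [integral_eq_zero_of_exact (differential fun p => k (f p)) hkf (fun _ _ => rfl) hz, mul_zero,
    add_zero] at key
  rw [← key]
  refine integral_congr (fun p v => ?_) z
  rw [hf.differential_comp ((hk.contDiffAt (hΦ.isOpen.mem_nhds (hU p))).differentiableAt (by simp)),
    hk' _ (hU p), OneForm.pullback]
  simp only [noetherForm, Function.comp_apply]
  rw [hΦ.dmap_diffeo hf hU hψ, hN, hψ, vol_smul_left, hΦ.kill_eq _ (hU p), hΦ.vol_eq _ (hU p)]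
  linear_combination (-2 * metric κ τ (f p) (F (A c) (f p)) (dmap f p v)) * (- hε')

end IsLocalIsometry

/-- If `Φ` acts on the orthonormal coframe by rotations about the vertical direction, it is an
orientation preserving isometry. -/
lemma IsLocalIsometry.of_rotation {κ τ : ℝ} {U : Set R3} {Φ : R3 → R3}
    {A : (Fin 4 → ℝ) → Fin 4 → ℝ} (isOpen : IsOpen U) (subset : U ⊆ E3 κ)
    (star : StarConvex ℝ 0 U) (mapsTo : ∀ x ∈ U, Φ x ∈ E3 κ)
    (smooth : ∀ x ∈ U, ContDiffAt ℝ ∞ Φ x)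
    (rot : ∀ x ∈ U, ∃ c s : ℝ, c ^ 2 + s ^ 2 = 1 ∧ ∀ h, coframe κ τ (Φ x) (fderiv ℝ Φ x h) =
      ![c * coframe κ τ x h 0 - s * coframe κ τ x h 1, s * coframe κ τ x h 0 + c * coframe κ τ x h 1,
        coframe κ τ x h 2])
    (kill_eq : ∀ x ∈ U, ∀ c, kill κ τ c (Φ x) = fderiv ℝ Φ x (kill κ τ (A c) x)) :
    IsLocalIsometry κ τ U Φ A where
  isOpen := isOpen
  subset := subset
  star := star
  mapsTo := mapsTo
  smooth := smooth
  metric_eq x hx u v := by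
    obtain ⟨c, s, h1, h2⟩ := rot x hx
    rw [metric_eq_dot, metric_eq_dot, h2, h2]
    generalize coframe κ τ x u = a
    generalize coframe κ τ x v = b
    simp only [dot_apply, Matrix.cons_val]
    linear_combination (a 0 * b 0 + a 1 * b 1) * h1
  vol_eq x hx u v w := by
    obtain ⟨c, s, h1, h2⟩ := rot x hx
    rw [vol_eq_triple κ τ, vol_eq_triple κ τ, h2, h2, h2]
    generalize coframe κ τ x u = a
    generalize coframe κ τ x v = b
    generalize coframe κ τ x w = d
    simp only [triple_apply, Matrix.cons_val]
    linear_combination (a 0 * (b 1 * d 2 - b 2 * d 1) + a 1 * (b 2 * d 0 - b 0 * d 2)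
      + a 2 * (b 0 * d 1 - b 1 * d 0)) * h1
  kill_eq := kill_eq

lemma starConvex_E3 (κ : ℝ) : StarConvex ℝ 0 (E3 κ) := by
  rw [starConvex_zero_iff]
  intro x hx a h0 h1
  have hx' : 0 < 1 + κ / 4 * (x 0 ^ 2 + x 1 ^ 2) := hx
  change 0 < 1 + κ / 4 * ((a * x 0) ^ 2 + (a * x 1) ^ 2)
  have e : 1 + κ / 4 * ((a * x 0) ^ 2 + (a * x 1) ^ 2)
      = (1 - a ^ 2) + a ^ 2 * (1 + κ / 4 * (x 0 ^ 2 + x 1 ^ 2)) := by ring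
  rw [e]
  rcases h0.eq_or_lt with h | h
  · rw [← h]; norm_num
  · have : a ^ 2 ≤ 1 := by nlinarith
    have := mul_pos (pow_pos h 2) hx'
    linarith

/-- The derivative of a map in a direction is the derivative along a line. -/
lemma fderiv_eq_of_line {Φ : R3 → R3} {x h L : R3} (hd : DifferentiableAt ℝ Φ x)
    (hl : ∀ i, HasDerivAt (fun s : ℝ => Φ (x + s • h) i) (L i) 0) : fderiv ℝ Φ x h = L := by
  have line : HasDerivAt (fun s : ℝ => x + s • h) h 0 := by
    simpa using ((hasDerivAt_id (0 : ℝ)).smul_const h).const_add x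
  have hd' : DifferentiableAt ℝ Φ (x + (0 : ℝ) • h) := by simpa using hd
  have key := hd'.hasFDerivAt.comp_hasDerivAt 0 line
  rw [zero_smul, add_zero] at key
  exact key.unique (hasDerivAt_pi.2 hl)

/-! ### Rotations -/

lemma transR_apply (t : ℝ) (x : R3) : transR t x =
    ![Real.cos t * x 0 - Real.sin t * x 1, Real.sin t * x 0 + Real.cos t * x 1, x 2] := by
  ext i
  fin_cases i <;> simp [transR, base, Complex.exp_mul_I, ← Complex.ofReal_cos, ← Complex.ofReal_sin]
  · ring
  · ring

lemma contDiff_transR (t : ℝ) : ContDiff ℝ ∞ (transR t) := by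
  rw [contDiff_pi]
  intro i
  simp only [transR_apply]
  fin_cases i <;> simp <;> fun_prop

lemma fderiv_transR (t : ℝ) (x h : R3) : fderiv ℝ (transR t) x h = transR t h := by
  refine fderiv_eq_of_line ((contDiff_transR t).differentiable (by simp) x) fun i => ?_
  have e : ∀ s : ℝ, transR t (x + s • h) i = transR t x i + s * transR t h i := fun s => by
    fin_cases i <;> simp [transR_apply] <;> ring
  simp only [e]
  simpa using ((hasDerivAt_id (0 : ℝ)).mul_const (transR t h i)).const_add (transR t x i)

/-- The adjoint action of a rotation. -/
def adjointR (t : ℝ) (c : Fin 4 → ℝ) : Fin 4 → ℝ :=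
  ![Real.cos t * c 0 + Real.sin t * c 1, -(Real.sin t * c 0) + Real.cos t * c 1, c 2, c 3]

lemma isLocalIsometry_transR (κ τ t : ℝ) :
    IsLocalIsometry κ τ (E3 κ) (transR t) (adjointR t) := by
  have hcs := Real.cos_sq_add_sin_sq t
  have hr : ∀ x, transR t x 0 ^ 2 + transR t x 1 ^ 2 = x 0 ^ 2 + x 1 ^ 2 := fun x => by
    simp only [transR_apply, Matrix.cons_val]
    linear_combination (x 0 ^ 2 + x 1 ^ 2) * hcs
  have hl : ∀ x, lam κ (transR t x) = lam κ x := fun x => by rw [lam, lam, hr]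
  refine .of_rotation (isOpen_E3 κ) le_rfl (starConvex_E3 κ) (fun x hx => ?_)
    (fun x _ => (contDiff_transR t).contDiffAt)
    (fun x _ => ⟨Real.cos t, Real.sin t, hcs, fun h => ?_⟩) fun x _ c => ?_
  · change 0 < 1 + κ / 4 * (transR t x 0 ^ 2 + transR t x 1 ^ 2)
    rw [hr]
    exact hx
  · rw [fderiv_transR]
    ext i
    fin_cases i
    · simp only [coframe, hl]; simp [transR_apply]; ring
    · simp only [coframe, hl]; simp [transR_apply]; ring
    · simp only [coframe, vert, hl]; simp [transR_apply, -mul_eq_mul_left_iff, -mul_eq_mul_right_iff]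
      linear_combination τ * lam κ x * (x 1 * h 0 - x 0 * h 1) * hcs
  · rw [fderiv_transR, kill_apply, kill_apply, transR_apply, transR_apply]
    ext i
    fin_cases i
    · simp [adjointR]
      linear_combination (-c 0) * hcs
    · simp [adjointR]
      linear_combination (-c 1) * hcs
    · simp [adjointR]; ring

/-! ### Translations -/

/-- Real part of the denominator `1 - (κ/4) b̄ w` of the translation by `b`. -/
def transRe (κ b₀ b₁ : ℝ) (x : R3) : ℝ := 1 - κ / 4 * (b₀ * x 0 + b₁ * x 1)

/-- Opposite of the imaginary part of the denominator `1 - (κ/4) b̄ w`. -/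
def transIm (κ b₀ b₁ : ℝ) (x : R3) : ℝ := κ / 4 * (b₀ * x 1 - b₁ * x 0)

/-- The translation of `E³(κ, τ)` by `b = b₀ + i b₁`. -/
def trans (κ τ b₀ b₁ : ℝ) (x : R3) : R3 :=
  let u := transRe κ b₀ b₁ x
  let y := transIm κ b₀ b₁ x
  ![((b₀ + x 0) * u - (b₁ + x 1) * y) / (u ^ 2 + y ^ 2),
    ((b₀ + x 0) * y + (b₁ + x 1) * u) / (u ^ 2 + y ^ 2),
    x 2 + if κ = 0 then τ * (b₀ * x 1 - b₁ * x 0)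
      else 4 / (κ / (2 * τ)) * Real.arctan (y / (u + √(u ^ 2 + y ^ 2)))]

/-- The domain of the translation by `b`. -/
def transDom (κ b₀ b₁ : ℝ) : Set R3 :=
  E3 κ ∩ {x | 0 < transRe κ b₀ b₁ x + √(transRe κ b₀ b₁ x ^ 2 + transIm κ b₀ b₁ x ^ 2)}

/-- The adjoint action of the translation by `b`. -/
def adjoint (κ τ b₀ b₁ : ℝ) (c : Fin 4 → ℝ) : Fin 4 → ℝ :=
  let m := 1 + κ / 4 * (b₀ ^ 2 + b₁ ^ 2)
  let e := b₀ * c 1 - b₁ * c 0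
  ![c 0 - b₁ * ((c 3 - κ * e / 2) / m), c 1 + b₀ * ((c 3 - κ * e / 2) / m),
    c 2 - (2 * τ * e + τ * (b₀ ^ 2 + b₁ ^ 2) * c 3) / m,
    (1 - κ / 4 * (b₀ ^ 2 + b₁ ^ 2)) / m * c 3 - κ * e / m]

section Translation

variable {κ τ b₀ b₁ : ℝ} {x : R3}

/-- The condition says that `u + iy` avoids the closed negative real half-line. In this form it is
easily followed along segments. -/
lemma add_sqrt_pos_iff (u y : ℝ) : 0 < u + √(u ^ 2 + y ^ 2) ↔ 0 < u ∨ y ≠ 0 := by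
  constructor
  · intro h
    by_contra! hc
    obtain ⟨h1, h2⟩ := hc
    rw [h2, zero_pow two_ne_zero, add_zero, Real.sqrt_sq_eq_abs, abs_of_nonpos h1] at h
    linarith
  · rintro (h | h)
    · have := Real.sqrt_nonneg (u ^ 2 + y ^ 2); linarith
    · have : |u| < √(u ^ 2 + y ^ 2) := by
        rw [← Real.sqrt_sq_eq_abs]
        exact Real.sqrt_lt_sqrt (sq_nonneg u) (by have := sq_pos_of_ne_zero h; linarith)
      have := neg_abs_le u
      linarith

lemma sq_add_sq_pos {u y : ℝ} (h : 0 < u + √(u ^ 2 + y ^ 2)) : 0 < u ^ 2 + y ^ 2 := by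
  rcases (add_sqrt_pos_iff u y).1 h with h | h
  · have := sq_pos_of_pos h; have := sq_nonneg y; linarith
  · have := sq_pos_of_ne_zero h; have := sq_nonneg u; linarith

lemma contDiff_transRe : ContDiff ℝ ∞ (transRe κ b₀ b₁) := by
  unfold transRe; fun_prop

lemma contDiff_transIm : ContDiff ℝ ∞ (transIm κ b₀ b₁) := by
  unfold transIm; fun_prop

lemma contDiffAt_trans (hx : x ∈ transDom κ b₀ b₁) :
    ContDiffAt ℝ ∞ (trans κ τ b₀ b₁) x := by
  have hn := sq_add_sq_pos hx.2
  have hu : ContDiffAt ℝ ∞ (transRe κ b₀ b₁) x := contDiff_transRe.contDiffAt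
  have hy : ContDiffAt ℝ ∞ (transIm κ b₀ b₁) x := contDiff_transIm.contDiffAt
  have h2 : ContDiffAt ℝ ∞ (fun x => transRe κ b₀ b₁ x ^ 2 + transIm κ b₀ b₁ x ^ 2) x :=
    (hu.pow 2).add (hy.pow 2)
  have hs := h2.sqrt hn.ne'
  have hp : ∀ i, ContDiffAt ℝ ∞ (fun x : R3 => x i) x := fun i => by fun_prop
  rw [contDiffAt_pi]
  intro i
  fin_cases i
  · exact ((((contDiffAt_const.add (hp 0)).mul hu).sub ((contDiffAt_const.add (hp 1)).mul hy)).div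
      h2 hn.ne')
  · exact ((((contDiffAt_const.add (hp 0)).mul hy).add ((contDiffAt_const.add (hp 1)).mul hu)).div
      h2 hn.ne')
  · refine (hp 2).add ?_
    by_cases hκ : κ = 0
    · simp only [hκ, if_true]
      exact contDiffAt_const.mul ((contDiffAt_const.mul (hp 1)).sub (contDiffAt_const.mul (hp 0)))
    · simp only [hκ, if_false]
      exact contDiffAt_const.mul (Real.contDiff_arctan.contDiffAt.comp x
        (hy.div (hu.add hs) (ne_of_gt hx.2)))

/-- The derivative of half of the argument. -/
lemma hasDerivAt_arctan_half {u y : ℝ → ℝ} {u' y' s : ℝ} (hu : HasDerivAt u u' s)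
    (hy : HasDerivAt y y' s) (h : 0 < u s + √(u s ^ 2 + y s ^ 2)) :
    HasDerivAt (fun s => Real.arctan (y s / (u s + √(u s ^ 2 + y s ^ 2))))
      ((u s * y' - y s * u') / (2 * (u s ^ 2 + y s ^ 2))) s := by
  have hn := sq_add_sq_pos h
  have key := (hy.div (hu.add (((hu.pow 2).add (hy.pow 2)).sqrt hn.ne')) h.ne').arctan
  refine key.congr_deriv ?_
  have hq : 0 < √(u s ^ 2 + y s ^ 2) := Real.sqrt_pos.2 hn
  have hq2 : √(u s ^ 2 + y s ^ 2) ^ 2 = u s ^ 2 + y s ^ 2 := Real.sq_sqrt hn.le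
  simp only [Pi.add_apply, Pi.pow_apply, Pi.div_apply]
  set q := √(u s ^ 2 + y s ^ 2) with hqdef
  have h3 : (u s + q) ^ 2 + y s ^ 2 ≠ 0 := by positivity
  rw [← hq2]
  field_simp
  norm_num
  linear_combination ((u s + 2 * q) * y' - y s * u') * hq2

/-- The map `w ↦ (b + w) / (1 - (κ/4) b̄ w)` has complex derivative `m / (u - iy)²` with `m = 1 +
(κ/4)|b|²`, that is `m (u + iy)² / (u² + y²)²`. In the vertical component the factor `κ` from `u'`
and `y'` cancels the one in `4/σ`, so one formula also covers `κ = 0`. -/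
lemma fderiv_trans (hx : x ∈ transDom κ b₀ b₁) (h : R3) : fderiv ℝ (trans κ τ b₀ b₁) x h =
    ![(1 + κ / 4 * (b₀ ^ 2 + b₁ ^ 2)) *
        ((transRe κ b₀ b₁ x ^ 2 - transIm κ b₀ b₁ x ^ 2) * h 0
          - 2 * transRe κ b₀ b₁ x * transIm κ b₀ b₁ x * h 1)
          / (transRe κ b₀ b₁ x ^ 2 + transIm κ b₀ b₁ x ^ 2) ^ 2,
      (1 + κ / 4 * (b₀ ^ 2 + b₁ ^ 2)) *
        (2 * transRe κ b₀ b₁ x * transIm κ b₀ b₁ x * h 0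
          + (transRe κ b₀ b₁ x ^ 2 - transIm κ b₀ b₁ x ^ 2) * h 1)
          / (transRe κ b₀ b₁ x ^ 2 + transIm κ b₀ b₁ x ^ 2) ^ 2,
      h 2 + τ * (transRe κ b₀ b₁ x * (b₀ * h 1 - b₁ * h 0)
        + transIm κ b₀ b₁ x * (b₀ * h 0 + b₁ * h 1))
          / (transRe κ b₀ b₁ x ^ 2 + transIm κ b₀ b₁ x ^ 2)] := by
  have hn := (sq_add_sq_pos hx.2).ne'
  have hp : ∀ i, HasDerivAt (fun s : ℝ => (x + s • h) i) (h i) 0 := fun i => by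
    simpa using ((hasDerivAt_id (0 : ℝ)).mul_const (h i)).const_add (x i)
  have hu : HasDerivAt (fun s : ℝ => transRe κ b₀ b₁ (x + s • h))
      (-(κ / 4 * (b₀ * h 0 + b₁ * h 1))) 0 :=
    (((hp 0).const_mul b₀).add ((hp 1).const_mul b₁)).const_mul (κ / 4) |>.const_sub 1
  have hy : HasDerivAt (fun s : ℝ => transIm κ b₀ b₁ (x + s • h))
      (κ / 4 * (b₀ * h 1 - b₁ * h 0)) 0 :=
    (((hp 1).const_mul b₀).sub ((hp 0).const_mul b₁)).const_mul (κ / 4)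
  have h2 := (hu.pow 2).add (hy.pow 2)
  have hn' : ((fun s : ℝ => transRe κ b₀ b₁ (x + s • h)) ^ 2
      + (fun s : ℝ => transIm κ b₀ b₁ (x + s • h)) ^ 2) 0 ≠ 0 := by simpa using hn
  refine fderiv_eq_of_line ((contDiffAt_trans hx).differentiableAt (by simp)) fun i => ?_
  fin_cases i
  · refine (((((hp 0).const_add b₀).mul hu).sub (((hp 1).const_add b₁).mul hy)).div h2
      hn').congr_deriv ?_
    simp
    field_simp
    simp only [transRe, transIm]
    ring
  · refine (((((hp 0).const_add b₀).mul hy).add (((hp 1).const_add b₁).mul hu)).div h2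
      hn').congr_deriv ?_
    simp
    field_simp
    simp only [transRe, transIm]
    ring
  · by_cases hκ : κ = 0
    · subst hκ
      have key := (hp 2).add ((((hp 1).const_mul b₀).sub ((hp 0).const_mul b₁)).const_mul τ)
      simp only [trans, if_true]
      refine key.congr_deriv ?_
      simp [transRe, transIm]
    · have key := (hp 2).add ((hasDerivAt_arctan_half hu hy (by simpa using hx.2)).const_mul
        (4 / (κ / (2 * τ))))
      simp only [trans, hκ, if_false]
      refine key.congr_deriv ?_
      simp
      field_simp

/-- It shows that the translation preserves the domain and gives the transformation of the conformal
factor `λ`. -/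
lemma sq_add_sq_trans (hx : x ∈ transDom κ b₀ b₁) :
    (1 + κ / 4 * (trans κ τ b₀ b₁ x 0 ^ 2 + trans κ τ b₀ b₁ x 1 ^ 2))
      * (transRe κ b₀ b₁ x ^ 2 + transIm κ b₀ b₁ x ^ 2)
      = (1 + κ / 4 * (b₀ ^ 2 + b₁ ^ 2)) * (1 + κ / 4 * (x 0 ^ 2 + x 1 ^ 2)) := by
  have hn := (sq_add_sq_pos hx.2).ne'
  simp only [trans, Matrix.cons_val]
  field_simp
  simp only [transRe, transIm]
  ring

lemma lam_trans (hb : 0 < 1 + κ / 4 * (b₀ ^ 2 + b₁ ^ 2)) (hx : x ∈ transDom κ b₀ b₁) :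
    lam κ (trans κ τ b₀ b₁ x) * (1 + κ / 4 * (b₀ ^ 2 + b₁ ^ 2))
      = lam κ x * (transRe κ b₀ b₁ x ^ 2 + transIm κ b₀ b₁ x ^ 2) := by
  have hn := (sq_add_sq_pos hx.2)
  have h0 : 0 < 1 + κ / 4 * (x 0 ^ 2 + x 1 ^ 2) := hx.1
  have h1 := sq_add_sq_trans (τ := τ) hx
  have h2 : 1 + κ / 4 * (trans κ τ b₀ b₁ x 0 ^ 2 + trans κ τ b₀ b₁ x 1 ^ 2) ≠ 0 := fun h => by
    rw [h, zero_mul] at h1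
    exact (mul_pos hb h0).ne h1
  rw [lam, lam, one_div_mul_eq_div, one_div_mul_eq_div, div_eq_div_iff h2 h0.ne']
  linear_combination -h1

lemma isLocalIsometry_trans (hb : 0 < 1 + κ / 4 * (b₀ ^ 2 + b₁ ^ 2)) :
    IsLocalIsometry κ τ (transDom κ b₀ b₁) (trans κ τ b₀ b₁) (adjoint κ τ b₀ b₁) := by
  have hr : Continuous (transRe κ b₀ b₁) := contDiff_transRe.continuous
  have hi : Continuous (transIm κ b₀ b₁) := contDiff_transIm.continuous
  refine .of_rotation ?_ Set.inter_subset_left ?_ (fun x hx => ?_)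
    (fun x hx => contDiffAt_trans hx) (fun x hx => ?_) fun x hx c => ?_
  · exact (isOpen_E3 κ).inter (isOpen_lt continuous_const (by fun_prop))
  · rw [starConvex_zero_iff]
    intro x hx a h0 h1
    refine ⟨starConvex_zero_iff.1 (starConvex_E3 κ) hx.1 h0 h1, ?_⟩
    -- Along the segment from the origin to `x`, the number `u + iy` runs along the segment from `1`
    -- to its value at `x`, which avoids the closed negative half-line.
    have e1 : transRe κ b₀ b₁ (a • x) = (1 - a) + a * transRe κ b₀ b₁ x := by
      simp [transRe]; ring
    have e2 : transIm κ b₀ b₁ (a • x) = a * transIm κ b₀ b₁ x := by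
      simp [transIm]; ring
    refine (add_sqrt_pos_iff _ _).2 ?_
    rw [e1, e2]
    rcases h0.eq_or_lt with h | h
    · left; rw [← h]; norm_num
    · rcases (add_sqrt_pos_iff _ _).1 hx.2 with h2 | h2
      · left; have := mul_pos h h2; linarith
      · right; exact mul_ne_zero h.ne' h2
  · have h1 := sq_add_sq_trans (τ := τ) hx
    have h2 : 0 < 1 + κ / 4 * (x 0 ^ 2 + x 1 ^ 2) := hx.1
    have h3 := mul_pos hb h2
    rw [← h1] at h3
    exact pos_of_mul_pos_left h3 (sq_add_sq_pos hx.2).le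
  · have hn := (sq_add_sq_pos hx.2).ne'
    have hl : lam κ (trans κ τ b₀ b₁ x) = lam κ x
        * (transRe κ b₀ b₁ x ^ 2 + transIm κ b₀ b₁ x ^ 2) / (1 + κ / 4 * (b₀ ^ 2 + b₁ ^ 2)) := by
      rw [← lam_trans hb hx, mul_div_cancel_right₀ _ hb.ne']
    -- Cosine and sine of twice the argument of `u + iy`: the horizontal differential is
    -- multiplication by `m (u + iy)² / (u² + y²)²`, and the change of `λ` compensates its modulus.
    refine ⟨(transRe κ b₀ b₁ x ^ 2 - transIm κ b₀ b₁ x ^ 2)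
      / (transRe κ b₀ b₁ x ^ 2 + transIm κ b₀ b₁ x ^ 2), 2 * transRe κ b₀ b₁ x * transIm κ b₀ b₁ x
      / (transRe κ b₀ b₁ x ^ 2 + transIm κ b₀ b₁ x ^ 2), by field_simp; ring, fun h => ?_⟩
    rw [fderiv_trans hx]
    have hm := hb.ne'
    generalize hmm : 1 + κ / 4 * (b₀ ^ 2 + b₁ ^ 2) = m at *
    have hle := lam_mul hx.1
    ext i
    fin_cases i
    · simp only [coframe, vert, hl]
      simp
      field_simp
    · simp only [coframe, vert, hl]
      simp
      field_simp
    · simp only [coframe, vert, hl]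
      simp [trans]
      field_simp
      simp only [transRe, transIm]
      linear_combination (-((1 - κ / 4 * (b₀ * x 0 + b₁ * x 1)) ^ 2
        + (κ / 4 * (b₀ * x 1 - b₁ * x 0)) ^ 2) * τ
        * ((1 - κ / 4 * (b₀ * x 0 + b₁ * x 1)) * (b₀ * h 1 - b₁ * h 0)
          + κ / 4 * (b₀ * x 1 - b₁ * x 0) * (b₀ * h 0 + b₁ * h 1))) * hle
  · have hn := (sq_add_sq_pos hx.2).ne'
    have hm := hb.ne'
    rw [fderiv_trans hx, kill_apply, kill_apply]
    ext i
    fin_cases i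
    · simp [trans, adjoint]
      generalize hmm : 1 + κ / 4 * (b₀ ^ 2 + b₁ ^ 2) = m at *
      field_simp
      subst hmm
      simp only [transRe, transIm]
      ring
    · simp [trans, adjoint]
      generalize hmm : 1 + κ / 4 * (b₀ ^ 2 + b₁ ^ 2) = m at *
      field_simp
      subst hmm
      simp only [transRe, transIm]
      ring
    · simp [trans, adjoint]
      generalize hmm : 1 + κ / 4 * (b₀ ^ 2 + b₁ ^ 2) = m at *
      field_simp
      subst hmm
      simp only [transRe, transIm]
      ring

end Translation

/-- `𝒮₁(t)` and `𝒮₂(t)` are the translations by `b = t` and `b = it`, so both families are handled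
by one computation. -/
lemma trans1_eq (κ τ t : ℝ) : trans1 κ τ t = trans κ τ t 0 := by
  funext x
  have h1 : ‖(1 : ℂ) - ((κ / 4 * t : ℝ) : ℂ) * base x‖
      = √(transRe κ t 0 x ^ 2 + transIm κ t 0 x ^ 2) := by
    rw [Complex.norm_eq_sqrt_sq_add_sq]
    simp [transRe, transIm, base]
    ring_nf
  ext i
  fin_cases i
  · simp [trans1, trans, transRe, transIm, base, Complex.div_re, Complex.normSq_apply]
    ring
  · simp [trans1, trans, transRe, transIm, base, Complex.div_im, Complex.normSq_apply]
    ring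
  · simp only [trans1, trans, h1]
    simp [transRe, transIm, mul_assoc]

lemma trans2_eq (κ τ t : ℝ) : trans2 κ τ t = trans κ τ 0 t := by
  funext x
  have h1 : ‖(1 : ℂ) + Complex.I * ((κ / 4 * t : ℝ) : ℂ) * base x‖
      = √(transRe κ 0 t x ^ 2 + transIm κ 0 t x ^ 2) := by
    rw [Complex.norm_eq_sqrt_sq_add_sq]
    simp [transRe, transIm, base]
    ring_nf
  ext i
  fin_cases i
  · simp [trans2, trans, transRe, transIm, base, Complex.div_re, Complex.normSq_apply]
    ring
  · simp [trans2, trans, transRe, transIm, base, Complex.div_im, Complex.normSq_apply]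
    ring
  · simp only [trans2, trans, h1]
    simp [transRe, transIm, mul_assoc, neg_div, sub_eq_add_neg]
    split_ifs <;> ring

lemma mem_transDom_of_dom1 {κ t : ℝ} {x : R3} (hx : x ∈ E3 κ) (h : x ∈ dom1 κ t) :
    x ∈ transDom κ t 0 := by
  refine ⟨hx, ?_⟩
  have h' : 0 < 1 - κ / 4 * t * x 0 + ‖(1 : ℂ) - ((κ / 4 * t : ℝ) : ℂ) * base x‖ := h
  rw [Complex.norm_eq_sqrt_sq_add_sq] at h'
  change 0 < transRe κ t 0 x + √(transRe κ t 0 x ^ 2 + transIm κ t 0 x ^ 2)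
  convert h' using 3
  · simp [transRe]; ring
  · simp [transRe, transIm, base]; ring

lemma mem_transDom_of_dom2 {κ t : ℝ} {x : R3} (hx : x ∈ E3 κ) (h : x ∈ dom2 κ t) :
    x ∈ transDom κ 0 t := by
  refine ⟨hx, ?_⟩
  have h' : 0 < 1 - κ / 4 * t * x 1
    + ‖(1 : ℂ) + Complex.I * ((κ / 4 * t : ℝ) : ℂ) * base x‖ := h
  rw [Complex.norm_eq_sqrt_sq_add_sq] at h'
  change 0 < transRe κ 0 t x + √(transRe κ 0 t x ^ 2 + transIm κ 0 t x ^ 2)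
  convert h' using 3
  · simp [transRe]; ring
  · simp [transRe, transIm, base]; ring

/-! ### Potentials of linear combinations -/

lemma metric_add_middle (κ τ : ℝ) (x u u' v : R3) :
    metric κ τ x (u + u') v = metric κ τ x u v + metric κ τ x u' v := by
  simp [metric, vert]; ring

lemma metric_smul_middle (κ τ : ℝ) (x u v : R3) (r : ℝ) :
    metric κ τ x (r • u) v = r * metric κ τ x u v := by
  simp [metric, vert]; ring

lemma vol_add_middle (κ : ℝ) (x u v v' w : R3) :
    vol κ x u (v + v') w = vol κ x u v w + vol κ x u v' w := by
  simp [vol, Matrix.det_fin_three]; ring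

lemma vol_smul_middle (κ : ℝ) (x u v w : R3) (r : ℝ) :
    vol κ x u (r • v) w = r * vol κ x u v w := by
  simp [vol, Matrix.det_fin_three]; ring

lemma vol_add_left (κ : ℝ) (x u u' v w : R3) :
    vol κ x (u + u') v w = vol κ x u v w + vol κ x u' v w := by
  simp [vol, Matrix.det_fin_three]; ring

section Potential

variable {κ τ : ℝ} {F G S T : R3 → R3}

lemma IsPotential.differentiableAt (hF : IsPotential κ τ F S) {x : R3} (hx : x ∈ E3 κ) (v : R3) :
    DifferentiableAt ℝ (fun y => metric κ τ y (F y) v) x :=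
  differentiableAt_metric differentiableAt_id ((hF.contDiffAt hx).differentiableAt (by simp))
    (differentiableAt_const v) hx

lemma IsPotential.add (hF : IsPotential κ τ F S) (hG : IsPotential κ τ G T) :
    IsPotential κ τ (F + G) (S + T) := by
  refine ⟨hF.1.add hG.1, fun x hx u v => ?_⟩
  simp only [Pi.add_apply, metric_add_middle, vol_add_left]
  rw [fderiv_fun_add (hF.differentiableAt hx v) (hG.differentiableAt hx v),
    fderiv_fun_add (hF.differentiableAt hx u) (hG.differentiableAt hx u), ← hF.2 x hx, ← hG.2 x hx]
  simp only [add_apply]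
  ring

lemma IsPotential.smul (hF : IsPotential κ τ F S) (r : ℝ) : IsPotential κ τ (r • F) (r • S) := by
  refine ⟨hF.1.const_smul r, fun x hx u v => ?_⟩
  simp only [Pi.smul_apply, metric_smul_middle, vol_smul_left]
  rw [fderiv_const_mul (hF.differentiableAt hx v), fderiv_const_mul (hF.differentiableAt hx u),
    ← hF.2 x hx]
  simp only [smul_apply, smul_eq_mul]
  ring

/-- The linear combination of four fields with coefficients `c`. -/
def combination (F1 F2 F3 FR : R3 → R3) (c : Fin 4 → ℝ) : R3 → R3 :=
  c 0 • F1 + c 1 • F2 + c 2 • F3 + c 3 • FR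

lemma combination_apply (F1 F2 F3 FR : R3 → R3) (c : Fin 4 → ℝ) (x : R3) :
    combination F1 F2 F3 FR c x = c 0 • F1 x + c 1 • F2 x + c 2 • F3 x + c 3 • FR x := rfl

lemma isPotential_combination {F1 F2 F3 FR : R3 → R3}
    (hF1 : IsPotential κ τ F1 (S1 κ τ)) (hF2 : IsPotential κ τ F2 (S2 κ τ))
    (hF3 : IsPotential κ τ F3 S3) (hFR : IsPotential κ τ FR SR) (c : Fin 4 → ℝ) :
    IsPotential κ τ (combination F1 F2 F3 FR c) (kill κ τ c) :=
  (((hF1.smul (c 0)).add (hF2.smul (c 1))).add (hF3.smul (c 2))).add (hFR.smul (c 3))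

end Potential

/-! ### Periods under a translation -/

section Periods

variable {M : Type*} [TopologicalSpace M] [ChartedSpace R2 M] {κ τ H : ℝ} {f N : M → R3}

lemma noetherForm_combination (κ τ H : ℝ) (f N : M → R3) (F1 F2 F3 FR : R3 → R3)
    (c : Fin 4 → ℝ) (p : M) (v : TangentSpace (𝓡 2) p) :
    noetherForm κ τ H f N (kill κ τ c ∘ f) (combination F1 F2 F3 FR c ∘ f) p v
      = ∑ i, c i * ![noetherForm κ τ H f N (S1 κ τ ∘ f) (F1 ∘ f),
        noetherForm κ τ H f N (S2 κ τ ∘ f) (F2 ∘ f), noetherForm κ τ H f N (S3 ∘ f) (F3 ∘ f),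
        noetherForm κ τ H f N (SR ∘ f) (FR ∘ f)] i p v := by
  simp only [Fin.sum_univ_four, noetherForm, Function.comp_apply, kill, combination_apply,
    metric_add_middle, metric_smul_middle, vol_add_middle, vol_smul_middle, Matrix.cons_val]
  ring

lemma integral_combination [IsManifold (𝓡 2) ∞ M] (hf : IsCMCImmersion κ τ H f N)
    {F1 F2 F3 FR : R3 → R3}
    (hF1 : IsPotential κ τ F1 (S1 κ τ)) (hF2 : IsPotential κ τ F2 (S2 κ τ))
    (hF3 : IsPotential κ τ F3 S3) (hFR : IsPotential κ τ FR SR) (c : Fin 4 → ℝ) (z : Chain M 1) :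
    integral (noetherForm κ τ H f N (kill κ τ c ∘ f) (combination F1 F2 F3 FR c ∘ f)) z
      = c 0 * integral (noetherForm κ τ H f N (S1 κ τ ∘ f) (F1 ∘ f)) z
        + c 1 * integral (noetherForm κ τ H f N (S2 κ τ ∘ f) (F2 ∘ f)) z
        + c 2 * integral (noetherForm κ τ H f N (S3 ∘ f) (F3 ∘ f)) z
        + c 3 * integral (noetherForm κ τ H f N (SR ∘ f) (FR ∘ f)) z := by
  rw [integral_congr (noetherForm_combination κ τ H f N F1 F2 F3 FR c),
    IsClosedForm.integral_sum Finset.univ ?_ c z]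
  · simp [Fin.sum_univ_four]
  · have e : ∀ i : Fin 4, ∀ S F : R3 → R3, kill κ τ (Pi.single i 1) = S → IsPotential κ τ F S →
        IsClosedForm (noetherForm κ τ H f N (S ∘ f) (F ∘ f)) := by
      rintro i S F rfl hF
      exact hf.isClosedForm _ hF
    intro i
    fin_cases i
    · exact e 0 _ _ (by ext x i; simp [kill]) hF1
    · exact e 1 _ _ (by ext x i; simp [kill]) hF2
    · exact e 2 _ _ (by ext x i; simp [kill]) hF3
    · exact e 3 _ _ (by ext x i; simp [kill]) hFR

variable [IsManifold (𝓡 2) ∞ M] [ConnectedSpace M] {F1 F2 F3 FR : R3 → R3}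
  {ψ : M ≃ₘ^∞⟮𝓡 2, 𝓡 2⟯ M} {z : Chain M 1}

/-- The periods of the Noether forms of a surface invariant under a translation. -/
theorem periods_of_translation {b₀ b₁ : ℝ} (hτ : τ ≠ 0)
    (hf : IsCMCImmersion κ τ H f N) (hF1 : IsPotential κ τ F1 (S1 κ τ))
    (hF2 : IsPotential κ τ F2 (S2 κ τ)) (hF3 : IsPotential κ τ F3 S3)
    (hFR : IsPotential κ τ FR SR) (hb0 : b₀ ^ 2 + b₁ ^ 2 ≠ 0)
    (hb : 0 < 1 + κ / 4 * (b₀ ^ 2 + b₁ ^ 2)) (hU : ∀ p, f p ∈ transDom κ b₀ b₁)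
    (hψ : ∀ p, f (ψ p) = trans κ τ b₀ b₁ (f p)) (hz : IsCycle z)
    (hz' : Homologous z (z.push ψ)) :
    (κ = 0 → integral (noetherForm κ τ H f N (S3 ∘ f) (F3 ∘ f)) z = 0) ∧
      b₀ * integral (noetherForm κ τ H f N (S2 κ τ ∘ f) (F2 ∘ f)) z
        - b₁ * integral (noetherForm κ τ H f N (S1 κ τ ∘ f) (F1 ∘ f)) z = 0 ∧
      κ * integral (noetherForm κ τ H f N (SR ∘ f) (FR ∘ f)) z
        + 2 * τ * integral (noetherForm κ τ H f N (S3 ∘ f) (F3 ∘ f)) z = 0 := by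
  obtain ⟨ε, hε, -, key⟩ := (isLocalIsometry_trans hb).integral_noetherForm hf
    (isPotential_combination hF1 hF2 hF3 hFR) hU hψ hz hz'
  have hε : ε = 1 ∨ ε = -1 := hε.imp_right And.left
  simp only [integral_combination hf hF1 hF2 hF3 hFR] at key
  generalize integral (noetherForm κ τ H f N (S1 κ τ ∘ f) (F1 ∘ f)) z = s1 at *
  generalize integral (noetherForm κ τ H f N (S2 κ τ ∘ f) (F2 ∘ f)) z = s2 at *
  generalize integral (noetherForm κ τ H f N (S3 ∘ f) (F3 ∘ f)) z = s3 at *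
  generalize integral (noetherForm κ τ H f N (SR ∘ f) (FR ∘ f)) z = sR at *
  -- The field `b₀ S₁ + b₁ S₂` is fixed by the adjoint action, so it gives nothing when `ε = 1`. The
  -- field orthogonal to it, `S_R` and `S₃` give the relations for `X = b₀ σ₂ - b₁ σ₁` and `T = κ
  -- σ_R + 2τ σ₃`.
  have k1 := key ![-b₁, b₀, 0, 0]
  have k2 := key ![0, 0, 0, 1]
  have k3 := key ![0, 0, 1, 0]
  simp [adjoint] at k1 k2 k3
  have hm := hb.ne'
  have hBB : b₀ * b₀ + b₁ * b₁ = b₀ ^ 2 + b₁ ^ 2 := by ring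
  rw [hBB] at k1
  generalize b₀ ^ 2 + b₁ ^ 2 = B at *
  obtain ⟨X, hX⟩ : ∃ X, X = b₀ * s2 - b₁ * s1 := ⟨_, rfl⟩
  obtain ⟨T, hT⟩ : ∃ T, T = κ * sR + 2 * τ * s3 := ⟨_, rfl⟩
  rw [← hX, ← hT]
  have hq := mul_inv_cancel₀ hm
  simp only [div_eq_mul_inv _ (1 + κ / 4 * B)] at k1 k2
  generalize (1 + κ / 4 * B)⁻¹ = q at *
  have e1 : (1 + κ / 4 * B) * X = ε * ((1 - κ / 4 * B) * X - B * T) := by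
    rw [hX, hT]
    linear_combination (1 + κ / 4 * B) * k1
      - ε * B * (κ / 2 * (b₀ * s2 - b₁ * s1) + κ * sR + 2 * τ * s3) * hq
  have e2 : (1 + κ / 4 * B) * sR = ε * (X - τ * B * s3 + (1 - κ / 4 * B) * sR) := by
    rw [hX]
    linear_combination (1 + κ / 4 * B) * k2
      + ε * (b₀ * s2 - b₁ * s1 - τ * B * s3 + (1 - κ / 4 * B) * sR) * hq
  have e3 : (1 + κ / 4 * B) * T = ε * (κ * X + (1 - κ / 4 * B) * T) := by
    rw [hT]
    linear_combination κ * e2 + 2 * τ * (1 + κ / 4 * B) * k3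
  clear hX key k1 k2 hBB
  rcases hε with rfl | rfl
  -- For `ε = 1`, `e1` and `e3` yield `T = 0` and `κ X = 0`. If `κ = 0`, then `σ₃ = 0` because `τ ≠
  -- 0`, and `e2` reduces to `X = 0`.
  · have hT' : T = -(κ / 2) * X := mul_left_cancel₀ hb0 (by linear_combination e1)
    have hκX : κ * X = 0 := by
      refine (mul_eq_zero.1 ?_).resolve_left hm
      linear_combination -e3 + κ * B / 2 * hT'
    have hT0 : T = 0 := by rw [hT']; linear_combination -(1 / 2) * hκX
    have hs3 : κ = 0 → s3 = 0 := by
      rintro rfl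
      have h : 2 * τ * s3 = 0 := by linear_combination hT0 - hT
      simpa [hτ] using h
    refine ⟨hs3, ?_, hT0⟩
    by_cases hκ : κ = 0
    · have := hs3 hκ
      subst this hκ
      linear_combination -e2
    · simpa [hκ] using hκX
  -- For `ε = -1` the system is `2X = B T`, `2T = -κ X`, with determinant proportional to `1 + (κ/4)
  -- B ≠ 0`. Also `σ₃ = -σ₃`.
  · have hT0 : T = 0 := by
      refine (mul_eq_zero.1 ?_).resolve_left hm
      linear_combination e3 / 2 - κ / 4 * e1
    refine ⟨fun _ => by linarith, ?_, hT0⟩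
    linear_combination e1 / 2 + B / 2 * hT0

end Periods

/-! ### Periods under a rotation -/

section Rotation

variable {M : Type*} [TopologicalSpace M] [ChartedSpace R2 M] {κ τ H : ℝ} {f N : M → R3}
  [IsManifold (𝓡 2) ∞ M] [ConnectedSpace M] {F1 F2 F3 FR : R3 → R3}
  {ψ : M ≃ₘ^∞⟮𝓡 2, 𝓡 2⟯ M} {z : Chain M 1}

/-- The periods of the Noether forms of a surface invariant under a rotation. -/
theorem periods_of_rotation {t : ℝ} (hf : IsCMCImmersion κ τ H f N)
    (hF1 : IsPotential κ τ F1 (S1 κ τ)) (hF2 : IsPotential κ τ F2 (S2 κ τ))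
    (hF3 : IsPotential κ τ F3 S3) (hFR : IsPotential κ τ FR SR) (ht : Real.cos t ≠ 1)
    (hψ : ∀ p, f (ψ p) = transR t (f p))
    (ho : H = 0 → Real.cos t = -1 → ∀ p, N (ψ p) = fderiv ℝ (transR t) (f p) (N p))
    (hz : IsCycle z) (hz' : Homologous z (z.push ψ)) :
    integral (noetherForm κ τ H f N (S1 κ τ ∘ f) (F1 ∘ f)) z = 0 ∧
      integral (noetherForm κ τ H f N (S2 κ τ ∘ f) (F2 ∘ f)) z = 0 := by
  have hΦ := isLocalIsometry_transR κ τ t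
  obtain ⟨ε, hε, hN, key⟩ := hΦ.integral_noetherForm hf
    (isPotential_combination hF1 hF2 hF3 hFR) hf.mem hψ hz hz'
  -- In the half-turn case with `ε = -1`, the orientation hypothesis would give `dΦ(N) = -dΦ(N)`,
  -- contradicting that `dΦ(N)` has length one.
  have hcos : ε = -1 → Real.cos t ≠ -1 := by
    rintro rfl hc
    have hH : H = 0 := (hε.resolve_left (by norm_num)).2
    obtain ⟨p⟩ : Nonempty M := inferInstance
    have h0 : fderiv ℝ (transR t) (f p) (N p) = 0 := by
      have h := (ho hH hc p).symm.trans (hN p)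
      rw [neg_one_smul] at h
      exact self_eq_neg.1 h
    have h1 := hΦ.metric_eq _ (hf.mem p) (N p) (N p)
    rw [hf.unit, h0] at h1
    simp [metric, vert] at h1
  simp only [integral_combination hf hF1 hF2 hF3 hFR] at key
  generalize integral (noetherForm κ τ H f N (S1 κ τ ∘ f) (F1 ∘ f)) z = s1 at *
  generalize integral (noetherForm κ τ H f N (S2 κ τ ∘ f) (F2 ∘ f)) z = s2 at *
  have k1 := key ![1, 0, 0, 0]
  have k2 := key ![0, 1, 0, 0]
  simp [adjointR] at k1 k2
  have hcs := Real.cos_sq_add_sin_sq t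
  -- The system for `(σ₁, σ₂)` has matrix `1 - ε R` with `R` a rotation of angle `±t`. Its
  -- determinant is `2 (1 - ε cos t)`.
  obtain ⟨d, hd0, hd⟩ : ∃ d : ℝ, d ≠ 0 ∧ d = 1 - ε * Real.cos t := by
    refine ⟨_, ?_, rfl⟩
    rcases hε with rfl | ⟨rfl, -⟩
    · exact fun h => ht (by linarith)
    · exact fun h => hcos rfl (by linarith)
  have hε2 : ε ^ 2 = 1 := by rcases hε with rfl | ⟨rfl, -⟩ <;> norm_num
  constructor
  · refine (mul_eq_zero.1 (?_ : 2 * d * s1 = 0)).resolve_left (by simpa using hd0)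
    rw [hd]
    linear_combination (1 - ε * Real.cos t) * k1 - ε * Real.sin t * k2
      - s1 * hε2 - s1 * ε ^ 2 * hcs
  · refine (mul_eq_zero.1 (?_ : 2 * d * s2 = 0)).resolve_left (by simpa using hd0)
    rw [hd]
    linear_combination (1 - ε * Real.cos t) * k2 + ε * Real.sin t * k1
      - s2 * hε2 - s2 * ε ^ 2 * hcs

end Rotation

/-! ### Exact Noether forms of a surface tangent to a Killing field -/

section Tangent

variable {κ τ : ℝ} {b c d : Fin 4 → ℝ}

/-- Torsion-freeness writes the bracket as a difference of covariant derivatives, which are cross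
products with the curls. -/
lemma coframe_bracket {x : R3} (hx : x ∈ E3 κ)
    (hb : kill κ τ b x = dkill κ τ c x (kill κ τ d x) - dkill κ τ d x (kill κ τ c x)) :
    coframe κ τ x (kill κ τ b x) = curl κ τ c x ⨯₃ coframe κ τ x (kill κ τ d x)
      - curl κ τ d x ⨯₃ coframe κ τ x (kill κ τ c x) := by
  rw [hb, ← cov_sub_cov hx (kill κ τ d x) (kill κ τ c x), cov_kill τ c hx, cov_kill τ d hx]

/-- The `1`-form `vol(S, ·, T) + F^♭` is exact if `rot F` is the bracket of `S` and `T`. -/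
lemma exists_primitive_bracket {F : R3 → R3} (hF : IsPotential κ τ F (kill κ τ b))
    (hb : ∀ x, kill κ τ b x = dkill κ τ c x (kill κ τ d x) - dkill κ τ d x (kill κ τ c x)) :
    ∃ k : R3 → ℝ, ContDiffOn ℝ ∞ k (E3 κ) ∧ ∀ x ∈ E3 κ, ∀ v, fderiv ℝ k x v =
      vol κ x (kill κ τ c x) v (kill κ τ d x) + metric κ τ x (F x) v := by
  have kc : ∀ (e : Fin 4 → ℝ) (x : R3), ContDiffAt ℝ ∞ (fun x => kill κ τ e x) x := fun e x =>
    (contDiff_kill κ τ e).contDiffAt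
  have h1 : ∀ x ∈ E3 κ, ∀ v,
      ContDiffAt ℝ ∞ (fun x => vol κ x (kill κ τ c x) v (kill κ τ d x)) x := fun x hx v =>
    contDiffAt_vol contDiffAt_id (kc c x) contDiffAt_const (kc d x) hx
  have h2 : ∀ x ∈ E3 κ, ∀ v, ContDiffAt ℝ ∞ (fun x => metric κ τ x (F x) v) x := fun x hx v =>
    contDiffAt_metric contDiffAt_id (hF.contDiffAt hx) contDiffAt_const hx
  refine exists_primitive (isOpen_E3 κ) (starConvex_E3 κ)
    (fun x v => vol κ x (kill κ τ c x) v (kill κ τ d x) + metric κ τ x (F x) v) ?_ ?_ ?_ ?_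
  · intro x v w
    simp only [metric_add_right, vol_add_middle]; ring
  · intro x r v
    simp only [metric_smul_right, vol_smul_middle]; ring
  · exact fun v x hx => ((h1 x hx v).add (h2 x hx v)).contDiffWithinAt
  · intro x hx u v
    have d1 := fun v => (h1 x hx v).differentiableAt (by simp)
    have d2 := fun v => (h2 x hx v).differentiableAt (by simp)
    have e1 : ∀ u v, fderiv ℝ (fun x => vol κ x (kill κ τ c x) v (kill κ τ d x)) x u
        = triple (curl κ τ c x ⨯₃ coframe κ τ x u) (coframe κ τ x v)
            (coframe κ τ x (kill κ τ d x))
          + triple (coframe κ τ x (kill κ τ c x)) (cov κ τ x u v 0)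
            (coframe κ τ x (kill κ τ d x))
          + triple (coframe κ τ x (kill κ τ c x)) (coframe κ τ x v)
            (curl κ τ d x ⨯₃ coframe κ τ x u) := fun u v => by
      have k := fderiv_vol τ (φ := fun y : R3 => y) (b := fun _ => v) (x := x) differentiableAt_id
        ((kc c x).differentiableAt (by simp)) (differentiableAt_const v)
        ((kc d x).differentiableAt (by simp)) hx u
      simpa [fderiv_kill, cov_kill τ _ hx] using k
    have e2 := hF.2 x hx u v
    have t1 := triple_cross (curl κ τ c x) (coframe κ τ x u) (coframe κ τ x v)
      (coframe κ τ x (kill κ τ d x))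
    have t2 := triple_cross (curl κ τ d x) (coframe κ τ x u) (coframe κ τ x v)
      (coframe κ τ x (kill κ τ c x))
    rw [vol_eq_triple κ τ, coframe_bracket hx (hb x)] at e2
    rw [fderiv_fun_add (d1 v) (d2 v), fderiv_fun_add (d1 u) (d2 u)]
    simp only [add_apply, e1, cov_zero_comm hx u v]
    simp only [triple_apply, Pi.sub_apply] at e2 t1 t2 ⊢
    linear_combination e2 + t1 - t2

variable {M : Type*} [TopologicalSpace M] [ChartedSpace R2 M] [IsManifold (𝓡 2) ∞ M]
  {H : ℝ} {f N : M → R3}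

namespace IsCMCImmersion

/-- The covariant derivative of the normal in the direction of a tangent Killing field. -/
lemma covNormal_kill (hf : IsCMCImmersion κ τ H f N)
    (hd : ∀ p, ∃ V, dmap f p V = kill κ τ d (f p)) {p : M} {V : TangentSpace (𝓡 2) p}
    (hV : dmap f p V = kill κ τ d (f p)) :
    covNormal κ τ f N p V = curl κ τ d (f p) ⨯₃ coframe κ τ (f p) (N p) := by
  have key : ∀ w : TangentSpace (𝓡 2) p, covNormal κ τ f N p w
      ⬝ᵥ coframe κ τ (f p) (kill κ τ d (f p))
      = -(coframe κ τ (f p) (N p) ⬝ᵥ (curl κ τ d (f p) ⨯₃ frameMap κ τ f p w)) := by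
    clear hV V
    induction p using parametrization_induction with | h g x hg hs => ?_
    intro w
    obtain ⟨u, rfl⟩ := hs w
    have hg' := hg.mdifferentiableAt (by simp)
    have h1 := (hf.contDiffAt_map hg).differentiableAt (by simp)
    have h2 := (hf.contDiffAt_normal hg).differentiableAt (by simp)
    have h3 := fderiv_kill_comp (κ := κ) (τ := τ) d h1 u
    have k := fderiv_metric (τ := τ) h1 h2 h3.1 (hf.mem (g x)) u
    have zero : ∀ y, metric κ τ (f (g y)) (N (g y)) (kill κ τ d (f (g y))) = 0 := fun y => by
      obtain ⟨W, hW⟩ := hd (g y)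
      rw [← hW, hf.normal]
    simp only [zero] at k
    rw [h3.2, cov_kill τ d (hf.mem (g x)), hf.fderiv_map hg', hf.fderiv_normal hg'] at k
    simp at k
    rw [covNormal, frameMap]
    linarith
  -- `key` comes from differentiating `⟨N, T⟩ = 0`. The symmetry of the second fundamental form
  -- turns it into the tangential components of `∇_T N`; the normal components are zero on both
  -- sides.
  obtain ⟨a, b, h⟩ := hf.exists_frame p
  have e : ∀ w : TangentSpace (𝓡 2) p, covNormal κ τ f N p V ⬝ᵥ frameMap κ τ f p w
      = (curl κ τ d (f p) ⨯₃ coframe κ τ (f p) (N p)) ⬝ᵥ frameMap κ τ f p w := fun w => by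
    rw [hf.covNormal_symm, dot_cross, ← key, frameMap, hV]
  have e0 : (curl κ τ d (f p) ⨯₃ coframe κ τ (f p) (N p)) ⬝ᵥ coframe κ τ (f p) (N p) = 0 := by
    simp only [dot_apply]; simp [cross_apply]; ring
  refine (h.expand _).trans (Eq.trans ?_ (h.expand _).symm)
  rw [e, e, e0, hf.covNormal_dot_normal]

/-- The Noether form of the bracket of a Killing field with a Killing field that is tangent to the
surface is exact. -/
theorem isExact_noetherForm_bracket (hf : IsCMCImmersion κ τ H f N)
    (hd : ∀ p, ∃ V, dmap f p V = kill κ τ d (f p))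
    (hb : ∀ x, kill κ τ b x = dkill κ τ c x (kill κ τ d x) - dkill κ τ d x (kill κ τ c x))
    {F : R3 → R3} (hF : IsPotential κ τ F (kill κ τ b)) :
    IsExact (noetherForm κ τ H f N (kill κ τ b ∘ f) (F ∘ f)) := by
  obtain ⟨k, hk, hk'⟩ := exists_primitive_bracket hF hb
  have hkd : ∀ p, DifferentiableAt ℝ k (f p) := fun p =>
    (hk.contDiffAt ((isOpen_E3 κ).mem_nhds (hf.mem p))).differentiableAt (by simp)
  -- This function is the primitive. It has the shape of the Noether form of `S` contracted with
  -- `T`, with `k` in the place of `⟨F_S, T⟩`.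
  have hs : ContMDiff (𝓡 2) 𝓘(ℝ, ℝ) ∞ fun p =>
      vol κ (f p) (N p) (kill κ τ c (f p)) (kill κ τ d (f p)) - 2 * H * k (f p) := fun p => by
    have c1 : ContDiffAt ℝ ∞ (fun y : R3 × R3 =>
        vol κ y.1 y.2 (kill κ τ c y.1) (kill κ τ d y.1) - 2 * H * k y.1) (f p, N p) := by
      refine (contDiffAt_vol contDiffAt_fst contDiffAt_snd ?_ ?_ (hf.mem p)).sub
        (contDiffAt_const.mul ?_)
      · exact (contDiff_kill κ τ c).contDiffAt.comp _ contDiffAt_fst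
      · exact (contDiff_kill κ τ d).contDiffAt.comp _ contDiffAt_fst
      · exact ContDiffAt.comp (g := k) (f := Prod.fst) (f p, N p)
          (hk.contDiffAt ((isOpen_E3 κ).mem_nhds (hf.mem p))) contDiffAt_fst
    exact c1.contMDiffAt.comp p ((hf.smooth p).prodMk_space (hf.smooth_normal p))
  refine ⟨_, hs, fun p => ?_⟩
  induction p using parametrization_induction with | h g x hg hs' => ?_
  intro w
  obtain ⟨u, rfl⟩ := hs' w
  obtain ⟨V, hV⟩ := hd (g x)
  have hx := hf.mem (g x)
  have hg' := hg.mdifferentiableAt (by simp)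
  have h1 := (hf.contDiffAt_map hg).differentiableAt (by simp)
  have h2 := (hf.contDiffAt_normal hg).differentiableAt (by simp)
  have h3 := fun e => fderiv_kill_comp (κ := κ) (τ := τ) e h1 u
  have e1 := fderiv_vol τ h1 h2 (h3 c).1 (h3 d).1 hx u
  rw [(h3 c).2, (h3 d).2, cov_kill τ c hx, cov_kill τ d hx, hf.fderiv_map hg',
    hf.fderiv_normal hg'] at e1
  have e2 : fderiv ℝ (fun y => k (f (g y))) x u
      = fderiv ℝ k (f (g x)) (dmap f (g x) (tmap g x u)) := by
    rw [← hf.fderiv_map hg']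
    exact congrArg (· u) (fderiv_comp x (hkd (g x)) h1)
  have hkx : DifferentiableAt ℝ (fun y => k (f (g y))) x := (hkd (g x)).comp x h1
  refine (fderiv_comp_function (hs.mdifferentiable (by simp) _) hg' u).symm.trans ?_
  rw [fderiv_fun_sub (differentiableAt_vol h1 h2 (h3 c).1 (h3 d).1 hx) (hkx.const_mul _),
    fderiv_const_mul hkx]
  simp only [sub_apply, smul_apply, smul_eq_mul]
  rw [e1, e2, hk' _ hx, noetherForm, vol_eq_triple κ τ, vol_eq_triple κ τ]
  simp only [Function.comp_apply]
  rw [coframe_bracket hx (hb _)]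
  have e3 := hf.noether_alternating c (g x) (tmap g x u) V
  rw [hf.covNormal_kill hd hV] at e3
  simp only [frameMap, hV] at e3
  have t := triple_cross (curl κ τ d (f (g x))) (coframe κ τ (f (g x)) (N (g x)))
    (coframe κ τ (f (g x)) (kill κ τ c (f (g x))))
    (coframe κ τ (f (g x)) (dmap f (g x) (tmap g x u)))
  rw [covNormal] at e3
  simp only [triple_apply, Pi.sub_apply] at e3 t ⊢
  linear_combination e3 + t

end IsCMCImmersion

end Tangent

/-! ### Tangency from invariance under uncountably many isometries -/

section Surface

open Filter Asymptotics Topology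

variable {M : Type*} [TopologicalSpace M] [ChartedSpace R2 M] {κ τ H : ℝ} {f N : M → R3}

/-- An uncountable graph in a second countable space accumulates at one of its points. -/
lemma exists_frequently_graph {X : Type*} [TopologicalSpace X] [SecondCountableTopology X]
    {T : Set ℝ} (hT : ¬ T.Countable) (q : ℝ → X) :
    ∃ t ∈ T, ∃ l : Filter ℝ, l.NeBot ∧ l ≤ 𝓝[T \ {t}] t ∧ Tendsto q l (𝓝 (q t)) := by
  by_contra! hl
  let G : Set (ℝ × X) := (fun t => (t, q t)) '' T
  have hinj : Function.Injective fun t => (t, q t) := fun s t h => congrArg Prod.fst h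
  have hd : DiscreteTopology G := by
    rw [discreteTopology_subtype_iff]
    rintro _ ⟨t, ht, rfl⟩
    by_contra hne
    rw [← Ne, ← neBot_iff] at hne
    have hle : 𝓝[≠] (t, q t) ⊓ 𝓟 G ≤ 𝓝 (t, q t) := inf_le_left.trans nhdsWithin_le_nhds
    have hfst : Tendsto Prod.fst (𝓝[≠] (t, q t) ⊓ 𝓟 G) (𝓝 t) :=
      continuousAt_fst.tendsto.mono_left hle
    have hev : ∀ᶠ z in 𝓝[≠] (t, q t) ⊓ 𝓟 G, z.1 ∈ T \ {t} ∧ q z.1 = z.2 := by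
      have h1 : ∀ᶠ z in 𝓝[≠] (t, q t) ⊓ 𝓟 G, z ∈ G := mem_inf_of_right (mem_principal_self G)
      have h2 : ∀ᶠ z in 𝓝[≠] (t, q t) ⊓ 𝓟 G, z ≠ (t, q t) :=
        mem_inf_of_left self_mem_nhdsWithin
      filter_upwards [h1, h2]
      rintro _ ⟨s, hs, rfl⟩ hst
      exact ⟨⟨hs, fun h => hst (congrArg (fun t => (t, q t)) h)⟩, rfl⟩
    -- If `(t, q t)` is not isolated in the graph, projecting its punctured neighbourhoods in the
    -- graph gives a forbidden filter. So the graph is discrete, hence countable by second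
    -- countability.
    refine hl t ht (map Prod.fst (𝓝[≠] (t, q t) ⊓ 𝓟 G)) inferInstance ?_ ?_
    · exact tendsto_nhdsWithin_iff.2 ⟨hfst, hev.mono fun z hz => hz.1⟩
    · rw [tendsto_map'_iff]
      exact (continuousAt_snd.tendsto.mono_left hle).congr' (hev.mono fun z hz => hz.2.symm)
  have hc : Countable G := TopologicalSpace.separableSpace_iff_countable.1 inferInstance
  exact hT (Set.countable_of_injective_of_countable_image hinj.injOn (Set.countable_coe_iff.1 hc))

/-- A linear form that vanishes on a tangent plane of an immersed surface vanishes to the second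
order on the surface. -/
lemma isLittleO_of_normal [IsManifold (𝓡 2) ∞ M] (hf : ContMDiff (𝓡 2) 𝓘(ℝ, R3) ∞ f) {m : M}
    (hi : Function.Injective (dmap f m)) (L : R3 →L[ℝ] ℝ) (hL : ∀ v, L (dmap f m v) = 0) :
    (fun y => L (f y - f m)) =o[𝓝 m] fun y => f y - f m := by
  have e : (extChartAt (𝓡 2) m).symm (extChartAt (𝓡 2) m m) = m := extChartAt_to_inv m
  have ht : extChartAt (𝓡 2) m m ∈ (extChartAt (𝓡 2) m).target := mem_extChartAt_target m
  have hs := (contMDiffOn_extChartAt_symm (I := 𝓡 2) (n := ∞) m).contMDiffAt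
    (extChartAt_target_mem_nhds m)
  have hi' := isInvertible_mfderivWithin_extChartAt_symm (I := 𝓡 2) ht
  rw [(𝓡 2).range_eq_univ, mfderivWithin_univ] at hi'
  have hd : DifferentiableAt ℝ (fun y => f ((extChartAt (𝓡 2) m).symm y))
      (extChartAt (𝓡 2) m m) :=
    (contMDiffAt_iff_contDiffAt.1 (hf.contMDiffAt.comp _ hs)).differentiableAt (by simp)
  have hfd := fderiv_comp_map (hf.mdifferentiable (by simp) _) (hs.mdifferentiableAt (by simp))
  -- Stated for any point equal to `m`, since the differential at the chart's image of `m` lives in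
  -- a tangent space whose type names that point.
  have hLe : ∀ n, n = m → ∀ v, L (dmap f n v) = 0 := by rintro _ rfl; exact hL
  have hie : ∀ n, n = m → Function.Injective (dmap f n) := by rintro _ rfl; exact hi
  have hinj : Function.Injective (fderiv ℝ (fun y => f ((extChartAt (𝓡 2) m).symm y))
      (extChartAt (𝓡 2) m m)) := fun u v huv => by
    rw [hfd, hfd] at huv
    exact hi'.bijective.injective (hie _ e huv)
  have hind : IsInducing (fderiv ℝ (fun y => f ((extChartAt (𝓡 2) m).symm y))
      (extChartAt (𝓡 2) m m)) :=
    (LinearMap.isClosedEmbedding_of_injective (LinearMap.ker_eq_bot.2 hinj)).isInducing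
  -- As the differential is injective, coordinate increments are bounded by a multiple of the
  -- increments of `f`.
  have h1 := (hd.hasFDerivAt.isTheta_sub hind).isBigO_symm
  have h2 : HasFDerivAt (fun y => L (f ((extChartAt (𝓡 2) m).symm y))) (0 : R2 →L[ℝ] ℝ)
      (extChartAt (𝓡 2) m m) := by
    refine (L.hasFDerivAt.comp _ hd.hasFDerivAt).congr_fderiv ?_
    ext1 u
    exact (congrArg L (hfd u)).trans (hLe _ e _)
  have h3 := (h2.isLittleO.trans_isBigO h1).comp_tendsto
    (continuousAt_extChartAt (I := 𝓡 2) m).tendsto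
  refine h3.congr' ?_ ?_
  · filter_upwards [extChartAt_source_mem_nhds (I := 𝓡 2) m] with y hy
    simp only [Function.comp_apply, (extChartAt (𝓡 2) m).left_inv hy, e]
    simp
  · filter_upwards [extChartAt_source_mem_nhds (I := 𝓡 2) m] with y hy
    simp only [Function.comp_apply, (extChartAt (𝓡 2) m).left_inv hy, e]

lemma IsCMCImmersion.exists_tangent_of_metric_eq_zero (hf : IsCMCImmersion κ τ H f N) {p : M}
    {u : R3} (hu : metric κ τ (f p) (N p) u = 0) : ∃ V, dmap f p V = u := by
  obtain ⟨a, b, h⟩ := hf.exists_frame p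
  have e := h.expand (coframe κ τ (f p) u)
  rw [dotProduct_comm, ← metric_eq_dot, hu, zero_smul, zero_add] at e
  exact ⟨_, coframe_injective (hf.mem p) ((frameMap_lin κ τ f p _ _ a b).trans e.symm)⟩

/-- A surface invariant under uncountably many isometries of a flow is tangent to the Killing field
that generates it. -/
theorem IsCMCImmersion.exists_tangent [IsManifold (𝓡 2) ∞ M] [SecondCountableTopology M]
    (hf : IsCMCImmersion κ τ H f N) {T : Set ℝ} (hT : ¬ T.Countable) {U : ℝ → Set R3}
    {Φ : ℝ → R3 → R3} {A : ℝ → (Fin 4 → ℝ) → Fin 4 → ℝ} {d : Fin 4 → ℝ} {r : ℝ → ℝ}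
    (hΦ : ∀ t ∈ T, IsLocalIsometry κ τ (U t) (Φ t) (A t)) (hA : ∀ t ∈ T, A t d = d)
    (hU : ∀ t ∈ T, ∀ p, f p ∈ U t) (hr : ∀ t ∈ T, r t ≠ 0)
    (hd : ∀ t ∈ T, ∀ x ∈ U t, HasDerivAt (fun s => Φ s x) (r t • kill κ τ d (Φ t x)) t)
    (hψ : ∀ t ∈ T, ∃ ψ : M ≃ₘ^∞⟮𝓡 2, 𝓡 2⟯ M, ∀ p, f (ψ p) = Φ t (f p)) (p : M) :
    ∃ V, dmap f p V = kill κ τ d (f p) := by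
  have : Nonempty (M ≃ₘ^∞⟮𝓡 2, 𝓡 2⟯ M) := ⟨Diffeomorph.refl _ _ _⟩
  choose! ψ hψ using hψ
  obtain ⟨t, ht, l, hl, hlt, hq⟩ := exists_frequently_graph hT fun t => ψ t p
  let L : R3 →L[ℝ] ℝ := LinearMap.toContinuousLinearMap
    { toFun := metric κ τ (f (ψ t p)) (N (ψ t p))
      map_add' := metric_add_right _ _ _ _
      map_smul' := fun r v => metric_smul_right _ _ _ _ v r }
  have hlT : ∀ᶠ s in l, s ∈ T \ {t} := hlt self_mem_nhdsWithin
  have hln : l ≤ 𝓝 t := hlt.trans nhdsWithin_le_nhds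
  have h1 : (fun s => Φ s (f p) - Φ t (f p)) =O[l] fun s => s - t :=
    (hd t ht _ (hU t ht p)).differentiableAt.isBigO_sub.mono hln
  have h2 : (fun s => L (Φ s (f p) - Φ t (f p))) =o[l] fun s => s - t := by
    -- Along `l` the points `Φ s (f p) = f (ψ s p)` lie on the surface with `ψ s p` tending to `ψ t
    -- p`, so their increment is tangent to first order. Compared with `h3`, this makes the velocity
    -- of the flow orthogonal to the normal at `ψ t p`.
    refine IsLittleO.trans_isBigO ?_ h1
    refine ((isLittleO_of_normal hf.smooth (hf.immersion (ψ t p)) L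
      (hf.normal (ψ t p))).comp_tendsto hq).congr' ?_ ?_
    all_goals
      filter_upwards [hlT] with s hs
      simp [hψ s hs.1, hψ t ht]
  have h3 : (fun s => L (Φ s (f p)) - L (Φ t (f p)) - (s - t) • L (r t • kill κ τ d (Φ t (f p))))
      =o[l] fun s => s - t :=
    ((hasDerivAt_iff_isLittleO.1 (L.hasFDerivAt.comp_hasDerivAt t
      (hd t ht _ (hU t ht p)))).mono hln)
  have h4 : (fun s => (s - t) * L (r t • kill κ τ d (Φ t (f p)))) =o[l] fun s => s - t := by
    refine (h2.sub h3).congr_left fun s => ?_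
    simp only [map_sub, smul_eq_mul]; ring
  have h5 : L (r t • kill κ τ d (Φ t (f p))) = 0 := by
    have h6 := h4.tendsto_div_nhds_zero
    refine tendsto_nhds_unique (tendsto_const_nhds.congr' ?_) h6
    filter_upwards [hlT] with s hs
    have : s - t ≠ 0 := sub_ne_zero.2 hs.2
    field_simp
  rw [map_smul, smul_eq_mul, mul_eq_zero, or_iff_right (hr t ht)] at h5
  have h7 : metric κ τ (f (ψ t p)) (N (ψ t p)) (kill κ τ d (Φ t (f p))) = 0 := h5
  obtain ⟨n1, n2⟩ := (hΦ t ht).normal_diffeo hf (hU t ht) (hψ t ht) p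
  refine hf.exists_tangent_of_metric_eq_zero ?_
  -- The tangency at `ψ t p` is pulled back to `p` by the isometry `Φ t`, which fixes the field `d`.
  rw [n1, metric_smul_middle, (hΦ t ht).kill_eq _ (hU t ht p), hA t ht, hψ t ht,
    (hΦ t ht).metric_eq _ (hU t ht p), ← hψ t ht] at h7
  refine (mul_eq_zero.1 h7).resolve_left fun h => ?_
  rw [h] at n2
  norm_num at n2

end Surface

/-- The translations in a fixed direction follow, up to the parametrization, the flow of a Killing
field. -/
lemma hasDerivAt_trans {κ τ e₀ e₁ t : ℝ} {x : R3} (hx : x ∈ transDom κ (t * e₀) (t * e₁))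
    (hb : 0 < 1 + κ / 4 * ((t * e₀) ^ 2 + (t * e₁) ^ 2)) :
    HasDerivAt (fun s => trans κ τ (s * e₀) (s * e₁) x)
      ((1 + κ / 4 * ((t * e₀) ^ 2 + (t * e₁) ^ 2))⁻¹ •
        kill κ τ ![e₀, e₁, 0, 0] (trans κ τ (t * e₀) (t * e₁) x)) t := by
  have hn := (sq_add_sq_pos hx.2).ne'
  have hp : ∀ a : ℝ, HasDerivAt (fun s : ℝ => s * a) a t := fun a => by
    simpa using (hasDerivAt_id t).mul_const a
  have hu : HasDerivAt (fun s : ℝ => transRe κ (s * e₀) (s * e₁) x)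
      (-(κ / 4 * (e₀ * x 0 + e₁ * x 1))) t :=
    ((((hp e₀).mul_const (x 0)).add ((hp e₁).mul_const (x 1))).const_mul (κ / 4)).const_sub 1
  have hy : HasDerivAt (fun s : ℝ => transIm κ (s * e₀) (s * e₁) x)
      (κ / 4 * (e₀ * x 1 - e₁ * x 0)) t :=
    (((hp e₀).mul_const (x 1)).sub ((hp e₁).mul_const (x 0))).const_mul (κ / 4)
  have h2 := (hu.pow 2).add (hy.pow 2)
  have hm := hb.ne'
  rw [hasDerivAt_pi]
  intro i
  fin_cases i
  · refine (((((hp e₀).add_const (x 0)).mul hu).sub (((hp e₁).add_const (x 1)).mul hy)).div h2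
      hn).congr_deriv ?_
    simp [trans, kill_apply, -mul_eq_mul_left_iff, -mul_eq_mul_right_iff]
    generalize hm' : 1 + κ / 4 * ((t * e₀) ^ 2 + (t * e₁) ^ 2) = m at hm ⊢
    generalize hu' : transRe κ (t * e₀) (t * e₁) x = u at hn ⊢
    generalize hy' : transIm κ (t * e₀) (t * e₁) x = y at hn ⊢
    field_simp
    rw [← hm', ← hu', ← hy']
    simp only [transRe, transIm]
    ring
  · refine (((((hp e₀).add_const (x 0)).mul hy).add (((hp e₁).add_const (x 1)).mul hu)).div h2
      hn).congr_deriv ?_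
    simp [trans, kill_apply, -mul_eq_mul_left_iff, -mul_eq_mul_right_iff]
    generalize hm' : 1 + κ / 4 * ((t * e₀) ^ 2 + (t * e₁) ^ 2) = m at hm ⊢
    generalize hu' : transRe κ (t * e₀) (t * e₁) x = u at hn ⊢
    generalize hy' : transIm κ (t * e₀) (t * e₁) x = y at hn ⊢
    field_simp
    rw [← hm', ← hu', ← hy']
    simp only [transRe, transIm]
    ring
  · by_cases hκ : κ = 0
    · subst hκ
      have key := ((((hp e₀).mul_const (x 1)).sub ((hp e₁).mul_const (x 0))).const_mul τ).const_add
        (x 2)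
      simp only [trans, if_true]
      refine key.congr_deriv ?_
      simp [transRe, transIm, kill_apply]
      ring
    · have key := ((hasDerivAt_arctan_half hu hy hx.2).const_mul
        (4 / (κ / (2 * τ)))).const_add (x 2)
      simp only [trans, hκ, if_false]
      refine key.congr_deriv ?_
      simp [kill_apply, -mul_eq_mul_left_iff, -mul_eq_mul_right_iff]
      generalize hm' : 1 + κ / 4 * ((t * e₀) ^ 2 + (t * e₁) ^ 2) = m at hm ⊢
      generalize hu' : transRe κ (t * e₀) (t * e₁) x = u at hn ⊢
      generalize hy' : transIm κ (t * e₀) (t * e₁) x = y at hn ⊢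
      field_simp
      rw [← hm', ← hu', ← hy']
      simp only [transRe, transIm]
      ring

lemma adjoint_tangent (κ τ e₀ e₁ t : ℝ) :
    adjoint κ τ (t * e₀) (t * e₁) ![e₀, e₁, 0, 0] = ![e₀, e₁, 0, 0] := by
  have h : t * e₀ * e₁ - t * e₁ * e₀ = 0 := by ring
  ext i
  fin_cases i <;> simp [adjoint, h]

/-! ### The one-parameter families of translations -/

section Family

variable {M : Type*} [TopologicalSpace M] [ChartedSpace R2 M] [IsManifold (𝓡 2) ∞ M]
  {κ τ H : ℝ} {f N : M → R3}

/-- A surface invariant under all small translations in one direction is tangent to their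
generator. -/
theorem IsCMCImmersion.exists_tangent_of_trans [SecondCountableTopology M]
    (hf : IsCMCImmersion κ τ H f N) {e₀ e₁ δ : ℝ} (hδ : 0 < δ)
    (h : ∀ t : ℝ, |t| < δ → (∀ p, f p ∈ transDom κ (t * e₀) (t * e₁)) ∧
      ∃ ψ : M ≃ₘ^∞⟮𝓡 2, 𝓡 2⟯ M, ∀ p, f (ψ p) = trans κ τ (t * e₀) (t * e₁) (f p)) (p : M) :
    ∃ V, dmap f p V = kill κ τ ![e₀, e₁, 0, 0] (f p) := by
  -- Parameters with `1 + (κ/4)|te|² ≤ 0` are discarded. The rest is open and contains `0`, so it is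
  -- uncountable.
  let T : Set ℝ := {t | |t| < δ} ∩ {t | 0 < 1 + κ / 4 * ((t * e₀) ^ 2 + (t * e₁) ^ 2)}
  have hTo : IsOpen T :=
    (isOpen_lt (by fun_prop) continuous_const).inter (isOpen_lt continuous_const (by fun_prop))
  have hT : ¬ T.Countable := fun hc => by
    obtain ⟨r, hr, hrT⟩ := Metric.isOpen_iff.1 hTo 0 (by simp [T, hδ])
    rw [Real.ball_eq_Ioo] at hrT
    have h1 := Cardinal.le_aleph0_iff_set_countable.2 (hc.mono hrT)
    rw [Cardinal.mk_Ioo_real (by linarith)] at h1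
    exact Cardinal.aleph0_lt_continuum.not_ge h1
  exact hf.exists_tangent hT (fun t ht => isLocalIsometry_trans ht.2)
    (fun t _ => adjoint_tangent κ τ e₀ e₁ t) (fun t ht => (h t ht.1).1)
    (fun t ht => inv_ne_zero ht.2.ne') (fun t ht x hx => hasDerivAt_trans hx ht.2)
    (fun t ht => (h t ht.1).2) p

variable {F1 F2 F3 FR : R3 → R3}

/-- The exact Noether forms of a surface that is tangent to `S₁`. -/
theorem IsCMCImmersion.isExact_of_tangent_S1 (hf : IsCMCImmersion κ τ H f N)
    (hF1 : IsPotential κ τ F1 (S1 κ τ)) (hF2 : IsPotential κ τ F2 (S2 κ τ))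
    (hF3 : IsPotential κ τ F3 S3) (hFR : IsPotential κ τ FR SR)
    (hd : ∀ p, ∃ V, dmap f p V = kill κ τ ![1, 0, 0, 0] (f p)) (r s : ℝ) :
    IsExact fun p v => r * noetherForm κ τ H f N (S2 κ τ ∘ f) (F2 ∘ f) p v
      + s * (κ * noetherForm κ τ H f N (SR ∘ f) (FR ∘ f) p v
        + 2 * τ * noetherForm κ τ H f N (S3 ∘ f) (F3 ∘ f) p v) := by
  have e : (![1, 0, 0, 0] : Fin 4 → ℝ) = Pi.single 0 1 := by
    ext i; fin_cases i <;> simp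
  -- The coefficients `![0, -s, 0, r]` are chosen so that `bracket1` is `![0, r, 2τs, κs]`.
  rw [e] at hd
  have key := hf.isExact_noetherForm_bracket hd (c := ![0, -s, 0, r])
    (b := bracket1 κ τ ![0, -s, 0, r]) (fun x => by rw [kill_single_zero, kill_bracket1])
    (isPotential_combination hF1 hF2 hF3 hFR _)
  convert key using 3 with p v
  rw [noetherForm_combination, Fin.sum_univ_four]
  simp [bracket1]
  ring

/-- The exact Noether forms of a surface that is tangent to `S₂`. -/
theorem IsCMCImmersion.isExact_of_tangent_S2 (hf : IsCMCImmersion κ τ H f N)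
    (hF1 : IsPotential κ τ F1 (S1 κ τ)) (hF2 : IsPotential κ τ F2 (S2 κ τ))
    (hF3 : IsPotential κ τ F3 S3) (hFR : IsPotential κ τ FR SR)
    (hd : ∀ p, ∃ V, dmap f p V = kill κ τ ![0, 1, 0, 0] (f p)) (r s : ℝ) :
    IsExact fun p v => r * noetherForm κ τ H f N (S1 κ τ ∘ f) (F1 ∘ f) p v
      + s * (κ * noetherForm κ τ H f N (SR ∘ f) (FR ∘ f) p v
        + 2 * τ * noetherForm κ τ H f N (S3 ∘ f) (F3 ∘ f) p v) := by
  have e : (![0, 1, 0, 0] : Fin 4 → ℝ) = Pi.single 1 1 := by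
    ext i; fin_cases i <;> simp
  -- The coefficients `![s, 0, 0, -r]` are chosen so that `bracket2` is `![r, 0, 2τs, κs]`.
  rw [e] at hd
  have key := hf.isExact_noetherForm_bracket hd (c := ![s, 0, 0, -r])
    (b := bracket2 κ τ ![s, 0, 0, -r]) (fun x => by rw [kill_single_one, kill_bracket2])
    (isPotential_combination hF1 hF2 hF3 hFR _)
  convert key using 3 with p v
  rw [noetherForm_combination, Fin.sum_univ_four]
  simp [bracket2]
  ring

end Family

end NoetherE3

end

/-! ### The theorem -/

open NoetherE3 in
theorem mainTheorem3 {M : Type*} [TopologicalSpace M] [T2Space M] [SecondCountableTopology M]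
    [ConnectedSpace M] [ChartedSpace R2 M] [IsManifold (𝓡 2) ∞ M]
    (κ τ H : ℝ) (hτ : τ ≠ 0) (f N : M → R3) (hf : IsCMCImmersion κ τ H f N)
    (F1 F2 F3 FR : R3 → R3)
    (hF1 : IsPotential κ τ F1 (S1 κ τ)) (hF2 : IsPotential κ τ F2 (S2 κ τ))
    (hF3 : IsPotential κ τ F3 S3) (hFR : IsPotential κ τ FR SR)
    (μ₁ μ₂ μ₃ μR : OneForm M)
    (hμ₁ : μ₁ = noetherForm κ τ H f N (S1 κ τ ∘ f) (F1 ∘ f))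
    (hμ₂ : μ₂ = noetherForm κ τ H f N (S2 κ τ ∘ f) (F2 ∘ f))
    (hμ₃ : μ₃ = noetherForm κ τ H f N (S3 ∘ f) (F3 ∘ f))
    (hμR : μR = noetherForm κ τ H f N (SR ∘ f) (FR ∘ f)) :
    -- invariance under one translation of the first family
    (∀ t : ℝ, t ≠ 0 → 0 < 1 + κ / 4 * t ^ 2 → (∀ p, f p ∈ dom1 κ t) →
      ∀ ψ : M ≃ₘ^∞⟮𝓡 2, 𝓡 2⟯ M, (∀ p, f (ψ p) = trans1 κ τ t (f p)) →
      ∀ c : Chain M 1, IsCycle c → Homologous c (c.push ψ) →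
        (κ = 0 → integral μ₂ c = 0 ∧ integral μ₃ c = 0) ∧
        (κ ≠ 0 → integral μ₂ c = 0 ∧ κ * integral μR c + 2 * τ * integral μ₃ c = 0)) ∧
    -- invariance under one translation of the second family
    (∀ t : ℝ, t ≠ 0 → 0 < 1 + κ / 4 * t ^ 2 → (∀ p, f p ∈ dom2 κ t) →
      ∀ ψ : M ≃ₘ^∞⟮𝓡 2, 𝓡 2⟯ M, (∀ p, f (ψ p) = trans2 κ τ t (f p)) →
      ∀ c : Chain M 1, IsCycle c → Homologous c (c.push ψ) →
        (κ = 0 → integral μ₁ c = 0 ∧ integral μ₃ c = 0) ∧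
        (κ ≠ 0 → integral μ₁ c = 0 ∧ κ * integral μR c + 2 * τ * integral μ₃ c = 0)) ∧
    -- invariance under the translations of the first family
    (∀ ε : ℝ, 0 < ε →
      (∀ t : ℝ, |t| < ε → (∀ p, f p ∈ dom1 κ t) ∧
        ∃ ψ : M ≃ₘ^∞⟮𝓡 2, 𝓡 2⟯ M, ∀ p, f (ψ p) = trans1 κ τ t (f p)) →
      (κ = 0 → IsExact μ₂ ∧ IsExact μ₃) ∧
      (κ ≠ 0 → IsExact μ₂ ∧ IsExact (fun p v => κ * μR p v + 2 * τ * μ₃ p v))) ∧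
    -- invariance under the translations of the second family
    (∀ ε : ℝ, 0 < ε →
      (∀ t : ℝ, |t| < ε → (∀ p, f p ∈ dom2 κ t) ∧
        ∃ ψ : M ≃ₘ^∞⟮𝓡 2, 𝓡 2⟯ M, ∀ p, f (ψ p) = trans2 κ τ t (f p)) →
      (κ = 0 → IsExact μ₁ ∧ IsExact μ₃) ∧
      (κ ≠ 0 → IsExact μ₁ ∧ IsExact (fun p v => κ * μR p v + 2 * τ * μ₃ p v))) ∧
    -- invariance under one rotation
    (∀ t : ℝ, (∀ k : ℤ, t ≠ 2 * Real.pi * k) →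
      ∀ ψ : M ≃ₘ^∞⟮𝓡 2, 𝓡 2⟯ M, (∀ p, f (ψ p) = transR t (f p)) →
      (H = 0 → Real.cos t = -1 → ∀ p, N (ψ p) = fderiv ℝ (transR t) (f p) (N p)) →
      ∀ c : Chain M 1, IsCycle c → Homologous c (c.push ψ) →
        integral μ₁ c = 0 ∧ integral μ₂ c = 0) := by 
  subst hμ₁ hμ₂ hμ₃ hμR
  refine ⟨?_, ?_, ?_, ?_, ?_⟩
  · intro t ht hb hU ψ hψ c hc hc'
    obtain ⟨h1, h2, h3⟩ := periods_of_translation (b₀ := t) (b₁ := 0) hτ hf hF1 hF2 hF3 hFR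
      (by simpa using ht) (by simpa using hb)
      (fun p => mem_transDom_of_dom1 (hf.mem p) (hU p))
      (fun p => by rw [hψ, trans1_eq]) hc hc'
    have h2' := (mul_eq_zero.1 (by simpa using h2 : t * _ = 0)).resolve_left ht
    exact ⟨fun hκ => ⟨h2', h1 hκ⟩, fun _ => ⟨h2', h3⟩⟩
  · intro t ht hb hU ψ hψ c hc hc'
    obtain ⟨h1, h2, h3⟩ := periods_of_translation (b₀ := 0) (b₁ := t) hτ hf hF1 hF2 hF3 hFR
      (by simpa using ht) (by simpa using hb)
      (fun p => mem_transDom_of_dom2 (hf.mem p) (hU p))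
      (fun p => by rw [hψ, trans2_eq]) hc hc'
    have h2' := (mul_eq_zero.1 (by simpa using h2 : t * _ = 0)).resolve_left ht
    exact ⟨fun hκ => ⟨h2', h1 hκ⟩, fun _ => ⟨h2', h3⟩⟩
  · intro ε hε h
    have hd := hf.exists_tangent_of_trans (e₀ := 1) (e₁ := 0) hε fun t ht => by
      obtain ⟨hU, ψ, hψ⟩ := h t ht
      simp only [mul_one, mul_zero, ← trans1_eq]
      exact ⟨fun p => mem_transDom_of_dom1 (hf.mem p) (hU p), ψ, hψ⟩
    have key := hf.isExact_of_tangent_S1 hF1 hF2 hF3 hFR hd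
    have h2 := key 1 0
    simp only [one_mul, zero_mul, add_zero] at h2
    refine ⟨fun hκ => ⟨h2, ?_⟩, fun _ => ⟨h2, by simpa using key 0 1⟩⟩
    subst hκ
    -- For `κ = 0` only `2τ μ₃` remains of the second form, and the factor `(2τ)⁻¹` isolates `μ₃`.
    simpa [← mul_assoc, hτ] using key 0 (2 * τ)⁻¹
  · intro ε hε h
    have hd := hf.exists_tangent_of_trans (e₀ := 0) (e₁ := 1) hε fun t ht => by
      obtain ⟨hU, ψ, hψ⟩ := h t ht
      simp only [mul_one, mul_zero, ← trans2_eq]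
      exact ⟨fun p => mem_transDom_of_dom2 (hf.mem p) (hU p), ψ, hψ⟩
    have key := hf.isExact_of_tangent_S2 hF1 hF2 hF3 hFR hd
    have h1 := key 1 0
    simp only [one_mul, zero_mul, add_zero] at h1
    refine ⟨fun hκ => ⟨h1, ?_⟩, fun _ => ⟨h1, by simpa using key 0 1⟩⟩
    subst hκ
    simpa [← mul_assoc, hτ] using key 0 (2 * τ)⁻¹
  · intro t ht ψ hψ ho c hc hc'
    refine periods_of_rotation hf hF1 hF2 hF3 hFR (fun h => ?_) hψ ho hc hc'
    obtain ⟨k, hk⟩ := (Real.cos_eq_one_iff t).1 h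
    exact ht k (by rw [← hk]; ring)
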